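/- **Conventions.** Let $d,n,N\in\mathbb N$, $m\in\mathbb R$, $\langle\xi\rangle=(1+|\xi|^2)^{1/2}$, $\hat v(\xi)=\int_{\mathbb R^d}e^{-ix\cdot\xi}v(x)\,dx$, with inverse $\mathcal F^{-1}g(x)=(2\pi)^{-d}\int_{\mathbb R^d}e^{ix\cdot\xi}g(\xi)\,d\xi$. For $j\in\mathbb N$ and $r\in\mathbb R$ let $\|v\|_{j,r}=(2\pi)^{-d/2}\|\langle 2^{-j}\xi\rangle^{r}\hat v(\xi)\|_{L^2(\mathbb R^d_\xi)}$, and $\|v\|_{H^r}=\|v\|_{0,r}$. *Symbols.* $C^\infty S^m$ is the set of smooth maps $\sigma:\mathbb R^{n}\times\mathbb R^d\to\mathbb C^{N\times N}$ (in particular, real matrix-valued maps) such that for all multi-indices $\alpha,\beta$ there is a nondecreasing function $C_{\alpha\beta}$ with $\langle\xi\rangle^{|\beta|-m}|\partial_w^\alpha\partial_\xi^\beta\sigma(w,\xi)|\le C_{\alpha\beta}(|w|)$ for all $(w,\xi)\in\mathbb R^n\times\mathbb R^d$. *Cut-offs.* A Littlewood–Paley cut-off on $V=\mathbb R^d$ or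 $V=\mathbb R$ is a smooth $\phi_0:V\to[0,1]$ with $\phi_0=1$ for $|\xi|\le\varepsilon_1$ and $\phi_0=0$ for $|\xi|\ge\varepsilon_2$, for some $0<\varepsilon_1<\varepsilon_2<1<2\varepsilon_1$; put $\phi_k(\xi)=\phi_0(2^{-k}\xi)-\phi_0(2^{-k+1}\xi)$ for $k\ge1$. Fix Littlewood–Paley cut-offs $\phi_0$ on $\mathbb R^d$ and $\chi_0$ on $\mathbb R$, and an integer $N_0\ge3$, and let $$\phi_{adm}(\eta,\xi)=\sum_{k\ge0}\phi_0(2^{-k+N_0}\eta)\,\chi_k(\langle\xi\rangle).$$ *Operators.* For a symbol $a(x,\xi)$ and $v\in\mathcal S(\mathbb R^d;\mathbb C^N)$, let $$\mathrm{pdo}(a)v(x)=(2\pi)^{-d}\int_{\mathbb R^d} e^{ix\cdot\xi}a(x,\xi)\hat v(\xi)\,d\xi,\qquad \mathrm{op}(a)=\mathrm{pdo}(a_{\phi_{adm}}),\qquad a_{\phi_{adm}}(\cdot,\xi)=\big(\mathcal F^{-1}\phi_{adm}(\cdot,\xi)\big)\star a(\cdot,\xi),$$ with convolution in $x$. In $2^{-j}$-semiclassical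 quantization, $$\mathrm{pdo}_j(a)v(x)=(2\pi)^{-d}\int_{\mathbb R^d} e^{ix\cdot\xi}a(x,2^{-j}\xi)\hat v(\xi)\,d\xi,\qquad \mathrm{op}_j(a)=H_j^{-1}\,\mathrm{op}(h_ja)\,H_j,$$ where $(h_ja)(x,\xi)=a(2^{-j}x,\xi)$ and $(H_jv)(x)=2^{-jd/2}v(2^{-j}x)$. **Proposition.** Let $\sigma\in C^\infty S^m$ and $s>d/2$. There is a nondecreasing function $C:[0,\infty)\to[0,\infty)$, depending only on $\sigma,m,s,d$ and the cut-offs, such that for all $u\in H^s(\mathbb R^d;\mathbb R^n)$ and all $j\in\mathbb N$, with $a(x,\xi)=\sigma(u(x),\xi)$: 1. $\mathrm{pdo}_j(a)-\mathrm{op}_j(a)$, defined on $\mathcal S(\mathbb R^d;\mathbb C^N)$, extends to a linear map from $H^{m+d/2}(\mathbb R^d;\mathbb C^N)$ to $L^2(\mathbb R^d;\mathbb C^N)$ with $$\big\|\big(\mathrm{pdo}_j(a)-\mathrm{op}_j(a)\big)v\big\|_{L^2}\le 2^{-j(s-d/2)}\,C(\|u\|_{L^\infty})\,\|u\|_{H^s}\,\|v\|_{j,m+d/2}\qquad\text{for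 all }v\in H^{m+d/2};$$ 2. if moreover $s>d$, then $\mathrm{pdo}_j(a)-\mathrm{op}_j(a)$ extends to a linear map from $H^{m}(\mathbb R^d;\mathbb C^N)$ to $L^2(\mathbb R^d;\mathbb C^N)$ with $$\big\|\big(\mathrm{pdo}_j(a)-\mathrm{op}_j(a)\big)v\big\|_{L^2}\le 2^{-j(s-d)}\,C(\|u\|_{L^\infty})\,\|u\|_{H^s}\,\|v\|_{j,m}\qquad\text{for all }v\in H^{m}.$$ -/

import Mathlib

open MeasureTheory TemperedDistribution
open scoped ENNReal NNReal SchwartzMap FourierTransform ContDiff RealInnerProductSpace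

noncomputable section

namespace ParaDiff

/-- Euclidean space `ℝ^d`. -/
abbrev Sp (d : ℕ) : Type := EuclideanSpace ℝ (Fin d)

/-- The space `ℂ^N` in which the functions acted upon take their values. -/
abbrev Val (N : ℕ) : Type := EuclideanSpace ℂ (Fin N)

/-- Complex `N × N` matrices, seen as endomorphisms of `ℂ^N` with the operator norm. -/
abbrev Mat (N : ℕ) : Type := Val N →L[ℂ] Val N

/-- The Japanese bracket `⟨ξ⟩ = (1 + |ξ|^2)^{1/2}`. -/
def jap {V : Type*} [Norm V] (ξ : V) : ℝ := Real.sqrt (1 + ‖ξ‖ ^ 2)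

/-! ### Fourier transform in angular frequency -/

/-- `û(ξ) = ∫ e^{-i x·ξ} u(x) dx`. -/
def hat {d : ℕ} {F : Type*} [NormedAddCommGroup F] [NormedSpace ℂ F]
    (u : Sp d → F) (ξ : Sp d) : F :=
  ∫ x : Sp d, Complex.exp (-(Complex.I * (⟪x, ξ⟫ : ℝ))) • u x

/-- `(2π)^{-d} ∫ e^{i x·ξ} g(ξ) dξ`, the inverse of `hat`. -/
def invHat {d : ℕ} {F : Type*} [NormedAddCommGroup F] [NormedSpace ℂ F]
    (g : Sp d → F) (x : Sp d) : F :=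
  (((2 * Real.pi) ^ d)⁻¹ : ℝ) • ∫ ξ : Sp d, Complex.exp (Complex.I * (⟪x, ξ⟫ : ℝ)) • g ξ

/-! ### Littlewood-Paley decomposition and admissible cut-offs -/

/-- A smooth low-frequency truncation function `φ₀`, `0 ≤ φ₀ ≤ 1`, equal to one for `|ξ| ≤ ε₁` and
to zero for `|ξ| ≥ ε₂`, where `0 < ε₁ < ε₂ < 1 < 2 ε₁`. -/
def IsLPCutoff {V : Type*} [NormedAddCommGroup V] [NormedSpace ℝ V] (φ₀ : V → ℝ) : Prop :=
  ContDiff ℝ ∞ φ₀ ∧ (∀ ξ, 0 ≤ φ₀ ξ ∧ φ₀ ξ ≤ 1) ∧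
    ∃ ε₁ ε₂ : ℝ, 0 < ε₁ ∧ ε₁ < ε₂ ∧ ε₂ < 1 ∧ 1 < 2 * ε₁ ∧
      (∀ ξ, ‖ξ‖ ≤ ε₁ → φ₀ ξ = 1) ∧ (∀ ξ, ε₂ ≤ ‖ξ‖ → φ₀ ξ = 0)

/-- The dyadic decomposition generated by `φ₀`: the function of index `0` is `φ₀`, the function of
index `k ≥ 1` is `φ₀(2^{-k} ξ) - φ₀(2^{-k+1} ξ)`. -/
def lpPiece {V : Type*} [NormedAddCommGroup V] [NormedSpace ℝ V] (φ₀ : V → ℝ) (k : ℕ) (ξ : V) :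
    ℝ :=
  if k = 0 then φ₀ ξ
  else φ₀ ((2 : ℝ) ^ (-(k : ℤ)) • ξ) - φ₀ ((2 : ℝ) ^ (-(k : ℤ) + 1) • ξ)

/-- The admissible cut-off `φ_adm(η, ξ) = ∑_{k ≥ 0} φ₀(2^{-k+N₀} η) χ_k(⟨ξ⟩)`; here `χ_k` is the
dyadic decomposition of the line generated by `χ₀`. At each point the sum has finitely many nonzero
terms. -/
def admCutoff {d : ℕ} (φ₀ : Sp d → ℝ) (χ₀ : ℝ → ℝ) (N₀ : ℕ) (η ξ : Sp d) : ℝ :=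
  ∑' k : ℕ, φ₀ ((2 : ℝ) ^ (-(k : ℤ) + (N₀ : ℤ)) • η) * lpPiece χ₀ k (jap ξ)

/-! ### Symbols -/

/-- The class `C^∞ S^m`: `σ(w, ξ)` is smooth in both arguments and, for all `k, l`, the derivatives
of order `k` in `w` and `l` in `ξ` are bounded by `C_{kl}(|w|) ⟨ξ⟩^{m - l}` with `C_{kl}`
nondecreasing. -/
def IsSmoothSymbol {d n N : ℕ} (m : ℝ) (σ : Sp n → Sp d → Mat N) : Prop :=
  ContDiff ℝ ∞ (Function.uncurry σ) ∧
    ∀ k l : ℕ, ∃ C : ℝ → ℝ, Monotone C ∧ ∀ (w : Sp n) (ξ : Sp d),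
      jap ξ ^ ((l : ℝ) - m) *
        ‖iteratedFDeriv ℝ k (fun w' => iteratedFDeriv ℝ l (fun ξ' => σ w' ξ') ξ) w‖ ≤ C ‖w‖

/-- The para-differential symbol: the convolution, in `x`, of `a(·, ξ)` with the inverse Fourier
transform of `φ_adm(·, ξ)`. -/
def paraSymbol {d N : ℕ} (φ₀ : Sp d → ℝ) (χ₀ : ℝ → ℝ) (N₀ : ℕ)
    (a : Sp d → Sp d → Mat N) (x ξ : Sp d) : Mat N :=
  ∫ y : Sp d, invHat (fun η => (admCutoff φ₀ χ₀ N₀ η ξ : ℂ)) y • a (x - y) ξ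

/-! ### Operators -/

/-- The pseudo-differential operator with symbol `a` in classical quantization,
`(pdo(a) v)(x) = (2π)^{-d} ∫ e^{i x·ξ} a(x, ξ) v̂(ξ) dξ`. -/
def pdo {d N : ℕ} (a : Sp d → Sp d → Mat N) (v : Sp d → Val N) (x : Sp d) : Val N :=
  invHat (fun ξ => a x ξ (hat v ξ)) x

/-- The para-differential operator with symbol `a` in classical quantization. -/
def op {d N : ℕ} (φ₀ : Sp d → ℝ) (χ₀ : ℝ → ℝ) (N₀ : ℕ)
    (a : Sp d → Sp d → Mat N) (v : Sp d → Val N) : Sp d → Val N :=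
  pdo (paraSymbol φ₀ χ₀ N₀ a) v

/-- `(h_j f)(x) = f(2^{-j} x)`; on a symbol, `h_j` acts in the first variable. -/
def dil {d : ℕ} {X : Type*} (j : ℕ) (f : Sp d → X) (x : Sp d) : X :=
  f ((2 : ℝ) ^ (-(j : ℤ)) • x)

/-- `H_j = 2^{-jd/2} h_j`. -/
def dilU {d N : ℕ} (j : ℕ) (v : Sp d → Val N) (x : Sp d) : Val N :=
  ((2 : ℝ) ^ (-((j : ℝ) * d / 2))) • dil j v x

/-- The inverse of `H_j`. -/
def dilUInv {d N : ℕ} (j : ℕ) (v : Sp d → Val N) (x : Sp d) : Val N :=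
  ((2 : ℝ) ^ ((j : ℝ) * d / 2)) • v ((2 : ℝ) ^ (j : ℤ) • x)

/-- The pseudo-differential operator in `2^{-j}`-semiclassical quantization,
`(pdo_j(a) v)(x) = (2π)^{-d} ∫ e^{i x·ξ} a(x, 2^{-j} ξ) v̂(ξ) dξ`. -/
def pdoJ {d N : ℕ} (j : ℕ) (a : Sp d → Sp d → Mat N) (v : Sp d → Val N) (x : Sp d) : Val N :=
  invHat (fun ξ => a x ((2 : ℝ) ^ (-(j : ℤ)) • ξ) (hat v ξ)) x

/-- The para-differential operator in `2^{-j}`-semiclassical quantization,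
`op_j(a) = H_j^{-1} op(h_j a) H_j`. -/
def opJ {d N : ℕ} (φ₀ : Sp d → ℝ) (χ₀ : ℝ → ℝ) (N₀ : ℕ) (j : ℕ)
    (a : Sp d → Sp d → Mat N) (v : Sp d → Val N) : Sp d → Val N :=
  dilUInv j (op φ₀ χ₀ N₀ (dil j a) (dilU j v))

/-! ### Sobolev spaces and norms -/

/-- The Sobolev space `H^r(ℝ^d; ℂ^N)` of tempered distributions. -/
def HSpace (d N : ℕ) (r : ℝ) : Submodule ℂ 𝓢'(Sp d, Val N) where
  carrier := {f | MemSobolev r 2 f}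
  add_mem' := fun hf hg => hf.add hg
  zero_mem' := memSobolev_fun_zero _ _ r 2
  smul_mem' := fun c _ hf => hf.smul c

/-- Schwartz functions as elements of `H^r`. -/
def schwartzToH {d N : ℕ} (r : ℝ) (v : 𝓢(Sp d, Val N)) : HSpace d N r :=
  ⟨(v : 𝓢'(Sp d, Val N)), v.memSobolev⟩

/-- The weighted Sobolev norm `‖v‖_{j,r} = ‖⟨2^{-j} ξ⟩^r v̂(ξ)‖_{L²}` (with the measure
`dξ / (2π)^d`, which makes it `‖⟨2^{-j} D⟩^r v‖_{L²}`), with value `∞` when `⟨2^{-j} ξ⟩^r v̂(ξ)` is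
not in `L²`. Mathlib's `𝓕 v` is `v̂` evaluated at `2π` times the frequency, hence the factor `2π`.
The function `g` below is unique when it exists. -/
def wNorm {d N : ℕ} (j : ℕ) (r : ℝ) (v : 𝓢'(Sp d, Val N)) : ℝ≥0∞ :=
  ⨅ (g : Lp (Val N) 2 (volume : Measure (Sp d)))
    (_ : smulLeftCLM (Val N)
      (fun ξ : Sp d => ((jap ((2 : ℝ) ^ (-(j : ℤ)) • ((2 * Real.pi) • ξ)) ^ r : ℝ) : ℂ)) (𝓕 v)
        = (g : 𝓢'(Sp d, Val N))), ‖g‖ₑ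

/-- A function with values in `ℝ^n`, seen as a function with values in `ℂ^n`. -/
def complexify {d n : ℕ} (u : Sp d → Sp n) (x : Sp d) : Val n :=
  WithLp.toLp 2 (fun i => ((u x i : ℝ) : ℂ))

/-- The `H^s` norm of an `ℝ^n`-valued function, for `s ≥ 0`; it is `∞` when the function is not
in `L²` or not in `H^s`. -/
def hsNorm {d n : ℕ} (s : ℝ) (u : Sp d → Sp n) : ℝ≥0∞ :=
  ⨅ h : MemLp (complexify u) 2 (volume : Measure (Sp d)),
    wNorm 0 s ((h.toLp (complexify u) : Lp (Val n) 2 (volume : Measure (Sp d))) :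
      𝓢'(Sp d, Val n))

/-- `u ∈ H^s(ℝ^d; ℝ^n)`, for `s ≥ 0`. -/
def MemHs {d n : ℕ} (s : ℝ) (u : Sp d → Sp n) : Prop :=
  ∃ h : MemLp (complexify u) 2 (volume : Measure (Sp d)),
    MemSobolev s 2 ((h.toLp (complexify u) : Lp (Val n) 2 (volume : Measure (Sp d))) :
      𝓢'(Sp d, Val n))

/-- `pdo_j(a) - op_j(a)`, on functions for which both terms are given by their defining
integrals. -/
def diffJ {d N : ℕ} (φ₀ : Sp d → ℝ) (χ₀ : ℝ → ℝ) (N₀ : ℕ) (j : ℕ)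
    (a : Sp d → Sp d → Mat N) (v : Sp d → Val N) (x : Sp d) : Val N :=
  pdoJ j a v x - opJ φ₀ χ₀ N₀ j a v x

/-- `T : H^r → L²` agrees on Schwartz functions with the operator `A`. -/
def Extends {d N : ℕ} {r : ℝ}
    (T : HSpace d N r →ₗ[ℂ] Lp (Val N) 2 (volume : Measure (Sp d)))
    (A : (Sp d → Val N) → Sp d → Val N) : Prop :=
  ∀ v : 𝓢(Sp d, Val N), T (schwartzToH r v) =ᵐ[volume] A v

end ParaDiff

end

/-!
# Para-differential approximation in semiclassical quantization

Write `U` for the continuous representative of `u`, `a(x, ξ) = σ(U(x), ξ)`, and `ψ` for the inverse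
Fourier transform of `φ₀`.

At a frequency `ξ` in the dyadic shell `⟨ξ⟩ ~ 2^k`, the para-differential smoothing convolves
`a(·, ξ)` with the kernel `ψ` dilated to scale `2^{-(k - N₀)}`. Conjugation with the dilations `H_j`
shrinks this scale to `2^{-(j + k - N₀)}`, so `pdo_j(a) - op_j(a)` is the operator with
Fourier-side kernel `e^{2πi x·ξ} r(x, 2^{-j} 2π ξ)`, where `r(·, ξ)` (`highSymbol`) is the part of
`a(·, ξ)` at frequencies above `2^{j+k-N₀}`; this is `diffJ_eq_integral`.

The high frequencies of `a(·, ξ)` are controlled by a tame composition estimate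
(`exists_eLpNorm_highPart_comp_le`): the part of `F ∘ U` at scales below `t` has `L²` norm
`≲ t^s ‖u‖_{H^s}`, with a constant that depends only on `sup |U|` and on bounds for finitely many
derivatives of `F` on a ball. It is proved by telescoping
`F(U) = (F(U) - F(U_N)) + ∑_q (F(U_{q+1}) - F(U_q)) + F(U_0)` over the frequency truncations `U_q`
of `U`. Each difference is linear in `U_{q+1} - U_q`, whose `L²` norm is `≲ 2^{-qs} ‖u‖_{H^s}`; its
derivatives obey Bernstein's inequalities; and, since all moments of `ψ` of positive order vanish,
removing the average against `ψ` gains any power of `2^q t`.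

Applied to `F = σ(·, ξ)` and `t = 2^{-(j + k - N₀)}`, this gives
`‖r(·, ξ)‖_{L²} ≲ 2^{-js} ⟨ξ⟩^{m-s} ‖u‖_{H^s}`. After division by `⟨2^{-j} ξ⟩^r` with `r ≥ m`, the
kernel is square integrable in `(x, ξ)` because `⟨ξ⟩^{-s} ∈ L²` for `s > d/2`, and the change of
variables `ξ ↦ 2^{-j} ξ` costs the factor `2^{jd/2}`. Hence the remainder is a Hilbert-Schmidt
operator composed with `v ↦ ⟨2^{-j} ξ⟩^r v̂`, with norm `≲ 2^{-j(s - d/2)} ‖u‖_{H^s}`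
(`exists_operator_of_highPart_le`). This holds for every `r ≥ m`: the choice `r = m + d/2` is the
first estimate, and `r = m` gives the second one, even with the better power of `2^{-j}`.
-/

set_option maxSynthPendingDepth 3

namespace ParaDiff

universe u

/-! ### Differences of compositions -/

/-- A tame pointwise estimate for `D^k (F ∘ v - F ∘ w)`, linear in the derivatives of `v - w`.
The induction differentiates once and splits
`F'(v) v' - F'(w) w' = (F'(v) - F'(w)) v' + F'(w) (v' - w')`. -/
theorem exists_norm_iteratedFDeriv_comp_sub_comp_le {X : Type*} {E : Type u}
    [NormedAddCommGroup X] [NormedSpace ℝ X] [NormedAddCommGroup E] [NormedSpace ℝ E] (k : ℕ) :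
    ∃ c : ℝ, 0 ≤ c ∧ ∀ i ≤ k, ∀ (Y : Type u) [NormedAddCommGroup Y] [NormedSpace ℝ Y]
      (F : E → Y) (v w : X → E) (x : X) (M D l R : ℝ), ContDiff ℝ ∞ F → ContDiff ℝ ∞ v →
      ContDiff ℝ ∞ w → 0 ≤ M → 0 ≤ D → 0 ≤ l → ‖v x‖ ≤ R → ‖w x‖ ≤ R →
      (∀ a ≤ i + 1, ∀ z, ‖z‖ ≤ R → ‖iteratedFDeriv ℝ a F z‖ ≤ M) →
      (∀ a, 1 ≤ a → a ≤ i → ‖iteratedFDeriv ℝ a v x‖ ≤ D ^ a) →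
      (∀ a, 1 ≤ a → a ≤ i → ‖iteratedFDeriv ℝ a w x‖ ≤ D ^ a) →
      (∀ a ≤ i, ‖iteratedFDeriv ℝ a (fun y => v y - w y) x‖ ≤ l * D ^ a) →
      ‖iteratedFDeriv ℝ i (fun y => F (v y) - F (w y)) x‖ ≤ c * M * l * D ^ i := by
  induction k with
  | zero =>
    refine ⟨1, zero_le_one, ?_⟩
    intro i hi Y _ _ F v w x M D l R hF hv hw hM hD hl hvR hwR hFM _ _ hd
    obtain rfl : i = 0 := by omega
    have h0 := hd 0 le_rfl
    simp only [norm_iteratedFDeriv_zero, pow_zero, mul_one] at h0 ⊢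
    have h1 : ‖F (v x) - F (w x)‖ ≤ M * ‖v x - w x‖ := by
      refine (convex_closedBall (0 : E) R).norm_image_sub_le_of_norm_fderiv_le (𝕜 := ℝ)
        (fun z _ => (hF.differentiable (by simp)) z) (fun z hz => ?_) (by simpa using hwR)
        (by simpa using hvR)
      have := hFM 1 le_rfl z (by simpa using hz)
      rwa [norm_iteratedFDeriv_one] at this
    rw [one_mul]
    exact h1.trans (by gcongr)
  | succ k ih =>
    obtain ⟨c, hc, ih⟩ := ih
    refine ⟨max c (2 ^ k * (c + k.factorial)), le_max_of_le_left hc, ?_⟩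
    intro i hi Y _ _ F v w x M D l R hF hv hw hM hD hl hvR hwR hFM hvD hwD hd
    rcases Nat.lt_or_ge i (k + 1) with hik | hik
    · refine (ih i (by omega) Y F v w x M D l R hF hv hw hM hD hl hvR hwR hFM hvD hwD hd).trans ?_
      gcongr
      exact le_max_left _ _
    obtain rfl : i = k + 1 := by omega
    have hF' : ContDiff ℝ ∞ (fderiv ℝ F) := hF.fderiv_right (by simp)
    have hv' : ContDiff ℝ ∞ (fderiv ℝ v) := hv.fderiv_right (by simp)
    have hw' : ContDiff ℝ ∞ (fderiv ℝ w) := hw.fderiv_right (by simp)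
    have hdF := hF.differentiable (by simp)
    have hdv := hv.differentiable (by simp)
    have hdw := hw.differentiable (by simp)
    let B := ContinuousLinearMap.compL ℝ X E Y
    have hB : ‖B‖ ≤ 1 := ContinuousLinearMap.norm_compL_le ℝ X E Y
    -- `B` is composition of linear maps
    have key : fderiv ℝ (fun y => F (v y) - F (w y)) = fun y =>
        B (fderiv ℝ F (v y) - fderiv ℝ F (w y)) (fderiv ℝ v y)
          + B (fderiv ℝ F (w y)) (fderiv ℝ v y - fderiv ℝ w y) := by
      funext y
      have e1 : fderiv ℝ (fun y => F (v y)) y = (fderiv ℝ F (v y)).comp (fderiv ℝ v y) :=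
        fderiv_comp y (hdF _) (hdv _)
      have e2 : fderiv ℝ (fun y => F (w y)) y = (fderiv ℝ F (w y)).comp (fderiv ℝ w y) :=
        fderiv_comp y (hdF _) (hdw _)
      have e3 : fderiv ℝ (fun y => F (v y) - F (w y)) y =
          fderiv ℝ (fun y => F (v y)) y - fderiv ℝ (fun y => F (w y)) y :=
        fderiv_fun_sub ((hdF _).comp y (hdv _)) ((hdF _).comp y (hdw _))
      rw [e3, e1, e2]
      ext z
      simp [B]
    have hfd : (fun y => fderiv ℝ v y - fderiv ℝ w y) = fderiv ℝ (fun y => v y - w y) := by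
      funext y
      rw [fderiv_fun_sub (hdv _) (hdw _)]
    rw [← norm_iteratedFDeriv_fderiv, key]
    have hs1 : ContDiff ℝ ∞ (fun y => fderiv ℝ F (v y) - fderiv ℝ F (w y)) :=
      (hF'.comp hv).sub (hF'.comp hw)
    have hs2 : ContDiff ℝ ∞ (fun y => fderiv ℝ F (w y)) := hF'.comp hw
    have hs3 : ContDiff ℝ ∞ (fun y => fderiv ℝ v y - fderiv ℝ w y) := hv'.sub hw'
    have hk : ((k : ℕ) : ℕ∞ω) ≤ (∞ : ℕ∞ω) := by exact_mod_cast le_top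
    have hadd := iteratedFDeriv_add_apply (𝕜 := ℝ) (i := k) (x := x)
      (((B.isBoundedBilinearMap.contDiff.comp₂ hs1 hv').of_le hk).contDiffAt)
      (((B.isBoundedBilinearMap.contDiff.comp₂ hs2 hs3).of_le hk).contDiffAt)
    have hsplit : (fun y => B (fderiv ℝ F (v y) - fderiv ℝ F (w y)) (fderiv ℝ v y)
          + B (fderiv ℝ F (w y)) (fderiv ℝ v y - fderiv ℝ w y)) =
        (fun y => B (fderiv ℝ F (v y) - fderiv ℝ F (w y)) (fderiv ℝ v y)) +
          (fun y => B (fderiv ℝ F (w y)) (fderiv ℝ v y - fderiv ℝ w y)) := rfl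
    rw [hsplit]
    have hadd' : iteratedFDeriv ℝ k
        ((fun y => B (fderiv ℝ F (v y) - fderiv ℝ F (w y)) (fderiv ℝ v y)) +
          (fun y => B (fderiv ℝ F (w y)) (fderiv ℝ v y - fderiv ℝ w y))) x = _ := hadd
    rw [hadd']
    refine (norm_add_le _ _).trans ?_
    have b1 := B.norm_iteratedFDeriv_le_of_bilinear_of_le_one hs1 hv' x hk hB
    have b2 := B.norm_iteratedFDeriv_le_of_bilinear_of_le_one hs2 hs3 x hk hB
    have hsum : ∑ a ∈ Finset.range (k + 1), ((k.choose a : ℕ) : ℝ) = 2 ^ k := by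
      exact_mod_cast Nat.sum_range_choose k
    have c1 : ∑ a ∈ Finset.range (k + 1), (k.choose a : ℝ) *
        ‖iteratedFDeriv ℝ a (fun y => fderiv ℝ F (v y) - fderiv ℝ F (w y)) x‖ *
        ‖iteratedFDeriv ℝ (k - a) (fderiv ℝ v) x‖ ≤ 2 ^ k * (c * M * l * D ^ (k + 1)) := by
      rw [← hsum, Finset.sum_mul]
      refine Finset.sum_le_sum fun a ha => ?_
      have hak : a ≤ k := by simpa [Nat.lt_succ_iff] using ha
      have t1 := ih a hak (E →L[ℝ] Y) (fderiv ℝ F) v w x M D l R hF' hv hw hM hD hl hvR hwR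
        (fun b hb z hz => by
          rw [norm_iteratedFDeriv_fderiv]; exact hFM (b + 1) (by omega) z hz)
        (fun b h1 h2 => hvD b h1 (by omega)) (fun b h1 h2 => hwD b h1 (by omega))
        (fun b hb => hd b (by omega))
      have t2 : ‖iteratedFDeriv ℝ (k - a) (fderiv ℝ v) x‖ ≤ D ^ (k - a + 1) := by
        rw [norm_iteratedFDeriv_fderiv]; exact hvD _ (by omega) (by omega)
      have e : D ^ (k + 1) = D ^ a * D ^ (k - a + 1) := by
        rw [← pow_add]; congr 1; omega
      rw [mul_assoc, e, ← mul_assoc (c * M * l)]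
      gcongr
    have c2 : ∑ a ∈ Finset.range (k + 1), (k.choose a : ℝ) *
        ‖iteratedFDeriv ℝ a (fun y => fderiv ℝ F (w y)) x‖ *
        ‖iteratedFDeriv ℝ (k - a) (fun y => fderiv ℝ v y - fderiv ℝ w y) x‖
          ≤ 2 ^ k * (k.factorial * M * l * D ^ (k + 1)) := by
      rw [← hsum, Finset.sum_mul]
      refine Finset.sum_le_sum fun a ha => ?_
      have hak : a ≤ k := by simpa [Nat.lt_succ_iff] using ha
      have t1 : ‖iteratedFDeriv ℝ a (fun y => fderiv ℝ F (w y)) x‖ ≤ a.factorial * M * D ^ a :=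
        norm_iteratedFDeriv_comp_le hF' hw (N := (∞ : ℕ∞ω)) (by exact_mod_cast le_top) x
          (fun b hb => by rw [norm_iteratedFDeriv_fderiv]; exact hFM (b + 1) (by omega) _ hwR)
          (fun b h1 h2 => hwD b h1 (by omega))
      have t2 : ‖iteratedFDeriv ℝ (k - a) (fun y => fderiv ℝ v y - fderiv ℝ w y) x‖
          ≤ l * D ^ (k - a + 1) := by
        rw [hfd, norm_iteratedFDeriv_fderiv]; exact hd _ (by omega)
      have e : D ^ (k + 1) = D ^ a * D ^ (k - a + 1) := by
        rw [← pow_add]; congr 1; omega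
      have hfac : (a.factorial : ℝ) ≤ k.factorial := by exact_mod_cast Nat.factorial_le hak
      calc _ ≤ (k.choose a : ℝ) * (k.factorial * M * D ^ a) * (l * D ^ (k - a + 1)) := by
            gcongr
            exact t1.trans (by gcongr)
        _ = _ := by rw [e]; ring
    calc _ ≤ 2 ^ k * (c * M * l * D ^ (k + 1)) + 2 ^ k * (k.factorial * M * l * D ^ (k + 1)) :=
          add_le_add (b1.trans c1) (b2.trans c2)
      _ = (2 ^ k * (c + k.factorial)) * M * l * D ^ (k + 1) := by ring
      _ ≤ _ := by gcongr; exact le_max_right _ _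

/-! ### Integral inequalities in `L²` -/

/-- The Cauchy-Schwarz inequality for Lebesgue integrals. -/
theorem lintegral_mul_sq_le {P : Type*} [MeasurableSpace P] {ν : Measure P} {f g : P → ℝ≥0∞}
    (hf : AEMeasurable f ν) (hg : AEMeasurable g ν) :
    (∫⁻ p, f p * g p ∂ν) ^ 2 ≤ (∫⁻ p, f p ^ 2 ∂ν) * ∫⁻ p, g p ^ 2 ∂ν := by
  have h := ENNReal.lintegral_mul_le_Lp_mul_Lq ν (p := 2) (q := 2)
    ⟨by norm_num, by norm_num, by norm_num⟩ hf hg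
  have h2 := pow_le_pow_left₀ zero_le h 2
  refine h2.trans (le_of_eq ?_)
  rw [mul_pow, ← ENNReal.rpow_natCast, ← ENNReal.rpow_natCast, ← ENNReal.rpow_mul,
    ← ENNReal.rpow_mul]
  norm_num

theorem eLpNorm_two_sq {P Y : Type*} [MeasurableSpace P] [NormedAddCommGroup Y] (ν : Measure P)
    (f : P → Y) : eLpNorm f 2 ν ^ 2 = ∫⁻ p, ‖f p‖ₑ ^ 2 ∂ν := by
  have := eLpNorm_nnreal_pow_eq_lintegral (f := f) (μ := ν) (p := 2) (by norm_num)
  simpa using this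

theorem eLpNorm_two_le_of_sq_le {P Y : Type*} [MeasurableSpace P] [NormedAddCommGroup Y]
    {ν : Measure P} {f : P → Y} {a : ℝ≥0∞} (h : ∫⁻ p, ‖f p‖ₑ ^ 2 ∂ν ≤ a ^ 2) :
    eLpNorm f 2 ν ≤ a := by
  rw [← eLpNorm_two_sq] at h
  exact (ENNReal.pow_le_pow_left_iff (by norm_num)).1 h

/-- Young's inequality for a superposition of translates: averaging translates with total weight
`∫ w` costs at most the factor `∫ w` in `L²`. -/
theorem eLpNorm_le_of_le_lintegral_translate {d : ℕ} {P Y Z : Type*} [MeasurableSpace P]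
    [NormedAddCommGroup Y] [NormedAddCommGroup Z] {ν : Measure P} [SFinite ν] {w : P → ℝ≥0∞}
    (hw : Measurable w) {c : P → Sp d} (hc : Measurable c) {f : Sp d → Y} {g : Sp d → Z}
    (hg : Measurable fun x => ‖g x‖ₑ)
    (h : ∀ x, ‖f x‖ₑ ≤ ∫⁻ p, w p * ‖g (x - c p)‖ₑ ∂ν) :
    eLpNorm f 2 volume ≤ (∫⁻ p, w p ∂ν) * eLpNorm g 2 volume := by
  refine eLpNorm_two_le_of_sq_le ?_
  -- Cauchy-Schwarz with the weight split evenly between the two factors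
  have hs : Measurable fun p => w p ^ (1 / 2 : ℝ) := hw.pow_const _
  have hss : ∀ p, w p ^ (1 / 2 : ℝ) * w p ^ (1 / 2 : ℝ) = w p := by
    intro p
    rw [← ENNReal.rpow_add_of_nonneg _ _ (by norm_num) (by norm_num)]
    norm_num
  have hgc : Measurable fun q : Sp d × P => ‖g (q.1 - c q.2)‖ₑ :=
    hg.comp (measurable_fst.sub (hc.comp measurable_snd))
  calc ∫⁻ x, ‖f x‖ₑ ^ 2 ≤ ∫⁻ x, (∫⁻ p, w p ∂ν) * ∫⁻ p, w p * ‖g (x - c p)‖ₑ ^ 2 ∂ν := by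
        refine lintegral_mono fun x => ?_
        have hgx : Measurable fun p => ‖g (x - c p)‖ₑ := hg.comp (measurable_const.sub hc)
        have := lintegral_mul_sq_le (ν := ν) hs.aemeasurable (hs.mul hgx).aemeasurable
        have e1 : ∀ p, w p ^ (1 / 2 : ℝ) * (w p ^ (1 / 2 : ℝ) * ‖g (x - c p)‖ₑ) =
            w p * ‖g (x - c p)‖ₑ := fun p => by rw [← mul_assoc, hss]
        have e2 : ∀ p, (w p ^ (1 / 2 : ℝ)) ^ 2 = w p := fun p => by rw [sq, hss]
        simp only [Pi.mul_apply, e1, mul_pow, e2] at this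
        exact (pow_le_pow_left₀ zero_le (h x) 2).trans this
    _ = (∫⁻ p, w p ∂ν) * ∫⁻ p, w p * eLpNorm g 2 volume ^ 2 ∂ν := by
        rw [lintegral_const_mul _ (by
          exact Measurable.lintegral_prod_right' (f := fun q : Sp d × P =>
            w q.2 * ‖g (q.1 - c q.2)‖ₑ ^ 2) ((hw.comp measurable_snd).mul (hgc.pow_const _)))]
        congr 1
        rw [lintegral_lintegral_swap ((hw.comp measurable_snd).mul (hgc.pow_const _)).aemeasurable]
        refine lintegral_congr fun p => ?_
        have hgp : Measurable fun x => ‖g (x - c p)‖ₑ ^ 2 :=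
          (hg.comp (measurable_id.sub_const (c p))).pow_const _
        rw [lintegral_const_mul _ hgp, eLpNorm_two_sq,
          lintegral_sub_right_eq_self (fun x => ‖g x‖ₑ ^ 2) (c p)]
    _ = _ := by rw [lintegral_mul_const _ hw]; ring

/-! ### Averages over dilated kernels -/

/-- The average `∫ κ(z) f(x - t z) dz` of `f` against the kernel `κ` dilated to scale `t`, that is
the convolution of `f` with `t^{-d} κ(·/t)`. -/
noncomputable def dilAvg {d : ℕ} {Y : Type*} [NormedAddCommGroup Y] [NormedSpace ℂ Y]
    (κ : Sp d → ℂ) (t : ℝ) (f : Sp d → Y) (x : Sp d) : Y :=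
  ∫ z, κ z • f (x - t • z)

section dilAvg

variable {d : ℕ} {Y : Type*} [NormedAddCommGroup Y] [NormedSpace ℂ Y]

theorem norm_dilAvg_le {κ : Sp d → ℂ} (hκ : Integrable κ) {f : Sp d → Y} {b : ℝ}
    (hf : ∀ x, ‖f x‖ ≤ b) (t : ℝ) (x : Sp d) : ‖dilAvg κ t f x‖ ≤ (∫ z, ‖κ z‖) * b := by
  rw [← integral_mul_const]
  refine norm_integral_le_of_norm_le (hκ.norm.mul_const b) (Filter.Eventually.of_forall fun z => ?_)
  rw [norm_smul]
  gcongr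
  exact hf _

theorem eLpNorm_dilAvg_le {κ : Sp d → ℂ} (hκ : Measurable κ) {f : Sp d → Y} (hf : Continuous f)
    (t : ℝ) : eLpNorm (dilAvg κ t f) 2 volume ≤ (∫⁻ z, ‖κ z‖ₑ) * eLpNorm f 2 volume := by
  refine eLpNorm_le_of_le_lintegral_translate (ν := volume) hκ.enorm
    (c := fun z : Sp d => t • z) (by fun_prop) hf.enorm.measurable fun x => ?_
  refine (enorm_integral_le_lintegral_enorm _).trans (le_of_eq ?_)
  simp_rw [enorm_smul]

theorem integrable_smul_comp_of_bounded {κ : Sp d → ℂ} (hκ : Integrable κ) {f : Sp d → Y}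
    (hf : Continuous f) {b : ℝ} (hb : ∀ x, ‖f x‖ ≤ b) (t : ℝ) (x : Sp d) :
    Integrable fun z => κ z • f (x - t • z) := by
  refine (hκ.norm.mul_const b).mono' ?_ (Filter.Eventually.of_forall fun z => ?_)
  · exact hκ.aestronglyMeasurable.smul
      (hf.comp (by fun_prop : Continuous fun z : Sp d => x - t • z)).aestronglyMeasurable
  · rw [norm_smul]; gcongr; exact hb _

theorem dilAvg_sub {κ : Sp d → ℂ} (hκ : Integrable κ) {f g : Sp d → Y} (hf : Continuous f)
    (hg : Continuous g) {b c : ℝ} (hb : ∀ x, ‖f x‖ ≤ b) (hc : ∀ x, ‖g x‖ ≤ c) (t : ℝ) (x : Sp d) :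
    dilAvg κ t (fun y => f y - g y) x = dilAvg κ t f x - dilAvg κ t g x := by
  unfold dilAvg
  simp_rw [smul_sub]
  exact integral_sub (integrable_smul_comp_of_bounded hκ hf hb t x)
    (integrable_smul_comp_of_bounded hκ hg hc t x)

theorem continuous_dilAvg {κ : Sp d → ℂ} (hκ : Integrable κ) {f : Sp d → Y}
    (hf : Continuous f) {b : ℝ} (hb : ∀ x, ‖f x‖ ≤ b) (t : ℝ) : Continuous (dilAvg κ t f) := by
  refine continuous_of_dominated (bound := fun z => ‖κ z‖ * b)
    (fun x => (integrable_smul_comp_of_bounded hκ hf hb t x).aestronglyMeasurable)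
    (fun x => Filter.Eventually.of_forall fun z => ?_) (hκ.norm.mul_const b)
    (Filter.Eventually.of_forall fun z => ?_)
  · rw [norm_smul]; gcongr; exact hb _
  · exact (hf.comp (by fun_prop)).const_smul _

end dilAvg

/-! ### Taylor expansion along a segment -/

section Taylor

variable {d : ℕ} {Y : Type*} [NormedAddCommGroup Y] [NormedSpace ℝ Y]

theorem iteratedDeriv_comp_add_smul {g : Sp d → Y} (hg : ContDiff ℝ ∞ g) (x h : Sp d) (k : ℕ)
    (τ : ℝ) : iteratedDeriv k (fun τ : ℝ => g (x + τ • h)) τ =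
      iteratedFDeriv ℝ k g (x + τ • h) fun _ => h := by
  have h1 : (fun τ : ℝ => g (x + τ • h)) =
      (fun y => g (x + y)) ∘ (ContinuousLinearMap.toSpanSingleton ℝ h) := by
    funext τ; simp
  have h2 : ContDiff ℝ ∞ fun y => g (x + y) := hg.comp (by fun_prop)
  rw [iteratedDeriv_eq_iteratedFDeriv, h1,
    ContinuousLinearMap.iteratedFDeriv_comp_right (i := k) (n := (∞ : ℕ∞ω)) _ h2 τ
      (by exact_mod_cast le_top)]
  simp [iteratedFDeriv_comp_add_left']

theorem enorm_taylor_remainder_le [CompleteSpace Y] {g : Sp d → Y} (hg : ContDiff ℝ ∞ g)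
    (x h : Sp d) (n : ℕ) :
    ‖g (x + h) - ∑ k ∈ Finset.range (n + 1), ((k.factorial : ℝ)⁻¹) •
        iteratedFDeriv ℝ k g x (fun _ => h)‖ₑ ≤
      ∫⁻ τ in Set.Icc (0 : ℝ) 1, ‖h‖ₑ ^ (n + 1) * ‖iteratedFDeriv ℝ (n + 1) g (x + τ • h)‖ₑ := by
  set θ : ℝ → Y := fun τ => g (x + τ • h) with hθ
  have hθc : ContDiff ℝ ∞ θ := hg.comp (by fun_prop)
  have hu : Set.uIcc (0 : ℝ) 1 = Set.Icc 0 1 := Set.uIcc_of_le zero_le_one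
  have hud : UniqueDiffOn ℝ (Set.Icc (0 : ℝ) 1) := uniqueDiffOn_Icc zero_lt_one
  have hw : ∀ k, ∀ τ ∈ Set.Icc (0 : ℝ) 1, iteratedDerivWithin k θ (Set.Icc 0 1) τ =
      iteratedFDeriv ℝ k g (x + τ • h) fun _ => h := by
    intro k τ hτ
    rw [iteratedDerivWithin_eq_iteratedDeriv hud
      (hθc.of_le (by exact_mod_cast le_top)).contDiffAt hτ, iteratedDeriv_comp_add_smul hg]
  have T := taylor_integral_remainder (f := θ) (x₀ := 0) (x := 1) (n := n)
    (hθc.of_le (by exact_mod_cast le_top)).contDiffOn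
  rw [hu, taylor_within_apply] at T
  have e1 : ∑ k ∈ Finset.range (n + 1), ((k.factorial : ℝ)⁻¹ * (1 - 0) ^ k) •
      iteratedDerivWithin k θ (Set.Icc 0 1) 0 = ∑ k ∈ Finset.range (n + 1),
        ((k.factorial : ℝ)⁻¹) • iteratedFDeriv ℝ k g x (fun _ => h) := by
    refine Finset.sum_congr rfl fun k _ => ?_
    rw [hw k 0 (by simp)]
    simp
  rw [e1] at T
  have e2 : θ 1 = g (x + h) := by simp [hθ]
  rw [← e2, T, intervalIntegral.integral_of_le zero_le_one, ← integral_Icc_eq_integral_Ioc]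
  refine (enorm_integral_le_lintegral_enorm _).trans ?_
  refine setLIntegral_mono' measurableSet_Icc fun τ hτ => ?_
  rw [hw _ τ hτ, enorm_smul]
  have b1 : ‖(1 - τ) ^ n / (n.factorial : ℝ)‖ₑ ≤ 1 := by
    rw [← ofReal_norm, ENNReal.ofReal_le_one, norm_div, norm_pow, Real.norm_of_nonneg
      (by linarith [hτ.2]), Real.norm_of_nonneg (by positivity)]
    refine div_le_one_of_le₀ ?_ (by positivity)
    exact (pow_le_one₀ (by linarith [hτ.2]) (by linarith [hτ.1])).trans
      (by exact_mod_cast Nat.one_le_iff_ne_zero.2 (Nat.factorial_ne_zero n))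
  have b2 : ‖iteratedFDeriv ℝ (n + 1) g (x + τ • h) fun _ => h‖ₑ ≤
      ‖iteratedFDeriv ℝ (n + 1) g (x + τ • h)‖ₑ * ‖h‖ₑ ^ (n + 1) := by
    have := (iteratedFDeriv ℝ (n + 1) g (x + τ • h)).le_opNorm fun _ => h
    simp only [Finset.prod_const, Finset.card_univ, Fintype.card_fin] at this
    simp only [enorm_eq_nnnorm]
    exact_mod_cast this
  calc _ ≤ 1 * (‖iteratedFDeriv ℝ (n + 1) g (x + τ • h)‖ₑ * ‖h‖ₑ ^ (n + 1)) := by gcongr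
    _ = _ := by rw [one_mul, mul_comm]

end Taylor

/-! ### Derivatives of Fourier integrals and moments -/

section FourierDeriv

variable {d : ℕ} {Y : Type*} [NormedAddCommGroup Y] [NormedSpace ℂ Y]

theorem iteratedFDeriv_fourier_apply {f : Sp d → Y}
    (hf : ∀ n : ℕ, Integrable fun v => ‖v‖ ^ n * ‖f v‖) (h'f : AEStronglyMeasurable f volume)
    (k : ℕ) (x : Sp d) (m : Fin k → Sp d) :
    iteratedFDeriv ℝ k (𝓕 f) x m =
      (-(2 * Real.pi * Complex.I)) ^ k • 𝓕 (fun v => (∏ i, (⟪v, m i⟫ : ℝ)) • f v) x := by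
  rw [Real.iteratedFDeriv_fourier (N := ⊤) (fun n _ => hf n) h'f le_top,
    Real.fourier_continuousMultilinearMap_apply
      (VectorFourier.integrable_fourierPowSMulRight _ (hf k) h'f)]
  rw [Real.fourier_eq, Real.fourier_eq, ← integral_smul]
  refine integral_congr_ae (Filter.Eventually.of_forall fun v => ?_)
  simp only [VectorFourier.fourierPowSMulRight_apply]
  rw [smul_comm]
  rfl

theorem iteratedFDeriv_fourierInv_apply {f : Sp d → Y}
    (hf : ∀ n : ℕ, Integrable fun v => ‖v‖ ^ n * ‖f v‖) (h'f : AEStronglyMeasurable f volume)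
    (k : ℕ) (x : Sp d) (m : Fin k → Sp d) :
    iteratedFDeriv ℝ k (𝓕⁻ f) x m =
      (2 * Real.pi * Complex.I) ^ k • 𝓕⁻ (fun v => (∏ i, (⟪v, m i⟫ : ℝ)) • f v) x := by
  have h1 : ∀ n : ℕ, Integrable fun v : Sp d => ‖v‖ ^ n * ‖f (-v)‖ := fun n => by
    simpa using (hf n).comp_neg
  have h2 : AEStronglyMeasurable (fun v : Sp d => f (-v)) volume :=
    h'f.comp_measurePreserving (Measure.measurePreserving_neg volume)
  rw [Real.fourierInv_eq_fourier_comp_neg, iteratedFDeriv_fourier_apply h1 h2,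
    Real.fourierInv_eq_fourier_comp_neg, Real.fourier_eq, Real.fourier_eq, ← integral_smul,
    ← integral_smul]
  refine integral_congr_ae (Filter.Eventually.of_forall fun v => ?_)
  simp only [inner_neg_left, Finset.prod_neg, Finset.card_univ, Fintype.card_fin, Circle.smul_def,
    ← Complex.coe_smul, smul_smul]
  congr 1
  rw [neg_pow (2 * (Real.pi : ℂ) * Complex.I)]
  push_cast
  ring

theorem contDiff_fourierInv {f : Sp d → Y}
    (hf : ∀ n : ℕ, Integrable fun v => ‖v‖ ^ n * ‖f v‖) : ContDiff ℝ ∞ (𝓕⁻ f) := by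
  have h1 : ∀ n : ℕ, Integrable fun v : Sp d => ‖v‖ ^ n * ‖f (-v)‖ := fun n => by
    simpa using (hf n).comp_neg
  rw [Real.fourierInv_eq_fourier_comp_neg]
  exact Real.contDiff_fourier (N := ⊤) fun n _ => h1 n

/-- A Schwartz function whose Fourier transform equals one near the origin has vanishing moments
of every positive order: up to a factor they are the derivatives of the Fourier transform at the
origin. -/
theorem integral_prod_inner_mul_eq_zero (ψ : 𝓢(Sp d, ℂ))
    (hψ : ∀ᶠ ξ in nhds (0 : Sp d), 𝓕 (ψ : Sp d → ℂ) ξ = 1) {k : ℕ} (hk : k ≠ 0)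
    (m : Fin k → Sp d) : ∫ z, (∏ i, (⟪z, m i⟫ : ℝ)) • ψ z = 0 := by
  have h := iteratedFDeriv_fourier_apply (f := (ψ : Sp d → ℂ)) (fun n => ψ.integrable_pow_mul _ n)
    ψ.continuous.aestronglyMeasurable k 0 m
  have h0 : iteratedFDeriv ℝ k (𝓕 (ψ : Sp d → ℂ)) 0 = 0 := by
    have : 𝓕 (ψ : Sp d → ℂ) =ᶠ[nhds 0] fun _ => 1 := hψ
    rw [(this.iteratedFDeriv ℝ k).eq_of_nhds, iteratedFDeriv_const_of_ne hk]
    rfl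
  rw [h0, Real.fourier_eq'] at h
  simp only [inner_zero_right, mul_zero, Complex.ofReal_zero, zero_mul, Complex.exp_zero, one_smul,
    zero_apply] at h
  have hc : (-(2 * (Real.pi : ℂ) * Complex.I)) ^ k ≠ 0 :=
    pow_ne_zero _ (neg_ne_zero.2 Complex.two_pi_I_ne_zero)
  exact (smul_eq_zero.1 h.symm).resolve_left hc

end FourierDeriv

/-! ### Multilinear maps on the standard basis -/

section Multilinear

variable {d : ℕ} {Y : Type*} [NormedAddCommGroup Y] [NormedSpace ℝ Y]

/-- The standard basis vector of `ℝ^d`. -/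
noncomputable abbrev stdVec {d : ℕ} (i : Fin d) : Sp d := EuclideanSpace.single i (1 : ℝ)

theorem multilinear_eq_sum_stdVec {k : ℕ} (A : ContinuousMultilinearMap ℝ (fun _ : Fin k => Sp d) Y)
    (v : Fin k → Sp d) :
    A v = ∑ I : Fin k → Fin d, (∏ j, (⟪v j, stdVec (I j)⟫ : ℝ)) • A fun j => stdVec (I j) := by
  have h : v = fun j => ∑ i : Fin d, (⟪v j, stdVec i⟫ : ℝ) • (stdVec i : Sp d) := by
    funext j
    have := (EuclideanSpace.basisFun (Fin d) ℝ).sum_repr (v j)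
    simpa [EuclideanSpace.inner_single_right] using this.symm
  conv_lhs => rw [h]
  rw [A.map_sum]
  exact Finset.sum_congr rfl fun I _ => A.map_smul_univ _ _

theorem norm_multilinear_le_sum_stdVec {k : ℕ}
    (A : ContinuousMultilinearMap ℝ (fun _ : Fin k => Sp d) Y) :
    ‖A‖ ≤ ∑ I : Fin k → Fin d, ‖A fun j => stdVec (I j)‖ := by
  refine A.opNorm_le_bound (Finset.sum_nonneg fun _ _ => norm_nonneg _) fun v => ?_
  rw [multilinear_eq_sum_stdVec A v, Finset.sum_mul]
  refine (norm_sum_le _ _).trans (Finset.sum_le_sum fun I _ => ?_)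
  rw [norm_smul, mul_comm, norm_prod]
  gcongr with j
  simpa using norm_inner_le_norm (𝕜 := ℝ) (v j) (stdVec (I j))

end Multilinear

/-! ### High frequency part of smooth functions -/

section HighFrequency

variable {d : ℕ} {Y : Type*} [NormedAddCommGroup Y] [NormedSpace ℂ Y]

theorem integral_smul_multilinear_eq_zero [CompleteSpace Y] (ψ : 𝓢(Sp d, ℂ))
    (hψ : ∀ᶠ ξ in nhds (0 : Sp d), 𝓕 (ψ : Sp d → ℂ) ξ = 1) {k : ℕ} (hk : k ≠ 0)
    (A : ContinuousMultilinearMap ℝ (fun _ : Fin k => Sp d) Y) :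
    (Integrable fun z => ψ z • A fun _ => z) ∧ ∫ z, ψ z • A (fun _ => z) = 0 := by
  have hint : ∀ I : Fin k → Fin d, Integrable fun z : Sp d =>
      ((∏ j, (⟪z, stdVec (I j)⟫ : ℝ)) • ψ z) • A fun j => stdVec (I j) := by
    intro I
    refine Integrable.smul_const ?_ _
    refine (ψ.integrable_pow_mul volume k).mono' ?_ (Filter.Eventually.of_forall fun z => ?_)
    · have hc : Continuous fun z : Sp d => ∏ j, (⟪z, stdVec (I j)⟫ : ℝ) :=
        continuous_finsetProd _ fun j _ => by fun_prop
      exact (hc.smul ψ.continuous).aestronglyMeasurable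
    · rw [norm_smul, norm_prod]
      gcongr
      calc _ ≤ ∏ _j : Fin k, ‖z‖ := Finset.prod_le_prod (fun _ _ => norm_nonneg _) fun j _ => by
            simpa using norm_inner_le_norm (𝕜 := ℝ) z (stdVec (I j))
        _ = _ := by simp
  have e : (fun z => ψ z • A fun _ => z) = fun z => ∑ I : Fin k → Fin d,
      ((∏ j, (⟪z, stdVec (I j)⟫ : ℝ)) • ψ z) • A fun j => stdVec (I j) := by
    funext z
    rw [multilinear_eq_sum_stdVec A, Finset.smul_sum]
    refine Finset.sum_congr rfl fun I _ => ?_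
    rw [smul_assoc, smul_comm]
  constructor
  · rw [e]; exact integrable_finsetSum _ fun I _ => hint I
  · rw [e, integral_finsetSum _ fun I _ => hint I]
    refine Finset.sum_eq_zero fun I _ => ?_
    rw [integral_smul_const, integral_prod_inner_mul_eq_zero ψ hψ hk, zero_smul]

/-- Since `ψ` has integral one and vanishing higher moments, subtracting the average against `ψ`
removes the Taylor polynomial, and only the Taylor remainder contributes. -/
theorem enorm_sub_dilAvg_le [CompleteSpace Y] (ψ : 𝓢(Sp d, ℂ))
    (hψ : ∀ᶠ ξ in nhds (0 : Sp d), 𝓕 (ψ : Sp d → ℂ) ξ = 1) (n : ℕ) {g : Sp d → Y}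
    (hg : ContDiff ℝ ∞ g) {b : ℝ} (hb : ∀ x, ‖g x‖ ≤ b) (t : ℝ) (x : Sp d) :
    ‖g x - dilAvg ψ t g x‖ₑ ≤ ∫⁻ p : Sp d × ℝ,
      (‖ψ p.1‖ₑ * (‖t‖ₑ * ‖p.1‖ₑ) ^ (n + 1)) *
        ‖iteratedFDeriv ℝ (n + 1) g (x - (p.2 * t) • p.1)‖ₑ
        ∂((volume : Measure (Sp d)).prod (volume.restrict (Set.Icc (0 : ℝ) 1))) := by
  have h1 : ∫ z, ψ z = 1 := by
    have := hψ.self_of_nhds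
    rw [Real.fourier_eq'] at this
    simpa using this
  set P : Sp d → Y := fun z => ∑ k ∈ Finset.range (n + 1), ((k.factorial : ℝ)⁻¹) •
    iteratedFDeriv ℝ k g x (fun _ => -t • z) with hP
  have hterm : ∀ k, (fun z : Sp d => ψ z • ((k.factorial : ℝ)⁻¹ •
      iteratedFDeriv ℝ k g x (fun _ => -t • z))) = fun z =>
        ((k.factorial : ℝ)⁻¹ * (-t) ^ k) • (ψ z • iteratedFDeriv ℝ k g x (fun _ => z)) := by
    intro k
    funext z
    have : iteratedFDeriv ℝ k g x (fun _ => -t • z) =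
        (-t) ^ k • iteratedFDeriv ℝ k g x (fun _ => z) := by
      have := (iteratedFDeriv ℝ k g x).map_smul_univ (fun _ => -t) (fun _ => z)
      simpa using this
    rw [this, smul_smul, smul_comm]
  have hint : ∀ k, Integrable fun z : Sp d => ψ z • ((k.factorial : ℝ)⁻¹ •
      iteratedFDeriv ℝ k g x (fun _ => -t • z)) := by
    intro k
    rw [hterm k]
    refine Integrable.smul _ ?_
    rcases Nat.eq_zero_or_pos k with rfl | hk
    · simpa using (ψ.integrable (μ := volume)).smul_const (g x)
    · exact (integral_smul_multilinear_eq_zero ψ hψ hk.ne' _).1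
  have hPint : Integrable fun z => ψ z • P z := by
    simp only [hP, Finset.smul_sum]
    exact integrable_finsetSum _ fun k _ => hint k
  have hPval : ∫ z, ψ z • P z = g x := by
    simp only [hP, Finset.smul_sum]
    rw [integral_finsetSum _ fun k _ => hint k, Finset.sum_eq_single 0]
    · rw [hterm 0]
      simp [integral_smul_const, h1]
    · intro k _ hk
      rw [hterm k, integral_smul, (integral_smul_multilinear_eq_zero ψ hψ hk _).2, smul_zero]
    · simp
  have hgint := integrable_smul_comp_of_bounded (ψ.integrable (μ := volume)) hg.continuous hb t x
  have e : g x - dilAvg ψ t g x = -∫ z, ψ z • (g (x + -t • z) - P z) := by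
    simp_rw [smul_sub, neg_smul, ← sub_eq_add_neg]
    rw [integral_sub hgint hPint, hPval, neg_sub]
    rfl
  have hmeas : Measurable fun p : Sp d × ℝ => (‖ψ p.1‖ₑ * (‖t‖ₑ * ‖p.1‖ₑ) ^ (n + 1)) *
        ‖iteratedFDeriv ℝ (n + 1) g (x - (p.2 * t) • p.1)‖ₑ := by
    have hc : Continuous (iteratedFDeriv ℝ (n + 1) g) :=
      hg.continuous_iteratedFDeriv (by exact_mod_cast le_top)
    have m1 : Measurable fun p : Sp d × ℝ => ‖ψ p.1‖ₑ :=
      (ψ.continuous.comp continuous_fst).enorm.measurable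
    have m2 : Measurable fun p : Sp d × ℝ => ‖p.1‖ₑ := continuous_fst.enorm.measurable
    have m3 : Measurable fun p : Sp d × ℝ =>
        ‖iteratedFDeriv ℝ (n + 1) g (x - (p.2 * t) • p.1)‖ₑ :=
      (hc.comp (by fun_prop :
        Continuous fun p : Sp d × ℝ => x - (p.2 * t) • p.1)).enorm.measurable
    exact (m1.mul ((m2.const_mul _).pow_const _)).mul m3
  rw [e, enorm_neg, lintegral_prod _ hmeas.aemeasurable]
  refine (enorm_integral_le_lintegral_enorm _).trans (lintegral_mono fun z => ?_)
  rw [enorm_smul]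
  refine (mul_le_mul_right (enorm_taylor_remainder_le hg x (-t • z) n) _).trans (le_of_eq ?_)
  rw [← lintegral_const_mul']
  · refine lintegral_congr fun τ => ?_
    rw [enorm_smul, enorm_neg, mul_assoc]
    congr 3
    simp [smul_smul, sub_eq_add_neg]
  · exact enorm_ne_top

/-- A function with `n + 1` derivatives in `L²` differs from its average at scale `t` by
`O(t^(n+1))`, to every order `n`. -/
theorem exists_eLpNorm_sub_dilAvg_le [CompleteSpace Y] (ψ : 𝓢(Sp d, ℂ))
    (hψ : ∀ᶠ ξ in nhds (0 : Sp d), 𝓕 (ψ : Sp d → ℂ) ξ = 1) (n : ℕ) :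
    ∃ C : ℝ≥0, ∀ (g : Sp d → Y) (b t : ℝ), ContDiff ℝ ∞ g → (∀ x, ‖g x‖ ≤ b) → 0 ≤ t →
      eLpNorm (fun x => g x - dilAvg ψ t g x) 2 volume ≤
        C * ENNReal.ofReal (t ^ (n + 1)) * eLpNorm (iteratedFDeriv ℝ (n + 1) g) 2 volume := by
  have hfin : ∫⁻ z : Sp d, ‖ψ z‖ₑ * ‖z‖ₑ ^ (n + 1) ≠ ⊤ := by
    have := (ψ.integrable_pow_mul volume (n + 1)).hasFiniteIntegral
    refine ((lintegral_congr fun z => ?_).trans_lt this).ne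
    rw [enorm_mul, enorm_pow, enorm_norm, enorm_norm, mul_comm]
  refine ⟨(∫⁻ z : Sp d, ‖ψ z‖ₑ * ‖z‖ₑ ^ (n + 1)).toNNReal, ?_⟩
  intro g b t hg hb ht
  rw [ENNReal.coe_toNNReal hfin]
  have hc : Continuous (iteratedFDeriv ℝ (n + 1) g) :=
    hg.continuous_iteratedFDeriv (by exact_mod_cast le_top)
  have hw : Measurable fun z : Sp d => ‖ψ z‖ₑ * (‖t‖ₑ * ‖z‖ₑ) ^ (n + 1) :=
    ψ.continuous.enorm.measurable.mul ((continuous_id.enorm.measurable.const_mul _).pow_const _)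
  refine (eLpNorm_le_of_le_lintegral_translate
    (ν := (volume : Measure (Sp d)).prod (volume.restrict (Set.Icc (0 : ℝ) 1)))
    (w := fun p => ‖ψ p.1‖ₑ * (‖t‖ₑ * ‖p.1‖ₑ) ^ (n + 1)) (hw.comp measurable_fst)
    (c := fun p => (p.2 * t) • p.1) (by fun_prop) hc.enorm.measurable
    (fun x => enorm_sub_dilAvg_le ψ hψ n hg hb t x)).trans (le_of_eq ?_)
  congr 1
  have hw1 : Measurable fun p : Sp d × ℝ => ‖ψ p.1‖ₑ * (‖t‖ₑ * ‖p.1‖ₑ) ^ (n + 1) :=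
    hw.comp measurable_fst
  rw [lintegral_prod _ hw1.aemeasurable]
  simp only [lintegral_const, Measure.restrict_apply_univ, Real.volume_Icc, sub_zero,
    ENNReal.ofReal_one, mul_one, mul_pow]
  have ht' : ‖t‖ₑ ^ (n + 1) = ENNReal.ofReal (t ^ (n + 1)) := by
    rw [← ofReal_norm, Real.norm_of_nonneg ht, ENNReal.ofReal_pow ht]
  rw [ht', ← lintegral_mul_const']
  · exact lintegral_congr fun z => by ring
  · exact ENNReal.ofReal_ne_top

end HighFrequency

/-! ### Plancherel's theorem for integrable functions -/

section Plancherel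

variable {d : ℕ} {Y : Type*} [NormedAddCommGroup Y]

theorem continuous_fourierInv [NormedSpace ℂ Y] {g : Sp d → Y} (h1 : Integrable g) :
    Continuous (𝓕⁻ g) := by
  rw [Real.fourierInv_eq_fourier_comp_neg]
  exact VectorFourier.fourierIntegral_continuous Real.continuous_fourierChar
    (L := innerₗ (Sp d)) continuous_inner h1.comp_neg

/-- Fubini's theorem for `𝓕⁻` in a form that also covers translates and dilations:
`∫ κ(z) (𝓕⁻ g)(x - t z) dz = (𝓕⁻ ((𝓕 κ)(t ·) g))(x)`. -/
theorem dilAvg_fourierInv [NormedSpace ℂ Y] [CompleteSpace Y] {κ : Sp d → ℂ}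
    (hκ : Integrable κ) {g : Sp d → Y} (hg : Integrable g) (t : ℝ) (x : Sp d) :
    dilAvg κ t (𝓕⁻ g) x = 𝓕⁻ (fun ξ => 𝓕 κ (t • ξ) • g ξ) x := by
  have hG : Integrable fun ξ => (𝐞 ⟪ξ, x⟫ : Circle) • g ξ := by
    have := (Real.fourierIntegral_convergent_iff (-x)).2 hg
    simpa using this
  have hL : Continuous fun p : Sp d × Sp d => (t • innerₗ (Sp d)) p.1 p.2 := by
    simp only [LinearMap.smul_apply, innerₗ_apply_apply]
    fun_prop
  have h := VectorFourier.integral_fourierIntegral_smul_eq_flip (L := t • innerₗ (Sp d))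
    Real.continuous_fourierChar hL hκ hG
  unfold dilAvg
  rw [Real.fourierInv_eq]
  have e1 : ∀ ξ, (𝐞 ⟪ξ, x⟫ : Circle) • 𝓕 κ (t • ξ) • g ξ =
      VectorFourier.fourierIntegral 𝐞 volume (t • innerₗ (Sp d)) κ ξ •
        (𝐞 ⟪ξ, x⟫ : Circle) • g ξ := by
    intro ξ
    rw [smul_comm]
    congr 1
    rw [Real.fourier_eq, VectorFourier.fourierIntegral]
    simp [inner_smul_right]
  have e2 : ∀ z, κ z • 𝓕⁻ g (x - t • z) = κ z • VectorFourier.fourierIntegral 𝐞 volume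
      (t • innerₗ (Sp d)).flip (fun ξ => (𝐞 ⟪ξ, x⟫ : Circle) • g ξ) z := by
    intro z
    rw [Real.fourierInv_eq, VectorFourier.fourierIntegral]
    congr 2
    funext ξ
    rw [smul_smul, ← AddChar.map_add_eq_mul]
    congr 2
    simp [inner_sub_right, inner_smul_right, real_inner_comm]
    ring
  simp_rw [e1, e2]
  exact h.symm

variable [InnerProductSpace ℂ Y] [CompleteSpace Y]

/-- On `L¹ ∩ L²` the Fourier integral agrees with the Fourier transform of `L²`. -/
theorem fourierInv_toLp_ae_eq {g : Sp d → Y} (h1 : Integrable g) (h2 : MemLp g 2 volume) :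
    (𝓕⁻ (h2.toLp g) : Lp Y 2 (volume : Measure (Sp d))) =ᵐ[volume] 𝓕⁻ g := by
  have hc := continuous_fourierInv h1
  set G : Lp Y 2 (volume : Measure (Sp d)) := 𝓕⁻ (h2.toLp g) with hG
  have hGl : LocallyIntegrable G volume := (Lp.memLp G).locallyIntegrable (by norm_num)
  have key : ∀ᵐ x, (G x - 𝓕⁻ g x) = 0 := by
    refine ae_eq_zero_of_integral_contDiff_smul_eq_zero (hGl.sub hc.locallyIntegrable)
      fun φ hφ hφc => ?_
    have hg1 : HasCompactSupport (Complex.ofRealCLM ∘ φ) := hφc.comp_left rfl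
    have hg2 : ContDiff ℝ ∞ (Complex.ofRealCLM ∘ φ) := by fun_prop
    let Φ : 𝓢(Sp d, ℂ) := hg1.toSchwartzMap hg2
    have hΦ : ∀ x, Φ x = (φ x : ℂ) := fun x => rfl
    have i1 : Integrable fun x => φ x • G x :=
      hGl.integrable_smul_left_of_hasCompactSupport hφ.continuous hφc
    have i2 : Integrable fun x => φ x • 𝓕⁻ g x :=
      hc.locallyIntegrable.integrable_smul_left_of_hasCompactSupport hφ.continuous hφc
    simp only [smul_sub]
    rw [integral_sub i1 i2, sub_eq_zero]
    calc ∫ x, φ x • G x = (G : 𝓢'(Sp d, Y)) Φ := by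
          rw [Lp.toTemperedDistribution_apply]
          simp_rw [hΦ, Complex.coe_smul]
      _ = ((h2.toLp g : Lp Y 2 (volume : Measure (Sp d))) : 𝓢'(Sp d, Y)) (𝓕⁻ Φ) := by
          rw [hG, ← Lp.fourierInv_toTemperedDistribution_eq, fourierInv_apply]
      _ = ∫ ξ, (𝓕⁻ Φ) ξ • g ξ := by
          rw [Lp.toTemperedDistribution_apply]
          refine integral_congr_ae ?_
          filter_upwards [h2.coeFn_toLp] with ξ hξ
          rw [hξ]
      _ = ∫ x, Φ x • 𝓕⁻ g x := by
          have hL : Continuous fun p : Sp d × Sp d => (-innerₗ (Sp d)) p.1 p.2 := by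
            simp only [LinearMap.neg_apply, innerₗ_apply_apply]
            fun_prop
          have h := VectorFourier.integral_fourierIntegral_smul_eq_flip (L := -innerₗ (Sp d))
            Real.continuous_fourierChar hL (Φ.integrable (μ := volume)) h1
          have e1 : ∀ ξ, (𝓕⁻ Φ) ξ =
              VectorFourier.fourierIntegral 𝐞 volume (-innerₗ (Sp d)) Φ ξ := by
            intro ξ
            rw [SchwartzMap.fourierInv_coe, Real.fourierInv_eq, VectorFourier.fourierIntegral]
            simp
          have e2 : ∀ x, 𝓕⁻ g x = VectorFourier.fourierIntegral 𝐞 volume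
              (-innerₗ (Sp d)).flip g x := by
            intro x
            rw [Real.fourierInv_eq, VectorFourier.fourierIntegral]
            simp [real_inner_comm]
          simp_rw [e1, e2]
          exact h
      _ = _ := by simp_rw [hΦ, Complex.coe_smul]
  filter_upwards [key] with x hx using sub_eq_zero.1 hx

theorem eLpNorm_fourierInv {g : Sp d → Y} (h1 : Integrable g) (h2 : MemLp g 2 volume) :
    eLpNorm (𝓕⁻ g) 2 volume = eLpNorm g 2 volume := by
  rw [← eLpNorm_congr_ae (fourierInv_toLp_ae_eq h1 h2), ← eLpNorm_congr_ae h2.coeFn_toLp,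
    ← Lp.enorm_def, ← Lp.enorm_def]
  have := Lp.norm_fourier_eq (𝓕⁻ (h2.toLp g) : Lp Y 2 (volume : Measure (Sp d)))
  rw [FourierInvPair.fourier_fourierInv_eq] at this
  rw [← ofReal_norm, ← ofReal_norm, this]

end Plancherel

/-! ### Bernstein's inequalities -/

section Multiplier

variable {d : ℕ} {Y : Type*} [NormedAddCommGroup Y]

theorem exists_pow_mul_norm_schwartz_le {Z : Type*} [NormedAddCommGroup Z] [NormedSpace ℝ Z]
    (θ : 𝓢(Sp d, Z)) (n : ℕ) : ∃ C : ℝ, 0 ≤ C ∧ ∀ ξ, ‖ξ‖ ^ n * ‖θ ξ‖ ≤ C :=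
  ⟨_, apply_nonneg (SchwartzMap.seminorm ℝ n 0) θ, SchwartzMap.norm_pow_mul_le_seminorm ℝ θ n⟩

theorem integrable_pow_mul_multiplier [NormedSpace ℂ Y] (θ : 𝓢(Sp d, ℂ)) {t : ℝ} (ht : 0 < t)
    {g : Sp d → Y} (hg : Integrable g) (n : ℕ) :
    Integrable fun ξ => ‖ξ‖ ^ n * ‖θ (t • ξ) • g ξ‖ := by
  obtain ⟨C, hC, h⟩ := exists_pow_mul_norm_schwartz_le θ n
  refine (hg.norm.const_mul (t⁻¹ ^ n * C)).mono' ?_ (Filter.Eventually.of_forall fun ξ => ?_)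
  · have h1 : Continuous fun ξ : Sp d => θ (t • ξ) := θ.continuous.comp (by fun_prop)
    exact (continuous_norm.pow n).aestronglyMeasurable.mul
      (h1.aestronglyMeasurable.smul hg.aestronglyMeasurable).norm
  · rw [norm_mul, norm_pow, norm_norm, norm_norm, norm_smul, ← mul_assoc]
    refine mul_le_mul_of_nonneg_right ?_ (norm_nonneg _)
    have := h (t • ξ)
    rw [norm_smul, Real.norm_of_nonneg ht.le, mul_pow] at this
    rw [inv_pow, ← div_eq_inv_mul, le_div_iff₀ (by positivity)]
    linarith

theorem memLp_multiplier [NormedSpace ℂ Y] (θ : 𝓢(Sp d, ℂ)) (t : ℝ) {p : ℝ≥0∞}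
    {g : Sp d → Y} (hg : MemLp g p volume) : MemLp (fun ξ => θ (t • ξ) • g ξ) p volume := by
  obtain ⟨C, hC, h⟩ := exists_pow_mul_norm_schwartz_le θ 0
  have h1 : Continuous fun ξ : Sp d => θ (t • ξ) := θ.continuous.comp (by fun_prop)
  refine MemLp.of_le_mul (c := C) hg (h1.aestronglyMeasurable.smul hg.aestronglyMeasurable)
    (Filter.Eventually.of_forall fun ξ => ?_)
  rw [norm_smul]
  gcongr
  simpa using h (t • ξ)

theorem integrable_multiplier [NormedSpace ℂ Y] (θ : 𝓢(Sp d, ℂ)) (t : ℝ)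
    {g : Sp d → Y} (hg : Integrable g) : Integrable (fun ξ => θ (t • ξ) • g ξ) :=
  memLp_one_iff_integrable.1 (memLp_multiplier θ t (memLp_one_iff_integrable.2 hg))

/-- The Schwartz function `ξ ↦ (∏ⱼ ξ_{I j}) θ(ξ)`. -/
noncomputable def monomialMul (θ : 𝓢(Sp d, ℂ)) {k : ℕ} (I : Fin k → Fin d) : 𝓢(Sp d, ℂ) :=
  SchwartzMap.smulLeftCLM ℂ (fun ξ : Sp d => ∏ j, (⟪ξ, stdVec (I j)⟫ : ℝ)) θ

theorem hasTemperateGrowth_prod_inner {k : ℕ} (I : Fin k → Fin d) :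
    (fun ξ : Sp d => ∏ j, (⟪ξ, stdVec (I j)⟫ : ℝ)).HasTemperateGrowth := by
  induction k with
  | zero => simp
  | succ k ih =>
    simp_rw [Fin.prod_univ_succ]
    exact (Function.hasTemperateGrowth_inner_left _).mul (ih fun j => I j.succ)

theorem monomialMul_apply (θ : 𝓢(Sp d, ℂ)) {k : ℕ} (I : Fin k → Fin d) (ξ : Sp d) :
    monomialMul θ I ξ = (∏ j, (⟪ξ, stdVec (I j)⟫ : ℝ)) • θ ξ := by
  rw [monomialMul, SchwartzMap.smulLeftCLM_apply_apply (hasTemperateGrowth_prod_inner I)]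

theorem norm_monomialMul_le (θ : 𝓢(Sp d, ℂ)) {k : ℕ} (I : Fin k → Fin d) (ξ : Sp d) :
    ‖monomialMul θ I ξ‖ ≤ ‖ξ‖ ^ k * ‖θ ξ‖ := by
  rw [monomialMul_apply, norm_smul, norm_prod]
  gcongr
  calc _ ≤ ∏ _j : Fin k, ‖ξ‖ := Finset.prod_le_prod (fun _ _ => norm_nonneg _) fun j _ => by
        simpa using norm_inner_le_norm (𝕜 := ℝ) ξ (stdVec (I j))
    _ = _ := by simp

theorem iteratedFDeriv_multiplier_stdVec [NormedSpace ℂ Y] (θ : 𝓢(Sp d, ℂ)) {t : ℝ} (ht : 0 < t)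
    {g : Sp d → Y} (hg : Integrable g) {k : ℕ} (x : Sp d) (I : Fin k → Fin d) :
    iteratedFDeriv ℝ k (𝓕⁻ fun ξ => θ (t • ξ) • g ξ) x (fun j => stdVec (I j)) =
      ((2 * Real.pi * Complex.I) ^ k * (((t⁻¹) ^ k : ℝ) : ℂ)) •
        𝓕⁻ (fun ξ => monomialMul θ I (t • ξ) • g ξ) x := by
  rw [iteratedFDeriv_fourierInv_apply (integrable_pow_mul_multiplier θ ht hg)
    (integrable_multiplier θ t hg).aestronglyMeasurable, mul_smul]
  congr 1
  rw [Real.fourierInv_eq, Real.fourierInv_eq, Complex.coe_smul, ← integral_smul]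
  refine integral_congr_ae (Filter.Eventually.of_forall fun ξ => ?_)
  simp only [monomialMul_apply, inner_smul_left, Finset.prod_mul_distrib, Finset.prod_const,
    Finset.card_univ, Fintype.card_fin, Circle.smul_def, ← Complex.coe_smul, smul_smul]
  congr 1
  push_cast
  have : (t : ℂ)⁻¹ ^ k * (t : ℂ) ^ k = 1 := by
    rw [← mul_pow, inv_mul_cancel₀ (by exact_mod_cast ht.ne'), one_pow]
  simp only [conj_trivial, smul_eq_mul]
  linear_combination (-((𝐞 ⟪ξ, x⟫ : ℂ) * (∏ j, ((⟪ξ, stdVec (I j)⟫ : ℝ) : ℂ)) * θ (t • ξ))) * this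

theorem norm_iteratedFDeriv_multiplier_le_sum [NormedSpace ℂ Y] (θ : 𝓢(Sp d, ℂ)) {t : ℝ}
    (ht : 0 < t) {g : Sp d → Y} (hg : Integrable g) (k : ℕ) (x : Sp d) :
    ‖iteratedFDeriv ℝ k (𝓕⁻ fun ξ => θ (t • ξ) • g ξ) x‖ ≤
      ((2 * Real.pi) ^ k * (t⁻¹) ^ k) * ∑ I : Fin k → Fin d,
        ‖𝓕⁻ (fun ξ => monomialMul θ I (t • ξ) • g ξ) x‖ := by
  refine (norm_multilinear_le_sum_stdVec _).trans (le_of_eq ?_)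
  rw [Finset.mul_sum]
  refine Finset.sum_congr rfl fun I _ => ?_
  rw [iteratedFDeriv_multiplier_stdVec θ ht hg, norm_smul]
  congr 1
  simp [abs_of_pos Real.pi_pos, abs_of_pos ht]

theorem fourier_coe_fourierInv (φ : 𝓢(Sp d, ℂ)) :
    𝓕 ((𝓕⁻ φ : 𝓢(Sp d, ℂ)) : Sp d → ℂ) = φ := by
  rw [← SchwartzMap.fourier_coe, FourierInvPair.fourier_fourierInv_eq]

theorem multiplier_eq_dilAvg [NormedSpace ℂ Y] [CompleteSpace Y] (θ : 𝓢(Sp d, ℂ)) (t : ℝ)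
    {g : Sp d → Y} (hg : Integrable g) (x : Sp d) :
    𝓕⁻ (fun ξ => θ (t • ξ) • g ξ) x = dilAvg (𝓕⁻ θ : 𝓢(Sp d, ℂ)) t (𝓕⁻ g) x := by
  rw [dilAvg_fourierInv ((𝓕⁻ θ : 𝓢(Sp d, ℂ)).integrable (μ := volume)) hg, fourier_coe_fourierInv]

/-- Bernstein's inequality in `L^∞`. -/
theorem exists_norm_iteratedFDeriv_multiplier_le [NormedSpace ℂ Y] [CompleteSpace Y]
    (θ : 𝓢(Sp d, ℂ)) (k : ℕ) :
    ∃ C : ℝ, 0 ≤ C ∧ ∀ (g : Sp d → Y) (b t : ℝ), Integrable g → 0 < t → (∀ x, ‖𝓕⁻ g x‖ ≤ b) →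
      ∀ x, ‖iteratedFDeriv ℝ k (𝓕⁻ fun ξ => θ (t • ξ) • g ξ) x‖ ≤ C * b * t⁻¹ ^ k := by
  refine ⟨(2 * Real.pi) ^ k * ∑ I : Fin k → Fin d,
    ∫ z, ‖(𝓕⁻ (monomialMul θ I) : 𝓢(Sp d, ℂ)) z‖, ?_, ?_⟩
  · have := Real.pi_pos
    exact mul_nonneg (by positivity) (Finset.sum_nonneg fun I _ => by positivity)
  intro g b t hg ht hb x
  refine (norm_iteratedFDeriv_multiplier_le_sum θ ht hg k x).trans ?_
  have hpi := Real.pi_pos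
  have : ∀ I : Fin k → Fin d, ‖𝓕⁻ (fun ξ => monomialMul θ I (t • ξ) • g ξ) x‖ ≤
      (∫ z, ‖(𝓕⁻ (monomialMul θ I) : 𝓢(Sp d, ℂ)) z‖) * b := fun I => by
    rw [multiplier_eq_dilAvg _ t hg]
    exact norm_dilAvg_le ((𝓕⁻ (monomialMul θ I) : 𝓢(Sp d, ℂ)).integrable (μ := volume)) hb t x
  calc _ ≤ ((2 * Real.pi) ^ k * (t⁻¹) ^ k) * ∑ I : Fin k → Fin d,
        (∫ z, ‖(𝓕⁻ (monomialMul θ I) : 𝓢(Sp d, ℂ)) z‖) * b := by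
        gcongr with I
        exact this I
    _ = _ := by rw [← Finset.sum_mul]; ring

/-- A multiplier that vanishes to order `r` at the origin gains the power `t^r` at scale `t`. -/
theorem eLpNorm_multiplier_le [InnerProductSpace ℂ Y] [CompleteSpace Y] {m : Sp d → ℂ}
    {r : ℝ} {C : ℝ} (hm : ∀ ξ, ‖m ξ‖ ≤ C * ‖ξ‖ ^ r) {t : ℝ} (ht : 0 < t)
    {g : Sp d → Y} (h1 : Integrable fun ξ => m (t • ξ) • g ξ)
    (h2 : MemLp (fun ξ => m (t • ξ) • g ξ) 2 volume) :
    eLpNorm (𝓕⁻ fun ξ => m (t • ξ) • g ξ) 2 volume ≤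
      ENNReal.ofReal (C * t ^ r) * eLpNorm (fun ξ => ‖ξ‖ ^ r • g ξ) 2 volume := by
  rw [eLpNorm_fourierInv h1 h2]
  refine eLpNorm_le_mul_eLpNorm_of_ae_le_mul (Filter.Eventually.of_forall fun ξ => ?_) 2
  rw [norm_smul, norm_smul, ← mul_assoc]
  gcongr
  refine (hm _).trans (le_of_eq ?_)
  rw [norm_smul, Real.norm_of_nonneg ht.le, Real.mul_rpow ht.le (norm_nonneg _),
    Real.norm_of_nonneg (by positivity), mul_assoc]

/-- Bernstein's inequality in `L²`, for multipliers that vanish to order `r` at the origin. -/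
theorem exists_eLpNorm_iteratedFDeriv_multiplier_le [InnerProductSpace ℂ Y] [CompleteSpace Y]
    (θ : 𝓢(Sp d, ℂ)) (k : ℕ) {r C₀ : ℝ} (hC₀ : 0 ≤ C₀)
    (hθ : ∀ ξ, ‖ξ‖ ^ k * ‖θ ξ‖ ≤ C₀ * ‖ξ‖ ^ r) :
    ∃ C : ℝ, 0 ≤ C ∧ ∀ (g : Sp d → Y) (t : ℝ), Integrable g → MemLp g 2 volume → 0 < t →
      eLpNorm (iteratedFDeriv ℝ k (𝓕⁻ fun ξ => θ (t • ξ) • g ξ)) 2 volume ≤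
        ENNReal.ofReal (C * (t⁻¹ ^ k * t ^ r)) *
          eLpNorm (fun ξ => ‖ξ‖ ^ r • g ξ) 2 volume := by
  have hpi := Real.pi_pos
  refine ⟨(2 * Real.pi) ^ k * (Fintype.card (Fin k → Fin d) * C₀), by positivity, ?_⟩
  intro g t hg h2 ht
  set f : (Fin k → Fin d) → Sp d → Y := fun I => 𝓕⁻ fun ξ => monomialMul θ I (t • ξ) • g ξ with hf
  have hfc : ∀ I, Continuous (f I) := fun I => continuous_fourierInv (integrable_multiplier _ t hg)
  have e1 : eLpNorm (iteratedFDeriv ℝ k (𝓕⁻ fun ξ => θ (t • ξ) • g ξ)) 2 volume ≤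
      ENNReal.ofReal ((2 * Real.pi) ^ k * (t⁻¹) ^ k) *
        eLpNorm (∑ I, fun x => ‖f I x‖) 2 volume := by
    refine eLpNorm_le_mul_eLpNorm_of_ae_le_mul (Filter.Eventually.of_forall fun x => ?_) 2
    refine (norm_iteratedFDeriv_multiplier_le_sum θ ht hg k x).trans ?_
    gcongr
    rw [Finset.sum_apply, Real.norm_of_nonneg (Finset.sum_nonneg fun _ _ => norm_nonneg _)]
  have e2 : eLpNorm (∑ I, fun x => ‖f I x‖) 2 volume ≤ ∑ _I : Fin k → Fin d,
      ENNReal.ofReal (C₀ * t ^ r) * eLpNorm (fun ξ => ‖ξ‖ ^ r • g ξ) 2 volume := by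
    refine (eLpNorm_sum_le (fun I _ => (hfc I).norm.aestronglyMeasurable) (by norm_num)).trans ?_
    refine Finset.sum_le_sum fun I _ => ?_
    rw [eLpNorm_norm]
    exact eLpNorm_multiplier_le (fun ξ => (norm_monomialMul_le θ I ξ).trans (hθ ξ)) ht
      (integrable_multiplier _ t hg) (memLp_multiplier _ t h2)
  refine e1.trans ((mul_le_mul_right e2 _).trans (le_of_eq ?_))
  rw [Finset.sum_const, nsmul_eq_mul, Finset.card_univ, ← mul_assoc, ← mul_assoc]
  congr 1
  rw [← ENNReal.ofReal_natCast, ← ENNReal.ofReal_mul (by positivity),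
    ← ENNReal.ofReal_mul (by positivity)]
  congr 1
  ring

end Multiplier

/-! ### High frequencies of a composition -/

/-- The part of `f` at spatial scales below `t`, with respect to the averaging kernel `κ`. -/
noncomputable def highPart {d : ℕ} {Y : Type*} [NormedAddCommGroup Y] [NormedSpace ℂ Y]
    (κ : Sp d → ℂ) (t : ℝ) (f : Sp d → Y) (x : Sp d) : Y :=
  f x - dilAvg κ t f x

section highPart

variable {d : ℕ} {Y : Type*} [NormedAddCommGroup Y] [NormedSpace ℂ Y]

theorem continuous_highPart {κ : Sp d → ℂ} (hκ : Integrable κ) {f : Sp d → Y}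
    (hf : Continuous f) {b : ℝ} (hb : ∀ x, ‖f x‖ ≤ b) (t : ℝ) : Continuous (highPart κ t f) :=
  hf.sub (continuous_dilAvg hκ hf hb t)

theorem eLpNorm_highPart_le {κ : Sp d → ℂ} (hκ : Integrable κ) (hκm : Measurable κ)
    {f : Sp d → Y} (hf : Continuous f) {b : ℝ} (hb : ∀ x, ‖f x‖ ≤ b) (t : ℝ) :
    eLpNorm (highPart κ t f) 2 volume ≤ (1 + ∫⁻ z, ‖κ z‖ₑ) * eLpNorm f 2 volume := by
  refine (eLpNorm_sub_le hf.aestronglyMeasurable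
    (continuous_dilAvg hκ hf hb t).aestronglyMeasurable (by norm_num)).trans ?_
  rw [add_mul, one_mul]
  gcongr
  exact eLpNorm_dilAvg_le hκm hf t

theorem highPart_eq_add {κ : Sp d → ℂ} (hκ : Integrable κ) {f g : Sp d → Y} (hf : Continuous f)
    (hg : Continuous g) {b c : ℝ} (hb : ∀ x, ‖f x‖ ≤ b) (hc : ∀ x, ‖g x‖ ≤ c) (t : ℝ) :
    highPart κ t f = highPart κ t (fun y => f y - g y) + highPart κ t g := by
  funext x
  simp only [highPart, Pi.add_apply, dilAvg_sub hκ hf hg hb hc]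
  abel

theorem highPart_const [CompleteSpace Y] {κ : Sp d → ℂ} (h1 : ∫ z, κ z = 1) (t : ℝ) (y : Y) :
    highPart κ t (fun _ => y) = 0 := by
  funext x
  simp [highPart, dilAvg, integral_smul_const, h1]

end highPart

section Composition

variable {d : ℕ} {Y Z : Type u} [NormedAddCommGroup Y] [NormedSpace ℂ Y]
  [NormedAddCommGroup Z] [NormedSpace ℂ Z]

theorem norm_comp_sub_comp_le {F : Y → Z} (hF : ContDiff ℝ ∞ F) {M R : ℝ}
    (hM : ∀ z, ‖z‖ ≤ R → ‖iteratedFDeriv ℝ 1 F z‖ ≤ M) {y z : Y} (hy : ‖y‖ ≤ R) (hz : ‖z‖ ≤ R) :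
    ‖F y - F z‖ ≤ M * ‖y - z‖ := by
  refine (convex_closedBall (0 : Y) R).norm_image_sub_le_of_norm_fderiv_le (𝕜 := ℝ)
    (fun z _ => (hF.differentiable (by simp)) z) (fun z hz => ?_) (by simpa using hz)
    (by simpa using hy)
  have := hM z (by simpa using hz)
  rwa [norm_iteratedFDeriv_one] at this

/-- A bound that uses no smoothness of `v` and `w`, only the Lipschitz bound for `F` on a ball. -/
theorem eLpNorm_highPart_comp_sub_comp_le {κ : Sp d → ℂ} (hκ : Integrable κ) (hκm : Measurable κ)
    {F : Y → Z} (hF : ContDiff ℝ ∞ F) {M R : ℝ}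
    (hM : ∀ z, ‖z‖ ≤ R → ‖iteratedFDeriv ℝ 1 F z‖ ≤ M) {v w : Sp d → Y}
    (hv : Continuous v) (hw : Continuous w) (hvR : ∀ x, ‖v x‖ ≤ R) (hwR : ∀ x, ‖w x‖ ≤ R)
    (t : ℝ) : eLpNorm (highPart κ t fun x => F (v x) - F (w x)) 2 volume ≤
      (1 + ∫⁻ z, ‖κ z‖ₑ) * (ENNReal.ofReal M * eLpNorm (fun x => v x - w x) 2 volume) := by
  have hM0 : 0 ≤ M := (norm_nonneg _).trans (hM _ (hvR 0))
  have hl : ∀ x, ‖F (v x) - F (w x)‖ ≤ M * ‖v x - w x‖ := fun x =>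
    norm_comp_sub_comp_le hF hM (hvR x) (hwR x)
  refine (eLpNorm_highPart_le hκ hκm (b := M * (R + R)) ?_ (fun x => ?_) t).trans ?_
  · exact (hF.continuous.comp hv).sub (hF.continuous.comp hw)
  · exact (hl x).trans (mul_le_mul_of_nonneg_left
      ((norm_sub_le _ _).trans (add_le_add (hvR x) (hwR x))) hM0)
  · gcongr
    exact eLpNorm_le_mul_eLpNorm_of_ae_le_mul (Filter.Eventually.of_forall hl) 2

/-- If `v` and `w` live at spatial scales `≥ 1/D`, then the part of `F ∘ v - F ∘ w` at scales below
`t` gains the factor `(t D)^(n+1)`, and the bound stays linear in `v - w`. -/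
theorem exists_eLpNorm_highPart_comp_sub_comp_le [CompleteSpace Z] (ψ : 𝓢(Sp d, ℂ))
    (hψ : ∀ᶠ ξ in nhds (0 : Sp d), 𝓕 (ψ : Sp d → ℂ) ξ = 1) (n : ℕ) :
    ∃ C : ℝ, 0 ≤ C ∧ ∀ (F : Y → Z) (M R : ℝ) (v w : Sp d → Y) (D t : ℝ) (l : ℝ≥0∞),
      ContDiff ℝ ∞ F → 0 ≤ M → 0 < D → 0 ≤ t →
      (∀ a ≤ n + 2, ∀ z, ‖z‖ ≤ R → ‖iteratedFDeriv ℝ a F z‖ ≤ M) →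
      ContDiff ℝ ∞ v → ContDiff ℝ ∞ w → (∀ x, ‖v x‖ ≤ R) → (∀ x, ‖w x‖ ≤ R) →
      (∀ a, 1 ≤ a → a ≤ n + 1 → ∀ x, ‖iteratedFDeriv ℝ a v x‖ ≤ D ^ a) →
      (∀ a, 1 ≤ a → a ≤ n + 1 → ∀ x, ‖iteratedFDeriv ℝ a w x‖ ≤ D ^ a) →
      (∀ a ≤ n + 1, eLpNorm (iteratedFDeriv ℝ a fun x => v x - w x) 2 volume ≤
        ENNReal.ofReal (D ^ a) * l) →
      eLpNorm (highPart ψ t fun x => F (v x) - F (w x)) 2 volume ≤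
        ENNReal.ofReal (C * M * (t * D) ^ (n + 1)) * l := by
  obtain ⟨C₁, hT⟩ := exists_eLpNorm_sub_dilAvg_le (Y := Z) ψ hψ n
  obtain ⟨c, hc, hcomp⟩ := exists_norm_iteratedFDeriv_comp_sub_comp_le (X := Sp d) (E := Y) (n + 1)
  refine ⟨C₁ * (c * (n + 2 : ℕ)), by positivity, ?_⟩
  intro F M R v w D t l hF hM hD ht hFM hv hw hvR hwR hvD hwD hl
  have hvw : ContDiff ℝ ∞ fun x => v x - w x := hv.sub hw
  -- `L x` is the least admissible `l` in the pointwise estimate at `x`, up to the sum over `a`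
  set L : Sp d → ℝ := ∑ a ∈ Finset.range (n + 2), fun x =>
    (D ^ a)⁻¹ * ‖iteratedFDeriv ℝ a (fun x => v x - w x) x‖ with hL
  have hLapp : ∀ x, L x = ∑ a ∈ Finset.range (n + 2),
      (D ^ a)⁻¹ * ‖iteratedFDeriv ℝ a (fun x => v x - w x) x‖ := fun x => by
    rw [hL, Finset.sum_apply]
  have hL0 : ∀ x, 0 ≤ L x := fun x => by
    rw [hLapp]; exact Finset.sum_nonneg fun a _ => by positivity
  have hcont : ∀ a : ℕ, Continuous (iteratedFDeriv ℝ a fun x => v x - w x) := fun a =>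
    hvw.continuous_iteratedFDeriv (by exact_mod_cast le_top)
  have hLn : eLpNorm L 2 volume ≤ (n + 2 : ℕ) * l := by
    refine (eLpNorm_sum_le (fun a _ => ?_) (by norm_num)).trans ?_
    · exact ((hcont a).norm.const_mul _).aestronglyMeasurable
    · calc _ ≤ ∑ _a ∈ Finset.range (n + 2), l := by
            refine Finset.sum_le_sum fun a ha => ?_
            have hDa : 0 < D ^ a := by positivity
            have h1 : eLpNorm (fun x =>
                (D ^ a)⁻¹ * ‖iteratedFDeriv ℝ a (fun x => v x - w x) x‖) 2 volume ≤
                ENNReal.ofReal (D ^ a)⁻¹ *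
                  eLpNorm (iteratedFDeriv ℝ a fun x => v x - w x) 2 volume := by
              refine eLpNorm_le_mul_eLpNorm_of_ae_le_mul (Filter.Eventually.of_forall fun x => ?_) 2
              rw [norm_mul, norm_norm, Real.norm_of_nonneg (by positivity)]
            refine h1.trans ((mul_le_mul_right
              (hl a (by have := Finset.mem_range.1 ha; omega)) _).trans (le_of_eq ?_))
            rw [← mul_assoc, ← ENNReal.ofReal_mul (by positivity), inv_mul_cancel₀ hDa.ne']
            simp
        _ = _ := by simp
  have hpt : ∀ x, ‖iteratedFDeriv ℝ (n + 1) (fun y => F (v y) - F (w y)) x‖ ≤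
      (c * M * D ^ (n + 1)) * ‖L x‖ := by
    intro x
    rw [Real.norm_of_nonneg (hL0 x)]
    refine (hcomp (n + 1) le_rfl Z F v w x M D (L x) R hF hv hw hM hD.le (hL0 x) (hvR x) (hwR x)
      hFM (fun a h1 h2 => hvD a h1 h2 x) (fun a h1 h2 => hwD a h1 h2 x) fun a ha => ?_).trans
      (le_of_eq (by ring))
    rw [hLapp, Finset.sum_mul]
    have hDa : 0 < D ^ a := by positivity
    calc _ = (D ^ a)⁻¹ * ‖iteratedFDeriv ℝ a (fun x => v x - w x) x‖ * D ^ a := by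
          field_simp
      _ ≤ _ := Finset.single_le_sum
        (f := fun i => (D ^ i)⁻¹ * ‖iteratedFDeriv ℝ i (fun x => v x - w x) x‖ * D ^ a)
        (fun i _ => by positivity) (Finset.mem_range.2 (by omega))
  have hgb : ∀ x, ‖F (v x) - F (w x)‖ ≤ M + M := fun x => by
    have h0 := fun z hz => hFM 0 (by omega) z hz
    simp only [norm_iteratedFDeriv_zero] at h0
    exact (norm_sub_le _ _).trans (add_le_add (h0 _ (hvR x)) (h0 _ (hwR x)))
  have hg : ContDiff ℝ ∞ fun x => F (v x) - F (w x) := (hF.comp hv).sub (hF.comp hw)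
  refine (hT _ _ t hg hgb ht).trans ?_
  have h3 := eLpNorm_le_mul_eLpNorm_of_ae_le_mul (p := 2) (μ := (volume : Measure (Sp d)))
    (Filter.Eventually.of_forall hpt)
  calc _ ≤ (C₁ : ℝ≥0∞) * ENNReal.ofReal (t ^ (n + 1)) *
        (ENNReal.ofReal (c * M * D ^ (n + 1)) * ((n + 2 : ℕ) * l)) := by
        gcongr
        exact h3.trans (mul_le_mul_right hLn _)
    _ = _ := by
      rw [← ENNReal.ofReal_coe_nnreal, ← ENNReal.ofReal_natCast, ← mul_assoc, ← mul_assoc,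
        ← ENNReal.ofReal_mul (by positivity), ← ENNReal.ofReal_mul (by positivity),
        ← ENNReal.ofReal_mul (by positivity)]
      congr 2
      rw [mul_pow]
      ring

end Composition

/-! ### Littlewood-Paley bounds -/

section LittlewoodPaley

variable {d : ℕ} {Y : Type*} [NormedAddCommGroup Y]

theorem fourierInv_sub_apply [NormedSpace ℂ Y] {f g : Sp d → Y} (hf : Integrable f)
    (hg : Integrable g) (x : Sp d) : 𝓕⁻ (fun ξ => f ξ - g ξ) x = 𝓕⁻ f x - 𝓕⁻ g x := by
  have h : ∀ {f : Sp d → Y}, Integrable f → Integrable fun ξ => (𝐞 ⟪ξ, x⟫ : Circle) • f ξ := by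
    intro f hf
    have := (Real.fourierIntegral_convergent_iff (-x)).2 hf
    simpa using this
  simp_rw [Real.fourierInv_eq, smul_sub]
  exact integral_sub (h hf) (h hg)

/-- A function that vanishes near the origin and decays vanishes there to any order `s`. -/
theorem exists_le_mul_rpow_of_eq_zero {f : Sp d → ℝ} {ε c s : ℝ} (hε : 0 < ε) (hs : 0 ≤ s)
    (h0 : ∀ ξ, ‖ξ‖ ≤ ε → f ξ = 0) (hc : ∀ ξ, f ξ ≤ c) (hc0 : 0 ≤ c) :
    ∀ ξ, f ξ ≤ c * ε⁻¹ ^ s * ‖ξ‖ ^ s := by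
  intro ξ
  rcases le_or_gt ‖ξ‖ ε with h | h
  · rw [h0 ξ h]; positivity
  · refine (hc ξ).trans ?_
    rw [mul_assoc, ← Real.mul_rpow (by positivity) (norm_nonneg _)]
    refine le_mul_of_one_le_right hc0 (Real.one_le_rpow ?_ hs)
    rw [← div_eq_inv_mul, le_div_iff₀ hε]
    linarith

/-- The Littlewood-Paley bounds for the low frequency truncations
`u_t = 𝓕⁻ (φ(t ·) g)` of `u = 𝓕⁻ g`, for a cut-off `φ` equal to one near the origin. -/
theorem exists_littlewoodPaley_bounds [InnerProductSpace ℂ Y] [CompleteSpace Y] (φ : 𝓢(Sp d, ℂ))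
    {ε : ℝ} (hε : 0 < ε) (hφ : ∀ ξ, ‖ξ‖ ≤ ε → φ ξ = 1) {s : ℝ} (hs : 0 ≤ s) (n : ℕ) :
    ∃ A : ℝ, 1 ≤ A ∧ ∀ (g : Sp d → Y) (b : ℝ) (W : ℝ≥0∞), Integrable g → MemLp g 2 volume →
      (∀ x, ‖𝓕⁻ g x‖ ≤ b) → eLpNorm g 2 volume ≤ W →
      eLpNorm (fun ξ => ‖ξ‖ ^ s • g ξ) 2 volume ≤ W →
      (∀ t, 0 < t → ∀ a ≤ n, ∀ x,
        ‖iteratedFDeriv ℝ a (𝓕⁻ fun ξ => φ (t • ξ) • g ξ) x‖ ≤ A * b * t⁻¹ ^ a) ∧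
      (∀ t, 0 < t → ∀ a ≤ n, eLpNorm (iteratedFDeriv ℝ a fun x =>
        𝓕⁻ (fun ξ => φ ((t * 2⁻¹) • ξ) • g ξ) x - 𝓕⁻ (fun ξ => φ (t • ξ) • g ξ) x) 2 volume ≤
          ENNReal.ofReal (A * (t⁻¹ ^ a * t ^ s)) * W) ∧
      (∀ a ≤ n, eLpNorm (iteratedFDeriv ℝ a (𝓕⁻ fun ξ => φ ((1 : ℝ) • ξ) • g ξ)) 2 volume ≤
        ENNReal.ofReal A * W) ∧
      ∀ t, 0 < t → eLpNorm (fun x => 𝓕⁻ g x - 𝓕⁻ (fun ξ => φ (t • ξ) • g ξ) x) 2 volume ≤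
        ENNReal.ofReal (A * t ^ s) * W := by
  choose A₁ hA₁ h₁ using fun a => exists_norm_iteratedFDeriv_multiplier_le (Y := Y) φ a
  choose S hS hφS using fun a => exists_pow_mul_norm_schwartz_le φ a
  -- the multiplier of the dyadic blocks: it vanishes near the origin
  let δ : 𝓢(Sp d, ℂ) := SchwartzMap.compCLMOfContinuousLinearEquiv ℂ
    (ContinuousLinearEquiv.smulLeft (Units.mk0 (2⁻¹ : ℝ) (by norm_num))) φ - φ
  have hδ : ∀ ξ, δ ξ = φ ((2⁻¹ : ℝ) • ξ) - φ ξ := fun ξ => rfl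
  have hδ0 : ∀ ξ, ‖ξ‖ ≤ ε → δ ξ = 0 := fun ξ hξ => by
    rw [hδ, hφ ξ hξ, hφ _ (by
      rw [norm_smul, Real.norm_of_nonneg (by norm_num)]; linarith [norm_nonneg ξ]), sub_self]
  choose D hD hδD using fun a => exists_pow_mul_norm_schwartz_le δ a
  choose A₂ hA₂ h₂ using fun a => exists_eLpNorm_iteratedFDeriv_multiplier_le (Y := Y) δ a
    (r := s) (C₀ := D a * ε⁻¹ ^ s) (by have := hD a; positivity)
    (exists_le_mul_rpow_of_eq_zero (f := fun ξ => ‖ξ‖ ^ a * ‖δ ξ‖) hε hs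
      (fun ξ hξ => by simp [hδ0 ξ hξ]) (hδD a) (hD a))
  choose A₃ hA₃ h₃ using fun a => exists_eLpNorm_iteratedFDeriv_multiplier_le (Y := Y) φ a
    (r := 0) (C₀ := S a) (hS a) (fun ξ => by simpa using hφS a ξ)
  have hm : ∀ ξ, ‖1 - φ ξ‖ ≤ (1 + S 0) * ε⁻¹ ^ s * ‖ξ‖ ^ s :=
    exists_le_mul_rpow_of_eq_zero hε hs (fun ξ hξ => by simp [hφ ξ hξ])
      (fun ξ => (norm_sub_le _ _).trans (by simpa using hφS 0 ξ)) (by linarith [hS 0])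
  have hS0 := hS 0
  set B₁ := ∑ a ∈ Finset.range (n + 1), A₁ a with hB₁
  set B₂ := ∑ a ∈ Finset.range (n + 1), A₂ a with hB₂
  set B₃ := ∑ a ∈ Finset.range (n + 1), A₃ a with hB₃
  set B₄ := (1 + S 0) * ε⁻¹ ^ s with hB₄
  have p₁ : 0 ≤ B₁ := Finset.sum_nonneg fun a _ => hA₁ a
  have p₂ : 0 ≤ B₂ := Finset.sum_nonneg fun a _ => hA₂ a
  have p₃ : 0 ≤ B₃ := Finset.sum_nonneg fun a _ => hA₃ a
  have p₄ : 0 ≤ B₄ := by positivity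
  have q₁ : ∀ a ≤ n, A₁ a ≤ B₁ := fun a ha =>
    Finset.single_le_sum (fun i _ => hA₁ i) (Finset.mem_range.2 (by omega))
  have q₂ : ∀ a ≤ n, A₂ a ≤ B₂ := fun a ha =>
    Finset.single_le_sum (fun i _ => hA₂ i) (Finset.mem_range.2 (by omega))
  have q₃ : ∀ a ≤ n, A₃ a ≤ B₃ := fun a ha =>
    Finset.single_le_sum (fun i _ => hA₃ i) (Finset.mem_range.2 (by omega))
  refine ⟨1 + B₁ + B₂ + B₃ + B₄, by linarith, ?_⟩
  intro g b W hg hg2 hb hW hWs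
  have hb0 : 0 ≤ b := (norm_nonneg _).trans (hb 0)
  refine ⟨fun t ht a ha x => ?_, fun t ht a ha => ?_, fun a ha => ?_, fun t ht => ?_⟩
  · refine (h₁ a g b t hg ht hb x).trans ?_
    gcongr
    linarith [q₁ a ha]
  · have e : (fun x => 𝓕⁻ (fun ξ => φ ((t * 2⁻¹) • ξ) • g ξ) x - 𝓕⁻ (fun ξ => φ (t • ξ) • g ξ) x) =
        𝓕⁻ fun ξ => δ (t • ξ) • g ξ := by
      funext x
      rw [← fourierInv_sub_apply (integrable_multiplier φ _ hg) (integrable_multiplier φ t hg)]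
      refine congrArg (fun f : Sp d → Y => 𝓕⁻ f x) (funext fun ξ => ?_)
      rw [hδ, smul_smul, mul_comm t, sub_smul]
    rw [e]
    refine (h₂ a g t hg hg2 ht).trans (mul_le_mul' (ENNReal.ofReal_le_ofReal ?_) hWs)
    gcongr
    linarith [q₂ a ha]
  · refine (h₃ a g 1 hg hg2 one_pos).trans (mul_le_mul' (ENNReal.ofReal_le_ofReal ?_) ?_)
    · simp only [inv_one, one_pow, Real.one_rpow, mul_one]
      linarith [q₃ a ha]
    · simpa using hW
  · have e : (fun x => 𝓕⁻ g x - 𝓕⁻ (fun ξ => φ (t • ξ) • g ξ) x) =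
        𝓕⁻ fun ξ => (1 - φ (t • ξ)) • g ξ := by
      funext x
      rw [← fourierInv_sub_apply hg (integrable_multiplier φ t hg)]
      simp_rw [sub_smul, one_smul]
    rw [e]
    have i1 : Integrable fun ξ => (1 - φ (t • ξ)) • g ξ := by
      simp_rw [sub_smul, one_smul]
      exact hg.sub (integrable_multiplier φ t hg)
    have i2 : MemLp (fun ξ => (1 - φ (t • ξ)) • g ξ) 2 volume := by
      simp_rw [sub_smul, one_smul]
      exact hg2.sub (memLp_multiplier φ t hg2)
    refine (eLpNorm_multiplier_le (m := fun ξ => 1 - φ ξ) hm ht i1 i2).trans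
      (mul_le_mul' (ENNReal.ofReal_le_ofReal ?_) hWs)
    gcongr
    linarith

end LittlewoodPaley

/-! ### Summation over the dyadic blocks -/

section Moser

variable {d : ℕ} {Y Z : Type u} [NormedAddCommGroup Y] [InnerProductSpace ℂ Y] [CompleteSpace Y]
  [NormedAddCommGroup Z] [NormedSpace ℂ Z] [CompleteSpace Z]

/-- The geometric sum over the dyadic blocks coarser than the scale `2^{-N}`. Each block gains the
power `n + 1 ≥ s + 1` of the ratio of the scales, so the finest block dominates. -/
theorem sum_dyadic_le {s : ℝ} {n : ℕ} (hn : s ≤ n) (N : ℕ) :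
    ∑ q ∈ Finset.range N, ((2⁻¹ : ℝ) ^ N * 2 ^ q) ^ (n + 1) * ((2⁻¹ : ℝ) ^ q) ^ s ≤
      ((2⁻¹ : ℝ) ^ N) ^ s := by
  set ρ : ℝ := 2 ^ ((n + 1 : ℕ) - s : ℝ) with hρ
  have hρ2 : 2 ≤ ρ := by
    calc (2 : ℝ) = 2 ^ (1 : ℝ) := (Real.rpow_one 2).symm
      _ ≤ ρ := Real.rpow_le_rpow_of_exponent_le one_le_two (by push_cast; linarith)
  have hpow : ∀ q : ℕ, ((2 : ℝ) ^ q) ^ (n + 1) * ((2⁻¹ : ℝ) ^ q) ^ s = ρ ^ q := by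
    intro q
    rw [hρ, ← Real.rpow_natCast ((2 : ℝ) ^ ((n + 1 : ℕ) - s : ℝ)), ← Real.rpow_mul zero_le_two,
      inv_pow, Real.inv_rpow (by positivity), ← Real.rpow_natCast 2 q,
      ← Real.rpow_natCast _ (n + 1), ← Real.rpow_mul zero_le_two, ← Real.rpow_mul zero_le_two,
      ← Real.rpow_neg zero_le_two, ← Real.rpow_add zero_lt_two]
    congr 1
    ring
  have hsum : ∀ N : ℕ, ∑ q ∈ Finset.range N, ρ ^ q ≤ ρ ^ N := by
    intro N
    induction N with
    | zero => simp
    | succ N ih =>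
      rw [Finset.sum_range_succ, pow_succ]
      have : 0 < ρ ^ N := by positivity
      nlinarith
  calc _ = ((2⁻¹ : ℝ) ^ N) ^ (n + 1) * ∑ q ∈ Finset.range N, ρ ^ q := by
        rw [Finset.mul_sum]
        refine Finset.sum_congr rfl fun q _ => ?_
        rw [← hpow q, mul_pow]
        ring
    _ ≤ ((2⁻¹ : ℝ) ^ N) ^ (n + 1) * ρ ^ N := by gcongr; exact hsum N
    _ = _ := by
        rw [← hpow N, ← mul_assoc, ← mul_pow, ← mul_pow]
        simp

/-- The tame estimate: the part of `F ∘ u` at scales below `t ≤ 1` is `O(t^s)` in `L²`, with a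
constant that is linear in the Sobolev norm of `u = 𝓕⁻ g` and depends otherwise only on `sup |u|`
and on bounds for the derivatives of `F`. With `u_q` the truncation of `u` to frequencies
`≲ 2^q` and `t = 2^{-N}`, one writes `F(u)` as `F(u) - F(u_N)`, plus the blocks
`F(u_{q+1}) - F(u_q)`, `q < N`, plus `F(u_0) - F(0)`, plus a constant. -/
theorem exists_eLpNorm_highPart_comp_le_of_scale (φ : 𝓢(Sp d, ℂ))
    {ε : ℝ} (hε : 0 < ε) (hφ : ∀ ξ, ‖ξ‖ ≤ ε → φ ξ = 1) {s : ℝ} (hs : 0 ≤ s) :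
    ∃ (C : ℝ) (K : ℕ) (R₀ : ℝ), 0 ≤ C ∧ 1 ≤ R₀ ∧ 1 ≤ K ∧
      ∀ (F : Y → Z) (M b : ℝ) (g : Sp d → Y) (W : ℝ≥0∞) (N : ℕ), ContDiff ℝ ∞ F → 0 ≤ M →
      Integrable g → MemLp g 2 volume → (∀ x, ‖𝓕⁻ g x‖ ≤ b) →
      (∀ a ≤ K, ∀ z, ‖z‖ ≤ R₀ * b → ‖iteratedFDeriv ℝ a F z‖ ≤ M) →
      eLpNorm g 2 volume ≤ W → eLpNorm (fun ξ => ‖ξ‖ ^ s • g ξ) 2 volume ≤ W →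
      eLpNorm (highPart (𝓕⁻ φ : 𝓢(Sp d, ℂ)) ((2⁻¹ : ℝ) ^ N) fun x => F (𝓕⁻ g x)) 2 volume ≤
        ENNReal.ofReal (C * M * (1 + b) ^ K * ((2⁻¹ : ℝ) ^ N) ^ s) * W := by
  set n := ⌈s⌉₊ with hn
  have hsn : s ≤ n := Nat.le_ceil s
  set ψ : 𝓢(Sp d, ℂ) := 𝓕⁻ φ with hψ
  have hψi : Integrable ψ := ψ.integrable
  have hFψ : 𝓕 (ψ : Sp d → ℂ) = φ := fourier_coe_fourierInv φ
  have hψ1 : ∀ᶠ ξ in nhds (0 : Sp d), 𝓕 (ψ : Sp d → ℂ) ξ = 1 := by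
    rw [hFψ]
    filter_upwards [Metric.closedBall_mem_nhds (0 : Sp d) hε] with ξ hξ
    exact hφ ξ (by simpa using hξ)
  have hψint : ∫ z, ψ z = 1 := by
    have := hψ1.self_of_nhds
    rw [Real.fourier_eq'] at this
    simpa using this
  obtain ⟨A, hA, hLP⟩ := exists_littlewoodPaley_bounds (Y := Y) φ hε hφ hs (n + 1)
  obtain ⟨C₁, hC₁, hsm⟩ := exists_eLpNorm_highPart_comp_sub_comp_le (Y := Y) (Z := Z) ψ hψ1 n
  set I : ℝ := ∫ z, ‖ψ z‖ with hI
  have hI0 : 0 ≤ I := integral_nonneg fun _ => norm_nonneg _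
  have hIe : (1 : ℝ≥0∞) + ∫⁻ z, ‖ψ z‖ₑ = ENNReal.ofReal (1 + I) := by
    rw [ENNReal.ofReal_add zero_le_one hI0, ENNReal.ofReal_one, hI,
      ofReal_integral_norm_eq_lintegral_enorm hψi]
  -- the three terms of the constant come from the block `F(u_0) - F(0)`, from the intermediate
  -- blocks, and from `F(u) - F(u_N)`
  refine ⟨C₁ * A ^ (n + 1) * A + C₁ * (A * 2) ^ (n + 1) * A + (1 + I) * A, n + 2, A,
    by positivity, hA, by omega, ?_⟩
  intro F M b g W N hF hM hg hg2 hb hFM hW hWs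
  have hb0 : 0 ≤ b := (norm_nonneg _).trans (hb 0)
  obtain ⟨L1, L2, L3, L4⟩ := hLP g b W hg hg2 hb hW hWs
  set τ : ℕ → ℝ := fun q => (2⁻¹ : ℝ) ^ q with hτ
  have hτ0 : ∀ q, 0 < τ q := fun q => by positivity
  have hτi : ∀ q, (τ q)⁻¹ = 2 ^ q := fun q => by simp [hτ]
  set lo : ℕ → Sp d → Y := fun q => 𝓕⁻ fun ξ => φ (τ q • ξ) • g ξ with hlo
  have hloc : ∀ q, ContDiff ℝ ∞ (lo q) := fun q =>
    contDiff_fourierInv (integrable_pow_mul_multiplier φ (hτ0 q) hg)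
  have hlob : ∀ q x, ‖lo q x‖ ≤ A * b := fun q x => by
    simpa using L1 (τ q) (hτ0 q) 0 (by omega) x
  have hUc : Continuous (𝓕⁻ g) := continuous_fourierInv hg
  have hUb : ∀ x, ‖𝓕⁻ g x‖ ≤ A * b := fun x =>
    (hb x).trans (le_mul_of_one_le_left hb0 hA)
  have hFb : ∀ z, ‖z‖ ≤ A * b → ‖F z‖ ≤ M := fun z hz => by
    simpa using hFM 0 (by omega) z hz
  -- all derivatives of `u_q` are controlled by powers of `E 2^q`
  set E : ℝ := A * (1 + b) with hE
  have hE1 : 1 ≤ E := by nlinarith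
  have hbE : A * b ≤ E := by nlinarith
  have hder : ∀ q p : ℕ, q ≤ p → ∀ a, 1 ≤ a → a ≤ n + 1 → ∀ x,
      ‖iteratedFDeriv ℝ a (lo q) x‖ ≤ (E * 2 ^ p) ^ a := by
    intro q p hqp a ha1 ha x
    refine (L1 (τ q) (hτ0 q) a ha x).trans ?_
    rw [hτi, mul_pow]
    gcongr
    · exact hbE.trans (le_self_pow₀ hE1 (by omega))
    · exact one_le_two
  -- the low frequency block
  have h0 : eLpNorm (highPart ψ (τ N) fun x => F (lo 0 x) - F 0) 2 volume ≤
      ENNReal.ofReal (C₁ * M * (τ N * E) ^ (n + 1)) * (ENNReal.ofReal A * W) := by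
    refine hsm F M (A * b) (lo 0) (fun _ => 0) E (τ N) (ENNReal.ofReal A * W) hF hM (by linarith)
      (hτ0 N).le hFM (hloc 0) contDiff_const (hlob 0) (fun _ => by simpa using by positivity)
      (fun a h1 h2 x => by simpa using hder 0 0 le_rfl a h1 h2 x) (fun a h1 h2 x => ?_)
      fun a ha => ?_
    · rw [iteratedFDeriv_const_of_ne (by omega)]
      simpa using by positivity
    · simp only [sub_zero]
      refine (L3 a ha).trans ?_
      refine le_mul_of_one_le_left zero_le ?_
      rw [ENNReal.one_le_ofReal]
      exact one_le_pow₀ hE1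
  -- the intermediate blocks
  have hq : ∀ q, eLpNorm (highPart ψ (τ N) fun x => F (lo (q + 1) x) - F (lo q x)) 2 volume ≤
      ENNReal.ofReal (C₁ * M * (τ N * (E * 2 ^ (q + 1))) ^ (n + 1)) *
        (ENNReal.ofReal (A * τ q ^ s) * W) := by
    intro q
    refine hsm F M (A * b) (lo (q + 1)) (lo q) (E * 2 ^ (q + 1)) (τ N) _ hF hM (by positivity)
      (hτ0 N).le hFM (hloc _) (hloc _) (hlob _) (hlob _) (hder (q + 1) (q + 1) le_rfl)
      (hder q (q + 1) (by omega)) fun a ha => ?_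
    have h2 := L2 (τ q) (hτ0 q) a ha
    have e : τ q * 2⁻¹ = τ (q + 1) := (pow_succ _ _).symm
    rw [e] at h2
    refine h2.trans ?_
    rw [← mul_assoc (ENNReal.ofReal _) (ENNReal.ofReal _), ← ENNReal.ofReal_mul (by positivity)]
    refine mul_le_mul' (ENNReal.ofReal_le_ofReal ?_) le_rfl
    rw [hτi, mul_left_comm]
    gcongr
    calc (2 : ℝ) ^ q ≤ 1 * 2 ^ (q + 1) := by
          rw [one_mul]; exact pow_le_pow_right₀ one_le_two (by omega)
      _ ≤ E * 2 ^ (q + 1) := by gcongr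
  -- summation of the blocks
  have hcomp : ∀ q, Continuous fun x => F (lo q x) := fun q =>
    hF.continuous.comp (hloc q).continuous
  have hcompb : ∀ q x, ‖F (lo q x)‖ ≤ M := fun q x => hFb _ (hlob q x)
  have hsubb : ∀ q x, ‖F (lo (q + 1) x) - F (lo q x)‖ ≤ M + M := fun q x =>
    (norm_sub_le _ _).trans (add_le_add (hcompb _ x) (hcompb _ x))
  have hF0 : ‖F 0‖ ≤ M := hFb 0 (by simpa using by positivity)
  set e : ℕ → ℝ := fun q => C₁ * M * (τ N * (E * 2 ^ (q + 1))) ^ (n + 1) * (A * τ q ^ s) with he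
  have he0 : ∀ q, 0 ≤ e q := fun q => by positivity
  set e' : ℝ := C₁ * M * (τ N * E) ^ (n + 1) * A with he'
  have hlow : ∀ p : ℕ, eLpNorm (highPart ψ (τ N) fun x => F (lo p x)) 2 volume ≤
      ENNReal.ofReal (e' + ∑ q ∈ Finset.range p, e q) * W := by
    intro p
    induction p with
    | zero =>
      rw [highPart_eq_add hψi (hcomp 0) (continuous_const (y := F 0)) (hcompb 0) (fun _ => hF0),
        highPart_const hψint, add_zero]
      refine h0.trans (le_of_eq ?_)
      rw [← mul_assoc, ← ENNReal.ofReal_mul (by positivity)]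
      simp [he']
    | succ p ih =>
      rw [highPart_eq_add hψi (hcomp (p + 1)) (hcomp p) (hcompb _) (hcompb _)]
      refine (eLpNorm_add_le
        (continuous_highPart hψi ((hcomp _).sub (hcomp _)) (hsubb p) _).aestronglyMeasurable
        (continuous_highPart hψi (hcomp _) (hcompb p) _).aestronglyMeasurable (by norm_num)).trans
        ((add_le_add (hq p) ih).trans (le_of_eq ?_))
      rw [← mul_assoc, ← ENNReal.ofReal_mul (by positivity), ← add_mul,
        ← ENNReal.ofReal_add (he0 p) (add_nonneg (by positivity)
          (Finset.sum_nonneg fun q _ => he0 q)), Finset.sum_range_succ]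
      congr 2
      ring
  -- the rough block
  have hhi : eLpNorm (highPart ψ (τ N) fun x => F (𝓕⁻ g x) - F (lo N x)) 2 volume ≤
      ENNReal.ofReal ((1 + I) * (M * (A * τ N ^ s))) * W := by
    refine (eLpNorm_highPart_comp_sub_comp_le hψi ψ.continuous.measurable hF (M := M) (R := A * b)
      (fun z hz => hFM 1 (by omega) z hz) hUc (hloc N).continuous hUb (hlob N) _).trans ?_
    rw [hIe]
    refine (mul_le_mul_right (mul_le_mul_right (L4 (τ N) (hτ0 N)) _) _).trans (le_of_eq ?_)
    rw [← mul_assoc, ← mul_assoc, ← ENNReal.ofReal_mul (by positivity),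
      ← ENNReal.ofReal_mul (by positivity), mul_assoc]
  have hUF : Continuous fun x => F (𝓕⁻ g x) := hF.continuous.comp hUc
  rw [highPart_eq_add hψi hUF (hcomp N) (fun x => hFb _ (hUb x)) (hcompb N)]
  refine (eLpNorm_add_le
    (continuous_highPart hψi (hUF.sub (hcomp _)) (b := M + M)
      (fun x => (norm_sub_le _ _).trans (add_le_add (hFb _ (hUb x)) (hcompb N x)))
      _).aestronglyMeasurable
    (continuous_highPart hψi (hcomp _) (hcompb N) _).aestronglyMeasurable (by norm_num)).trans
    ((add_le_add hhi (hlow N)).trans ?_)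
  rw [← add_mul, ← ENNReal.ofReal_add (by positivity) (add_nonneg (by positivity)
    (Finset.sum_nonneg fun q _ => he0 q))]
  refine mul_le_mul' (ENNReal.ofReal_le_ofReal ?_) le_rfl
  -- the numerical constants
  have hT0 : 0 ≤ τ N ^ s := by positivity
  have hTle : τ N ^ (n + 1) ≤ τ N ^ s := by
    rw [← Real.rpow_natCast]
    refine Real.rpow_le_rpow_of_exponent_ge (hτ0 N)
      (pow_le_one₀ (by norm_num) (by norm_num)) ?_
    push_cast
    linarith
  have hsum : ∑ q ∈ Finset.range N, e q ≤ C₁ * M * (E * 2) ^ (n + 1) * A * τ N ^ s := by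
    have := sum_dyadic_le hsn N
    calc ∑ q ∈ Finset.range N, e q = (C₁ * M * (E * 2) ^ (n + 1) * A) *
          ∑ q ∈ Finset.range N, (τ N * 2 ^ q) ^ (n + 1) * τ q ^ s := by
          rw [Finset.mul_sum]
          refine Finset.sum_congr rfl fun q _ => ?_
          simp only [he, pow_succ (2 : ℝ) q, mul_pow]
          ring
      _ ≤ _ := by gcongr
  have hbp : (1 + b) ^ (n + 1) ≤ (1 + b) ^ (n + 2) := pow_le_pow_right₀ (by linarith) (by omega)
  have hb1 : 1 ≤ (1 + b) ^ (n + 2) := one_le_pow₀ (by linarith)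
  have hEp : E ^ (n + 1) ≤ A ^ (n + 1) * (1 + b) ^ (n + 2) := by
    rw [hE, mul_pow]; gcongr
  have k1 : e' ≤ C₁ * M * (A ^ (n + 1) * (1 + b) ^ (n + 2)) * A * τ N ^ s := by
    calc e' = C₁ * M * E ^ (n + 1) * A * τ N ^ (n + 1) := by rw [he', mul_pow]; ring
      _ ≤ _ := by gcongr
  have k2 : C₁ * M * (E * 2) ^ (n + 1) * A * τ N ^ s ≤
      C₁ * M * ((A * 2) ^ (n + 1) * (1 + b) ^ (n + 2)) * A * τ N ^ s := by
    have : (E * 2) ^ (n + 1) ≤ (A * 2) ^ (n + 1) * (1 + b) ^ (n + 2) := by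
      rw [mul_pow, mul_pow A]
      calc _ ≤ A ^ (n + 1) * (1 + b) ^ (n + 2) * 2 ^ (n + 1) := by gcongr
        _ = _ := by ring
    gcongr
  have k3 : (1 + I) * (M * (A * τ N ^ s)) ≤ (1 + I) * (M * (A * τ N ^ s)) * (1 + b) ^ (n + 2) :=
    le_mul_of_one_le_right (by positivity) hb1
  calc _ ≤ (1 + I) * (M * (A * τ N ^ s)) * (1 + b) ^ (n + 2) +
        (C₁ * M * (A ^ (n + 1) * (1 + b) ^ (n + 2)) * A * τ N ^ s +
          C₁ * M * ((A * 2) ^ (n + 1) * (1 + b) ^ (n + 2)) * A * τ N ^ s) :=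
        add_le_add k3 (add_le_add k1 (hsum.trans k2))
    _ = _ := by ring

/-- The tame estimate at all dyadic scales `t = 2^{-Q}`. For `t ≥ 1` it only expresses that `F` is
Lipschitz. -/
theorem exists_eLpNorm_highPart_comp_le (φ : 𝓢(Sp d, ℂ))
    {ε : ℝ} (hε : 0 < ε) (hφ : ∀ ξ, ‖ξ‖ ≤ ε → φ ξ = 1) {s : ℝ} (hs : 0 ≤ s) :
    ∃ (C : ℝ) (K : ℕ) (R₀ : ℝ), 0 ≤ C ∧ 1 ≤ R₀ ∧
      ∀ (F : Y → Z) (M b : ℝ) (g : Sp d → Y) (W : ℝ≥0∞) (Q : ℤ), ContDiff ℝ ∞ F → 0 ≤ M →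
      Integrable g → MemLp g 2 volume → (∀ x, ‖𝓕⁻ g x‖ ≤ b) →
      (∀ a ≤ K, ∀ z, ‖z‖ ≤ R₀ * b → ‖iteratedFDeriv ℝ a F z‖ ≤ M) →
      eLpNorm g 2 volume ≤ W → eLpNorm (fun ξ => ‖ξ‖ ^ s • g ξ) 2 volume ≤ W →
      eLpNorm (highPart (𝓕⁻ φ : 𝓢(Sp d, ℂ)) ((2 : ℝ) ^ (-Q)) fun x => F (𝓕⁻ g x)) 2 volume ≤
        ENNReal.ofReal (C * M * (1 + b) ^ K * ((2 : ℝ) ^ (-Q)) ^ s) * W := by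
  obtain ⟨C, K, R₀, hC, hR₀, hK, h⟩ := exists_eLpNorm_highPart_comp_le_of_scale (Y := Y) (Z := Z)
    φ hε hφ hs
  set ψ : 𝓢(Sp d, ℂ) := 𝓕⁻ φ with hψ
  have hψi : Integrable ψ := ψ.integrable
  have hψint : ∫ z, ψ z = 1 := by
    have := congrFun (fourier_coe_fourierInv φ) 0
    rw [hφ 0 (by simpa using hε.le), Real.fourier_eq'] at this
    simpa using this
  set I : ℝ := ∫ z, ‖ψ z‖ with hI
  have hI0 : 0 ≤ I := integral_nonneg fun _ => norm_nonneg _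
  have hIe : (1 : ℝ≥0∞) + ∫⁻ z, ‖ψ z‖ₑ = ENNReal.ofReal (1 + I) := by
    rw [ENNReal.ofReal_add zero_le_one hI0, ENNReal.ofReal_one, hI,
      ofReal_integral_norm_eq_lintegral_enorm hψi]
  refine ⟨C + (1 + I), K, R₀, by positivity, hR₀, ?_⟩
  intro F M b g W Q hF hM hg hg2 hb hFM hW hWs
  have hb0 : 0 ≤ b := (norm_nonneg _).trans (hb 0)
  rcases le_total 0 Q with hQ | hQ
  · obtain ⟨N, rfl⟩ := Int.eq_ofNat_of_zero_le hQ
    have e : (2 : ℝ) ^ (-(N : ℤ)) = 2⁻¹ ^ N := by rw [zpow_neg, zpow_natCast, inv_pow]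
    rw [e]
    refine (h F M b g W N hF hM hg hg2 hb hFM hW hWs).trans ?_
    refine mul_le_mul' (ENNReal.ofReal_le_ofReal ?_) le_rfl
    gcongr
    linarith
  · set t : ℝ := (2 : ℝ) ^ (-Q) with ht
    -- here `t ≥ 1`, so `t^s ≥ 1`, and it suffices to bound `F(u) - F(0)` in `L²`
    have ht1 : 1 ≤ t := one_le_zpow₀ one_le_two (by omega)
    have hUc : Continuous (𝓕⁻ g) := continuous_fourierInv hg
    have hUF : Continuous fun x => F (𝓕⁻ g x) := hF.continuous.comp hUc
    have hFb : ∀ z, ‖z‖ ≤ R₀ * b → ‖F z‖ ≤ M := fun z hz => by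
      simpa using hFM 0 (by omega) z hz
    have hUb : ∀ x, ‖𝓕⁻ g x‖ ≤ R₀ * b := fun x =>
      (hb x).trans (le_mul_of_one_le_left hb0 hR₀)
    have h0 : (0 : ℝ) ≤ R₀ * b := by positivity
    rw [highPart_eq_add hψi hUF (continuous_const (y := F 0)) (fun x => hFb _ (hUb x))
      (fun _ => hFb 0 (by simpa using h0)), highPart_const hψint, add_zero]
    refine (eLpNorm_highPart_comp_sub_comp_le hψi ψ.continuous.measurable hF (M := M) (R := R₀ * b)
      (w := fun _ => 0) (fun z hz => hFM 1 hK z hz) hUc continuous_const hUb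
      (fun _ => by simpa using h0) _).trans ?_
    have e2 : eLpNorm (fun x => 𝓕⁻ g x - (0 : Y)) 2 volume = eLpNorm g 2 volume := by
      simp only [sub_zero]
      exact eLpNorm_fourierInv hg hg2
    have e3 : (1 : ℝ) ≤ (1 + b) ^ K * t ^ s :=
      one_le_mul_of_one_le_of_one_le (one_le_pow₀ (by linarith)) (Real.one_le_rpow ht1 hs)
    rw [hIe, e2, ← mul_assoc, ← ENNReal.ofReal_mul (by positivity)]
    refine mul_le_mul' (ENNReal.ofReal_le_ofReal ?_) hW
    calc (1 + I) * M ≤ ((C + (1 + I)) * M) * ((1 + b) ^ K * t ^ s) := by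
          refine le_trans ?_ (le_mul_of_one_le_right (by positivity) e3)
          exact mul_le_mul_of_nonneg_right (by linarith) hM
      _ = _ := by ring

end Moser

/-! ### Dyadic decompositions -/

section Cutoffs

theorem one_le_jap {V : Type*} [NormedAddCommGroup V] (ξ : V) : 1 ≤ jap ξ :=
  Real.one_le_sqrt.2 (by nlinarith [sq_nonneg ‖ξ‖])

theorem jap_pos {V : Type*} [NormedAddCommGroup V] (ξ : V) : 0 < jap ξ :=
  zero_lt_one.trans_le (one_le_jap ξ)

theorem continuous_jap {V : Type*} [NormedAddCommGroup V] : Continuous (jap : V → ℝ) := by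
  unfold jap
  fun_prop

theorem jap_rpow {V : Type*} [NormedAddCommGroup V] (ξ : V) (r : ℝ) :
    jap ξ ^ r = (1 + ‖ξ‖ ^ 2) ^ (r / 2) := by
  rw [jap, Real.sqrt_eq_rpow, ← Real.rpow_mul (by positivity)]
  congr 1
  ring

theorem continuous_lpPiece {V : Type*} [NormedAddCommGroup V] [NormedSpace ℝ V] {φ₀ : V → ℝ}
    (hφ : Continuous φ₀) (k : ℕ) : Continuous (lpPiece φ₀ k) := by
  unfold lpPiece
  split_ifs <;> fun_prop

theorem abs_lpPiece_le {V : Type*} [NormedAddCommGroup V] [NormedSpace ℝ V] {φ₀ : V → ℝ}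
    (hφ : IsLPCutoff φ₀) (k : ℕ) (ξ : V) : |lpPiece φ₀ k ξ| ≤ 1 := by
  have h := hφ.2.1
  unfold lpPiece
  rw [abs_le]
  split_ifs
  · constructor <;> linarith [h ξ]
  · constructor <;>
      linarith [h ((2 : ℝ) ^ (-(k : ℤ)) • ξ), h ((2 : ℝ) ^ (-(k : ℤ) + 1) • ξ)]

/-- On the half-line `x ≥ 1` at most two consecutive functions of a dyadic decomposition are
nonzero, and these add up to one. The function of index `0` vanishes there. -/
theorem exists_lpPiece_add_eq_one {χ₀ : ℝ → ℝ} (hχ : IsLPCutoff χ₀) {x : ℝ} (hx : 1 ≤ x) :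
    ∃ p : ℕ, x < 2 ^ (p + 1) ∧ (∀ k, k ∉ ({p + 1, p + 2} : Finset ℕ) → lpPiece χ₀ k x = 0) ∧
      ∑ k ∈ ({p + 1, p + 2} : Finset ℕ), lpPiece χ₀ k x = 1 := by
  obtain ⟨-, -, ε₁, ε₂, hε₁, -, hε₂1, h2ε₁, h1, h0⟩ := hχ
  obtain ⟨p, hp, hp'⟩ := exists_nat_pow_near hx one_lt_two
  have hx0 : 0 < x := by linarith
  -- values of the dilates of `χ₀` at `x`
  have hzero : ∀ a : ℤ, a ≤ p → χ₀ ((2 : ℝ) ^ (-a) • x) = 0 := by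
    intro a ha
    apply h0
    rw [smul_eq_mul, Real.norm_of_nonneg (by positivity), zpow_neg, ← div_eq_inv_mul,
      le_div_iff₀ (by positivity)]
    have : (2 : ℝ) ^ a ≤ 2 ^ (p : ℤ) := zpow_le_zpow_right₀ one_le_two ha
    rw [zpow_natCast] at this
    nlinarith [zpow_pos (two_pos : (0 : ℝ) < 2) a]
  have hone : ∀ a : ℤ, (p : ℤ) + 2 ≤ a → χ₀ ((2 : ℝ) ^ (-a) • x) = 1 := by
    intro a ha
    apply h1
    rw [smul_eq_mul, Real.norm_of_nonneg (by positivity), zpow_neg, ← div_eq_inv_mul,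
      div_le_iff₀ (by positivity)]
    have : (2 : ℝ) ^ ((p : ℤ) + 2) ≤ 2 ^ a := zpow_le_zpow_right₀ one_le_two ha
    have e : (2 : ℝ) ^ ((p : ℤ) + 2) = 2 ^ (p + 1) * 2 := by
      rw [zpow_add₀ two_ne_zero, zpow_natCast, pow_succ]; norm_num [mul_assoc]
    nlinarith [zpow_pos (two_pos : (0 : ℝ) < 2) a]
  have hsucc : ∀ k : ℕ, k ≠ 0 → lpPiece χ₀ k x =
      χ₀ ((2 : ℝ) ^ (-(k : ℤ)) • x) - χ₀ ((2 : ℝ) ^ (-((k : ℤ) - 1)) • x) := by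
    intro k hk
    rw [lpPiece, if_neg hk]
    congr 4
    ring
  refine ⟨p, hp', fun k hk => ?_, ?_⟩
  · simp only [Finset.mem_insert, Finset.mem_singleton, not_or] at hk
    rcases Nat.eq_zero_or_pos k with rfl | hk0
    · simpa [lpPiece] using hzero 0 (by omega)
    · rw [hsucc k hk0.ne']
      rcases le_or_gt k p with h | h
      · rw [hzero _ (by omega), hzero _ (by omega), sub_zero]
      · rw [hone _ (by omega), hone _ (by omega), sub_self]
  · rw [Finset.sum_pair (by omega), hsucc _ (by omega), hsucc _ (by omega)]
    have e : (((p + 2 : ℕ) : ℤ) - 1) = ((p + 1 : ℕ) : ℤ) := by push_cast; ring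
    rw [e, hzero (((p + 1 : ℕ) : ℤ) - 1) (by push_cast; omega),
      hone ((p + 2 : ℕ) : ℤ) (by push_cast; omega)]
    ring

end Cutoffs

/-! ### Fourier transforms in angular frequency and dilations -/

section Hat

variable {d : ℕ} {F : Type*} [NormedAddCommGroup F] [NormedSpace ℂ F]

theorem integral_comp_zpow_smul {G : Type*} [NormedAddCommGroup G] [NormedSpace ℝ G]
    (f : Sp d → G) (a : ℤ) :
    ∫ x, f ((2 : ℝ) ^ a • x) = ((2 : ℝ) ^ a) ^ (-(d : ℤ)) • ∫ x, f x := by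
  rw [Measure.integral_comp_smul, finrank_euclideanSpace_fin, abs_of_pos (by positivity),
    zpow_neg, zpow_natCast]

/-- Passage from angular frequency to the convention of `𝓕`. -/
theorem hat_two_pi_smul (v : Sp d → F) (ξ : Sp d) : hat v ((2 * Real.pi) • ξ) = 𝓕 v ξ := by
  rw [hat, Real.fourier_eq']
  refine integral_congr_ae (.of_forall fun x => ?_)
  simp only [real_inner_smul_right]
  congr 2
  push_cast
  ring

/-- Passage from angular frequency to the convention of `𝓕⁻`; the Jacobian of `ξ ↦ 2π ξ` cancels the
factor `(2π)^{-d}`. -/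
theorem invHat_eq_fourierInv (g : Sp d → F) (x : Sp d) :
    invHat g x = 𝓕⁻ (fun ξ => g ((2 * Real.pi) • ξ)) x := by
  have h := Measure.integral_comp_smul (μ := (volume : Measure (Sp d)))
    (fun ξ : Sp d => Complex.exp (Complex.I * (⟪x, ξ⟫ : ℝ)) • g ξ) (2 * Real.pi)
  rw [finrank_euclideanSpace_fin, abs_of_pos (by positivity)] at h
  rw [invHat, ← h, Real.fourierInv_eq']
  refine integral_congr_ae (.of_forall fun ξ => ?_)
  simp only [real_inner_smul_right, real_inner_comm]
  congr 2
  push_cast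
  ring

/-- The Fourier transform of a dilated function. -/
theorem hat_dilU {N : ℕ} (j : ℕ) (v : Sp d → Val N) (ξ : Sp d) :
    hat (dilU j v) ξ = ((2 : ℝ) ^ ((j : ℝ) * d / 2)) • hat v ((2 : ℝ) ^ (j : ℤ) • ξ) := by
  have h := integral_comp_zpow_smul (fun x : Sp d =>
    Complex.exp (-(Complex.I * (⟪x, (2 : ℝ) ^ (j : ℤ) • ξ⟫ : ℝ))) • v x) (-(j : ℤ))
  have e : (2 : ℝ) ^ ((j : ℝ) * d / 2) = (2 : ℝ) ^ (-((j : ℝ) * d / 2)) * 2 ^ ((j : ℝ) * d) := by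
    rw [← Real.rpow_add two_pos]; congr 1; ring
  have e2 : ((2 : ℝ) ^ (-(j : ℤ))) ^ (-(d : ℤ)) = (2 : ℝ) ^ ((j : ℝ) * d) := by
    rw [← zpow_mul, ← Real.rpow_intCast]; congr 1; push_cast; ring
  rw [e2] at h
  rw [e, mul_smul]
  unfold hat
  rw [← h, ← integral_smul]
  refine integral_congr_ae (.of_forall fun x => ?_)
  simp only [dilU, dil, real_inner_smul_left, real_inner_smul_right]
  rw [← mul_assoc, ← zpow_add₀ two_ne_zero, add_neg_cancel, zpow_zero, one_mul, smul_comm]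

/-- The operator `H_j^{-1} pdo(p) H_j` is `pdo_j` of the symbol `p(2^j x, ξ)`. -/
theorem dilUInv_pdo_dilU {N : ℕ} (j : ℕ) (p : Sp d → Sp d → Mat N) (v : Sp d → Val N) (x : Sp d) :
    dilUInv j (pdo p (dilU j v)) x = pdoJ j (fun x ξ => p ((2 : ℝ) ^ (j : ℤ) • x) ξ) v x := by
  have h := integral_comp_zpow_smul (fun ξ : Sp d => Complex.exp (Complex.I * (⟪x, ξ⟫ : ℝ)) •
    p ((2 : ℝ) ^ (j : ℤ) • x) ((2 : ℝ) ^ (-(j : ℤ)) • ξ) (hat v ξ)) (j : ℤ)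
  have e2 : ((2 : ℝ) ^ (j : ℤ)) ^ (-(d : ℤ)) = (2 : ℝ) ^ (-((j : ℝ) * d)) := by
    rw [← zpow_mul, ← Real.rpow_intCast]; congr 1; push_cast; ring
  have e3 : (2 : ℝ) ^ ((j : ℝ) * d / 2) * 2 ^ ((j : ℝ) * d / 2) * 2 ^ (-((j : ℝ) * d)) = 1 := by
    rw [← Real.rpow_add two_pos, ← Real.rpow_add two_pos]
    convert Real.rpow_zero 2 using 2
    ring
  rw [e2] at h
  have h' : (2 : ℝ) ^ ((j : ℝ) * d / 2) • ∫ ξ : Sp d,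
        Complex.exp (Complex.I * (⟪(2 : ℝ) ^ (j : ℤ) • x, ξ⟫ : ℝ)) •
          p ((2 : ℝ) ^ (j : ℤ) • x) ξ (hat (dilU j v) ξ) =
      ((2 : ℝ) ^ ((j : ℝ) * d / 2) * 2 ^ ((j : ℝ) * d / 2) * 2 ^ (-((j : ℝ) * d))) •
        ∫ ξ : Sp d, Complex.exp (Complex.I * (⟪x, ξ⟫ : ℝ)) •
          p ((2 : ℝ) ^ (j : ℤ) • x) ((2 : ℝ) ^ (-(j : ℤ)) • ξ) (hat v ξ) := by
    rw [mul_smul, ← h, mul_smul, ← integral_smul ((2 : ℝ) ^ ((j : ℝ) * d / 2))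
      (fun ξ : Sp d => Complex.exp (Complex.I * (⟪x, (2 : ℝ) ^ (j : ℤ) • ξ⟫ : ℝ)) •
        p ((2 : ℝ) ^ (j : ℤ) • x) ((2 : ℝ) ^ (-(j : ℤ)) • (2 : ℝ) ^ (j : ℤ) • ξ)
          (hat v ((2 : ℝ) ^ (j : ℤ) • ξ)))]
    congr 1
    refine integral_congr_ae (.of_forall fun ξ => ?_)
    simp only [hat_dilU, real_inner_smul_left, real_inner_smul_right, smul_smul]
    rw [← zpow_add₀ two_ne_zero, neg_add_cancel, zpow_zero, one_smul,
      ContinuousLinearMap.map_smul_of_tower, smul_comm]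
  rw [e3, one_smul] at h'
  rw [dilUInv, pdo, pdoJ, invHat, invHat, smul_comm, h']

end Hat

/-! ### The para-differential symbol -/

section ParaSymbol

variable {d N : ℕ}

/-- As a function of the ordinary frequency `ξ / 2π`, a Littlewood-Paley cut-off is a Schwartz
function equal to one near the origin. -/
theorem exists_schwartz_eq_cutoff {φ₀ : Sp d → ℝ} (hφ : IsLPCutoff φ₀) :
    ∃ φ : 𝓢(Sp d, ℂ), (∀ ξ, φ ξ = φ₀ ((2 * Real.pi) • ξ)) ∧
      ∃ ε : ℝ, 0 < ε ∧ ∀ ξ, ‖ξ‖ ≤ ε → φ ξ = 1 := by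
  obtain ⟨hsm, -, ε₁, ε₂, hε₁, -, -, -, h1, h0⟩ := hφ
  have hpi : 0 < 2 * Real.pi := by positivity
  have hcs : HasCompactSupport fun ξ : Sp d => ((φ₀ ((2 * Real.pi) • ξ) : ℝ) : ℂ) := by
    refine HasCompactSupport.intro (isCompact_closedBall (0 : Sp d) (ε₂ / (2 * Real.pi)))
      fun ξ hξ => ?_
    rw [h0, Complex.ofReal_zero]
    rw [mem_closedBall_zero_iff, not_le, div_lt_iff₀ hpi] at hξ
    rw [norm_smul, Real.norm_of_nonneg hpi.le]
    linarith
  refine ⟨hcs.toSchwartzMap (Complex.ofRealCLM.contDiff.comp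
    (hsm.comp (contDiff_const_smul (2 * Real.pi)))), fun ξ => rfl, ε₁ / (2 * Real.pi),
    by positivity, fun ξ hξ => ?_⟩
  change ((φ₀ ((2 * Real.pi) • ξ) : ℝ) : ℂ) = 1
  rw [h1, Complex.ofReal_one]
  rw [norm_smul, Real.norm_of_nonneg hpi.le, mul_comm]
  exact (le_div_iff₀ hpi).1 hξ

theorem fourierInv_comp_zpow_smul (φ : 𝓢(Sp d, ℂ)) (a : ℤ) (y : Sp d) :
    𝓕⁻ (fun ξ => φ ((2 : ℝ) ^ (-a) • ξ)) y =
      (((2 : ℝ) ^ a) ^ d : ℝ) • (𝓕⁻ φ : 𝓢(Sp d, ℂ)) ((2 : ℝ) ^ a • y) := by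
  have h := integral_comp_zpow_smul (fun ξ : Sp d =>
    Complex.exp (↑(2 * Real.pi * ⟪ξ, (2 : ℝ) ^ a • y⟫) * Complex.I) • φ ξ) (-a)
  have e : ((2 : ℝ) ^ (-a)) ^ (-(d : ℤ)) = ((2 : ℝ) ^ a) ^ d := by
    rw [zpow_neg, zpow_neg, inv_zpow, inv_inv, zpow_natCast]
  rw [SchwartzMap.fourierInv_coe, Real.fourierInv_eq', Real.fourierInv_eq', ← e, ← h]
  refine integral_congr_ae (.of_forall fun ξ => ?_)
  simp only [real_inner_smul_left, real_inner_smul_right]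
  rw [← mul_assoc ((2 : ℝ) ^ a), ← zpow_add₀ two_ne_zero, add_neg_cancel, zpow_zero, one_mul]

/-- The kernel of the para-differential smoothing at frequency `ξ`, where `S` contains the indices
of the dyadic shells that meet `⟨ξ⟩`. -/
theorem invHat_admCutoff {φ₀ : Sp d → ℝ} {φ : 𝓢(Sp d, ℂ)}
    (hφ : ∀ ξ, φ ξ = φ₀ ((2 * Real.pi) • ξ)) {χ₀ : ℝ → ℝ} {N₀ : ℕ} {ξ : Sp d} {S : Finset ℕ}
    (hS : ∀ k ∉ S, lpPiece χ₀ k (jap ξ) = 0) (y : Sp d) :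
    invHat (fun η => (admCutoff φ₀ χ₀ N₀ η ξ : ℂ)) y =
      ∑ k ∈ S, (lpPiece χ₀ k (jap ξ) * ((2 : ℝ) ^ ((k : ℤ) - N₀)) ^ d : ℝ) •
        (𝓕⁻ φ : 𝓢(Sp d, ℂ)) ((2 : ℝ) ^ ((k : ℤ) - N₀) • y) := by
  have hadm : ∀ η : Sp d, (admCutoff φ₀ χ₀ N₀ ((2 * Real.pi) • η) ξ : ℂ) =
      ∑ k ∈ S, (lpPiece χ₀ k (jap ξ) : ℝ) • φ ((2 : ℝ) ^ (-((k : ℤ) - N₀)) • η) := by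
    intro η
    rw [admCutoff, tsum_eq_sum (s := S) fun k hk => by rw [hS k hk, mul_zero], Complex.ofReal_sum]
    refine Finset.sum_congr rfl fun k _ => ?_
    rw [hφ, Complex.ofReal_mul, Complex.real_smul, mul_comm, neg_sub', smul_comm (2 * Real.pi),
      sub_neg_eq_add]
  have hint : ∀ k : ℕ, Integrable fun η : Sp d => φ ((2 : ℝ) ^ (-((k : ℤ) - N₀)) • η) :=
    fun k => (integrable_comp_smul_iff volume φ (by positivity)).2 φ.integrable
  simp only [invHat_eq_fourierInv, hadm]
  simp only [mul_smul, ← fourierInv_comp_zpow_smul]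
  simp only [Real.fourierInv_eq', Finset.smul_sum]
  rw [integral_finsetSum]
  · refine Finset.sum_congr rfl fun k _ => ?_
    rw [← integral_smul]
    refine integral_congr_ae (.of_forall fun ξ => ?_)
    simp only [smul_eq_mul, Complex.real_smul]
    ring
  · intro k _
    have h1 := (hint k).smul (lpPiece χ₀ k (jap ξ))
    refine h1.mono ?_ (.of_forall fun η => ?_)
    · exact (Continuous.aestronglyMeasurable (f := fun η : Sp d =>
        Complex.exp (↑(2 * Real.pi * ⟪η, y⟫) * Complex.I)) (by fun_prop)).smul
        h1.aestronglyMeasurable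
    · rw [norm_smul, Complex.norm_exp_ofReal_mul_I, one_mul]
      rfl

/-- The para-differential symbol of a rescaled symbol is, at each frequency, a finite combination
of dyadic averages of the original symbol. -/
theorem paraSymbol_dil {φ₀ : Sp d → ℝ} {φ : 𝓢(Sp d, ℂ)}
    (hφ : ∀ ξ, φ ξ = φ₀ ((2 * Real.pi) • ξ)) {χ₀ : ℝ → ℝ} {N₀ : ℕ} {ξ : Sp d} {S : Finset ℕ}
    (hS : ∀ k ∉ S, lpPiece χ₀ k (jap ξ) = 0) {a : Sp d → Sp d → Mat N}
    (ha : Continuous fun x => a x ξ) {b : ℝ} (hb : ∀ x, ‖a x ξ‖ ≤ b) (j : ℕ) (x : Sp d) :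
    paraSymbol φ₀ χ₀ N₀ (dil j a) ((2 : ℝ) ^ (j : ℤ) • x) ξ =
      ∑ k ∈ S, lpPiece χ₀ k (jap ξ) •
        dilAvg (𝓕⁻ φ : 𝓢(Sp d, ℂ)) ((2 : ℝ) ^ (-((j : ℤ) + k - N₀))) (fun x => a x ξ) x := by
  have hinv := invHat_admCutoff (N₀ := N₀) hφ hS
  generalize (𝓕⁻ φ : 𝓢(Sp d, ℂ)) = ψ at hinv ⊢
  have hdil : ∀ y, dil j a ((2 : ℝ) ^ (j : ℤ) • x - y) ξ =
      a (x - (2 : ℝ) ^ (-(j : ℤ)) • y) ξ := by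
    intro y
    rw [dil, smul_sub, smul_smul, ← zpow_add₀ two_ne_zero, neg_add_cancel, zpow_zero, one_smul]
  have hscale : ∀ (k : ℕ) (y : Sp d), (2 : ℝ) ^ (-((j : ℤ) + k - N₀)) •
      (2 : ℝ) ^ ((k : ℤ) - N₀) • y = (2 : ℝ) ^ (-(j : ℤ)) • y := by
    intro k y
    rw [smul_smul, ← zpow_add₀ two_ne_zero]
    congr 2
    ring
  have hint : ∀ k : ℕ, Integrable fun y : Sp d => ψ ((2 : ℝ) ^ ((k : ℤ) - N₀) • y) •
      a (x - (2 : ℝ) ^ (-(j : ℤ)) • y) ξ := by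
    intro k
    have := (integrable_comp_smul_iff volume (fun z : Sp d => ψ z •
      a (x - (2 : ℝ) ^ (-((j : ℤ) + k - N₀)) • z) ξ)
      (by positivity : (2 : ℝ) ^ ((k : ℤ) - N₀) ≠ 0)).2
      (integrable_smul_comp_of_bounded ψ.integrable ha hb _ _)
    simpa only [hscale] using this
  have havg : ∀ k : ℕ, dilAvg ψ ((2 : ℝ) ^ (-((j : ℤ) + k - N₀))) (fun x => a x ξ) x =
      (((2 : ℝ) ^ ((k : ℤ) - N₀)) ^ d : ℝ) • ∫ y : Sp d,
        ψ ((2 : ℝ) ^ ((k : ℤ) - N₀) • y) • a (x - (2 : ℝ) ^ (-(j : ℤ)) • y) ξ := by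
    intro k
    have h := integral_comp_zpow_smul (fun z : Sp d => ψ z •
      a (x - (2 : ℝ) ^ (-((j : ℤ) + k - N₀)) • z) ξ) ((k : ℤ) - N₀)
    simp only [hscale] at h
    rw [h, smul_smul, zpow_neg _ (d : ℤ), zpow_natCast _ d, mul_inv_cancel₀ (by positivity),
      one_smul, dilAvg]
  simp only [paraSymbol, hdil, hinv, Finset.sum_smul]
  rw [integral_finsetSum]
  · refine Finset.sum_congr rfl fun k _ => ?_
    rw [havg, smul_smul, ← integral_smul]
    refine integral_congr_ae (.of_forall fun y => ?_)
    simp only [smul_assoc]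
  · intro k _
    simp only [smul_assoc]
    exact (hint k).smul (lpPiece χ₀ k (jap ξ) * ((2 : ℝ) ^ ((k : ℤ) - N₀)) ^ d)

theorem paraSymbol_congr_ae (φ₀ : Sp d → ℝ) (χ₀ : ℝ → ℝ) (N₀ : ℕ) {a a' : Sp d → Sp d → Mat N}
    (h : ∀ᵐ x, a x = a' x) (x ξ : Sp d) :
    paraSymbol φ₀ χ₀ N₀ a x ξ = paraSymbol φ₀ χ₀ N₀ a' x ξ := by
  refine integral_congr_ae ?_
  have := (quasiMeasurePreserving_sub_left (volume : Measure (Sp d)) x).ae h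
  filter_upwards [this] with y hy
  rw [hy]

theorem ae_dil {j : ℕ} {X : Type*} {f g : Sp d → X} (h : ∀ᵐ x, f x = g x) :
    ∀ᵐ x, dil j f x = dil j g x := by
  have hq : Measure.QuasiMeasurePreserving (fun x : Sp d => (2 : ℝ) ^ (-(j : ℤ)) • x)
      volume volume := by
    refine ⟨by fun_prop, ?_⟩
    rw [Measure.map_addHaar_smul _ (by positivity)]
    exact Measure.smul_absolutelyContinuous
  exact hq.ae h

end ParaSymbol

/-! ### The symbol of the remainder -/

section HighSymbol

variable {d N : ℕ}

/-- The part of the symbol `a` removed by the para-differential smoothing at level `j`: at frequency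
`ξ` in the dyadic shell of index `k`, it is the part of `a(·, ξ)` at frequencies above
`2^{j+k-N₀}`, where `κ` is the kernel of the low frequency truncation. At each `ξ` at most two terms
of the sum are nonzero. -/
noncomputable def highSymbol (κ : Sp d → ℂ) (χ₀ : ℝ → ℝ) (N₀ j : ℕ) (a : Sp d → Sp d → Mat N)
    (x ξ : Sp d) : Mat N :=
  ∑' k : ℕ, lpPiece χ₀ k (jap ξ) •
    highPart κ ((2 : ℝ) ^ (-((j : ℤ) + k - N₀))) (fun x => a x ξ) x

theorem highSymbol_eq_sum {κ : Sp d → ℂ} {χ₀ : ℝ → ℝ} {ξ : Sp d} {S : Finset ℕ}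
    (hS : ∀ k ∉ S, lpPiece χ₀ k (jap ξ) = 0) (N₀ j : ℕ) (a : Sp d → Sp d → Mat N) (x : Sp d) :
    highSymbol κ χ₀ N₀ j a x ξ = ∑ k ∈ S, lpPiece χ₀ k (jap ξ) •
      highPart κ ((2 : ℝ) ^ (-((j : ℤ) + k - N₀))) (fun x => a x ξ) x :=
  tsum_eq_sum fun k hk => by rw [hS k hk, zero_smul]

/-- The `χ_k(⟨ξ⟩)` add up to one, so the smoothed symbol is `a` minus its high frequency part. -/
theorem paraSymbol_dil_eq_sub {φ₀ : Sp d → ℝ} {φ : 𝓢(Sp d, ℂ)}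
    (hφ : ∀ ξ, φ ξ = φ₀ ((2 * Real.pi) • ξ)) {χ₀ : ℝ → ℝ} (hχ : IsLPCutoff χ₀) {N₀ : ℕ} {ξ : Sp d}
    {a : Sp d → Sp d → Mat N} (ha : Continuous fun x => a x ξ) {b : ℝ} (hb : ∀ x, ‖a x ξ‖ ≤ b)
    (j : ℕ) (x : Sp d) :
    paraSymbol φ₀ χ₀ N₀ (dil j a) ((2 : ℝ) ^ (j : ℤ) • x) ξ =
      a x ξ - highSymbol (𝓕⁻ φ : 𝓢(Sp d, ℂ)) χ₀ N₀ j a x ξ := by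
  obtain ⟨p, -, hS, hsum⟩ := exists_lpPiece_add_eq_one hχ (one_le_jap ξ)
  rw [paraSymbol_dil hφ hS ha hb, highSymbol_eq_sum hS]
  simp only [highPart, smul_sub, Finset.sum_sub_distrib, ← Finset.sum_smul, hsum, one_smul]
  abel

theorem norm_highSymbol_le {κ : Sp d → ℂ} (hκ : Integrable κ) {χ₀ : ℝ → ℝ} (hχ : IsLPCutoff χ₀)
    (N₀ j : ℕ) {a : Sp d → Sp d → Mat N} {ξ : Sp d} {b : ℝ} (hb : ∀ x, ‖a x ξ‖ ≤ b) (x : Sp d) :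
    ‖highSymbol κ χ₀ N₀ j a x ξ‖ ≤ 2 * ((1 + ∫ z, ‖κ z‖) * b) := by
  obtain ⟨p, -, hS, -⟩ := exists_lpPiece_add_eq_one hχ (one_le_jap ξ)
  have h1 : ∀ k : ℕ, ‖lpPiece χ₀ k (jap ξ) •
      highPart κ ((2 : ℝ) ^ (-((j : ℤ) + k - N₀))) (fun x => a x ξ) x‖ ≤
        (1 + ∫ z, ‖κ z‖) * b := by
    intro k
    rw [norm_smul, Real.norm_eq_abs]
    refine (mul_le_of_le_one_left (norm_nonneg _) (abs_lpPiece_le hχ k _)).trans ?_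
    rw [highPart, add_mul, one_mul]
    exact (norm_sub_le _ _).trans (add_le_add (hb x) (norm_dilAvg_le hκ hb _ x))
  rw [highSymbol_eq_sum hS, two_mul, Finset.sum_pair (by omega)]
  exact (norm_add_le _ _).trans (add_le_add (h1 _) (h1 _))

theorem stronglyMeasurable_highSymbol {κ : Sp d → ℂ} (hκ : Continuous κ) {χ₀ : ℝ → ℝ}
    (hχ : IsLPCutoff χ₀) (N₀ j : ℕ) {a : Sp d → Sp d → Mat N}
    (ha : Continuous (Function.uncurry a)) :
    StronglyMeasurable fun p : Sp d × Sp d => highSymbol κ χ₀ N₀ j a p.1 p.2 := by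
  have hterm : ∀ k : ℕ, StronglyMeasurable fun p : Sp d × Sp d => lpPiece χ₀ k (jap p.2) •
      highPart κ ((2 : ℝ) ^ (-((j : ℤ) + k - N₀))) (fun x => a x p.2) p.1 := by
    intro k
    have h1 : Continuous fun p : Sp d × Sp d => lpPiece χ₀ k (jap p.2) :=
      (continuous_lpPiece hχ.1.continuous k).comp (continuous_jap.comp continuous_snd)
    have h2 : StronglyMeasurable fun p : Sp d × Sp d =>
        dilAvg κ ((2 : ℝ) ^ (-((j : ℤ) + k - N₀))) (fun x => a x p.2) p.1 := by
      refine StronglyMeasurable.integral_prod_right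
        (f := fun (p : Sp d × Sp d) (z : Sp d) =>
          κ z • a (p.1 - (2 : ℝ) ^ (-((j : ℤ) + k - N₀)) • z) p.2) ?_
      refine Continuous.stronglyMeasurable ((hκ.comp continuous_snd).smul ?_)
      exact ha.comp (f := fun q : (Sp d × Sp d) × Sp d =>
        (q.1.1 - (2 : ℝ) ^ (-((j : ℤ) + k - N₀)) • q.2, q.1.2)) (by fun_prop)
    exact h1.stronglyMeasurable.smul (ha.stronglyMeasurable.sub h2)
  refine stronglyMeasurable_of_tendsto Filter.atTop (f := fun (n : ℕ) (p : Sp d × Sp d) =>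
    ∑ k ∈ Finset.range n, lpPiece χ₀ k (jap p.2) •
      highPart κ ((2 : ℝ) ^ (-((j : ℤ) + k - N₀))) (fun x => a x p.2) p.1)
    (fun n => Finset.stronglyMeasurable_fun_sum _ fun k _ => hterm k) ?_
  rw [tendsto_pi_nhds]
  intro p
  obtain ⟨_, -, hS, -⟩ := exists_lpPiece_add_eq_one hχ (one_le_jap p.2)
  exact (summable_of_ne_finset_zero fun k hk => by
    rw [hS k hk, zero_smul]).hasSum.tendsto_sum_nat

/-- At frequency `ξ` only shells with `2^k > ⟨ξ⟩` contribute, hence the gain `(2^j ⟨ξ⟩)^{-s}`. -/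
theorem eLpNorm_highSymbol_le {κ : Sp d → ℂ} (hκ : Integrable κ) {χ₀ : ℝ → ℝ}
    (hχ : IsLPCutoff χ₀) (N₀ j : ℕ) {a : Sp d → Sp d → Mat N} {ξ : Sp d}
    (ha : Continuous fun x => a x ξ) {b : ℝ} (hb : ∀ x, ‖a x ξ‖ ≤ b) {s c : ℝ} (hs : 0 ≤ s)
    (hc : 0 ≤ c) {W : ℝ≥0∞} (h : ∀ Q : ℤ,
      eLpNorm (highPart κ ((2 : ℝ) ^ (-Q)) fun x => a x ξ) 2 volume ≤
        ENNReal.ofReal (c * ((2 : ℝ) ^ (-Q)) ^ s) * W) :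
    eLpNorm (fun x => highSymbol κ χ₀ N₀ j a x ξ) 2 volume ≤
      ENNReal.ofReal (2 * c * ((2 : ℝ) ^ N₀) ^ s * ((2 : ℝ) ^ (-(j : ℝ) * s) * jap ξ ^ (-s))) *
        W := by
  obtain ⟨p, hp, hS, -⟩ := exists_lpPiece_add_eq_one hχ (one_le_jap ξ)
  have hx := jap_pos ξ
  set B : ℝ := c * ((2 : ℝ) ^ N₀) ^ s * ((2 : ℝ) ^ (-(j : ℝ) * s) * jap ξ ^ (-s)) with hB
  have hB0 : 0 ≤ B := by positivity
  have hk : ∀ k : ℕ, p + 1 ≤ k → eLpNorm (fun x => lpPiece χ₀ k (jap ξ) •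
      highPart κ ((2 : ℝ) ^ (-((j : ℤ) + k - N₀))) (fun x => a x ξ) x) 2 volume ≤
        ENNReal.ofReal B * W := by
    intro k hk
    refine (eLpNorm_mono (g := highPart κ ((2 : ℝ) ^ (-((j : ℤ) + k - N₀))) fun x => a x ξ)
      fun x => ?_).trans ((h _).trans (mul_le_mul' (ENNReal.ofReal_le_ofReal ?_) le_rfl))
    · rw [norm_smul, Real.norm_eq_abs]
      exact mul_le_of_le_one_left (norm_nonneg _) (abs_lpPiece_le hχ k _)
    · have hk2 : jap ξ ≤ 2 ^ k := hp.le.trans (pow_le_pow_right₀ one_le_two hk)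
      have e : (2 : ℝ) ^ (-((j : ℤ) + k - N₀)) = 2 ^ N₀ * ((2 : ℝ) ^ (-(j : ℝ)) * (2 ^ k)⁻¹) := by
        rw [Real.rpow_neg zero_le_two, Real.rpow_natCast, ← mul_inv, ← pow_add, neg_sub,
          zpow_sub₀ two_ne_zero, zpow_natCast, ← Nat.cast_add, zpow_natCast, div_eq_mul_inv]
      rw [e, Real.mul_rpow (by positivity) (by positivity), Real.mul_rpow (by positivity)
        (by positivity), ← Real.rpow_mul zero_le_two, hB, mul_assoc c, Real.rpow_neg hx.le,
        ← Real.inv_rpow hx.le]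
      gcongr
  have hcont : ∀ k : ℕ, AEStronglyMeasurable (fun x => lpPiece χ₀ k (jap ξ) •
      highPart κ ((2 : ℝ) ^ (-((j : ℤ) + k - N₀))) (fun x => a x ξ) x) volume := fun k =>
    ((continuous_highPart hκ ha hb ((2 : ℝ) ^ (-((j : ℤ) + k - N₀)))).const_smul
      (lpPiece χ₀ k (jap ξ))).aestronglyMeasurable
  simp only [highSymbol_eq_sum hS, Finset.sum_pair (show p + 1 ≠ p + 2 by omega)]
  refine (eLpNorm_add_le (hcont _) (hcont _) (by norm_num)).trans
    ((add_le_add (hk _ le_rfl) (hk _ (by omega))).trans (le_of_eq ?_))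
  rw [← add_mul, ← ENNReal.ofReal_add hB0 hB0]
  congr 2
  rw [hB]
  ring

end HighSymbol

/-! ### Hilbert-Schmidt operators -/

section HilbertSchmidt

variable {d N : ℕ} {κ : Sp d → Sp d → Mat N}

theorem lintegral_enorm_apply_sq_le (hκ : StronglyMeasurable (Function.uncurry κ))
    {g : Sp d → Val N} (hg : StronglyMeasurable g) (x : Sp d) :
    (∫⁻ ξ, ‖κ x ξ (g ξ)‖ₑ) ^ 2 ≤ (∫⁻ ξ, ‖κ x ξ‖ₑ ^ 2) * eLpNorm g 2 volume ^ 2 := by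
  have hκx : StronglyMeasurable (κ x) := hκ.comp_measurable measurable_prodMk_left
  rw [eLpNorm_two_sq]
  refine le_trans ?_ (lintegral_mul_sq_le hκx.enorm.aemeasurable hg.enorm.aemeasurable)
  gcongr with ξ
  exact (κ x ξ).le_opENorm _

theorem stronglyMeasurable_kernel_apply (hκ : StronglyMeasurable (Function.uncurry κ))
    {g : Sp d → Val N} (hg : StronglyMeasurable g) :
    StronglyMeasurable fun p : Sp d × Sp d => κ p.1 p.2 (g p.2) :=
  isBoundedBilinearMap_apply.continuous.comp_stronglyMeasurable
    (hκ.prodMk (hg.comp_measurable measurable_snd))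

/-- A square integrable kernel defines a bounded operator on `L²`. -/
theorem exists_hilbertSchmidt (hκ : StronglyMeasurable (Function.uncurry κ)) {H : ℝ≥0∞}
    (hH : H ≠ ⊤) (h : ∫⁻ ξ, ∫⁻ x, ‖κ x ξ‖ₑ ^ 2 ≤ H ^ 2) :
    ∃ T : Lp (Val N) 2 (volume : Measure (Sp d)) →ₗ[ℂ] Lp (Val N) 2 (volume : Measure (Sp d)),
      (∀ g, T g =ᵐ[volume] fun x => ∫ ξ, κ x ξ (g ξ)) ∧ ∀ g, ‖T g‖ₑ ≤ H * ‖g‖ₑ := by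
  have hmeas : Measurable fun p : Sp d × Sp d => ‖κ p.1 p.2‖ₑ ^ 2 := hκ.enorm.pow_const 2
  have h' : ∫⁻ x, ∫⁻ ξ, ‖κ x ξ‖ₑ ^ 2 ≤ H ^ 2 := by
    rwa [lintegral_lintegral_swap hmeas.aemeasurable]
  have hfin : ∀ᵐ x, ∫⁻ ξ, ‖κ x ξ‖ₑ ^ 2 < ⊤ :=
    ae_lt_top hmeas.lintegral_prod_right' (h'.trans_lt (by finiteness)).ne
  have hgm : ∀ g : Lp (Val N) 2 (volume : Measure (Sp d)), StronglyMeasurable g :=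
    fun g => Lp.stronglyMeasurable g
  have hint : ∀ g : Lp (Val N) 2 (volume : Measure (Sp d)),
      ∀ᵐ x, Integrable fun ξ => κ x ξ (g ξ) := by
    intro g
    filter_upwards [hfin] with x hx
    refine ⟨((stronglyMeasurable_kernel_apply hκ (hgm g)).comp_measurable
      measurable_prodMk_left).aestronglyMeasurable, ?_⟩
    have h1 := lintegral_enorm_apply_sq_le hκ (hgm g) x
    have h2 : (∫⁻ ξ, ‖κ x ξ‖ₑ ^ 2) * eLpNorm g 2 volume ^ 2 < ⊤ :=
      ENNReal.mul_lt_top hx (ENNReal.pow_lt_top (Lp.memLp g).2)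
    by_contra hcon
    rw [HasFiniteIntegral, not_lt, top_le_iff] at hcon
    rw [hcon] at h1
    simp [h2.ne] at h1
  have hbound : ∀ g : Lp (Val N) 2 (volume : Measure (Sp d)),
      eLpNorm (fun x => ∫ ξ, κ x ξ (g ξ)) 2 volume ≤ H * ‖g‖ₑ := by
    intro g
    refine eLpNorm_two_le_of_sq_le ?_
    calc ∫⁻ x, ‖∫ ξ, κ x ξ (g ξ)‖ₑ ^ 2
        ≤ ∫⁻ x, (∫⁻ ξ, ‖κ x ξ‖ₑ ^ 2) * eLpNorm g 2 volume ^ 2 := by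
          refine lintegral_mono fun x => le_trans ?_ (lintegral_enorm_apply_sq_le hκ (hgm g) x)
          gcongr
          exact enorm_integral_le_lintegral_enorm _
      _ = (∫⁻ x, ∫⁻ ξ, ‖κ x ξ‖ₑ ^ 2) * eLpNorm g 2 volume ^ 2 :=
          lintegral_mul_const _ hmeas.lintegral_prod_right'
      _ ≤ H ^ 2 * eLpNorm g 2 volume ^ 2 := by gcongr
      _ = (H * ‖g‖ₑ) ^ 2 := by rw [mul_pow, Lp.enorm_def]
  have hmem : ∀ g : Lp (Val N) 2 (volume : Measure (Sp d)),
      MemLp (fun x => ∫ ξ, κ x ξ (g ξ)) 2 volume := fun g =>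
    ⟨((stronglyMeasurable_kernel_apply hκ (hgm g)).integral_prod_right').aestronglyMeasurable,
      (hbound g).trans_lt (ENNReal.mul_lt_top hH.lt_top enorm_lt_top)⟩
  refine ⟨{ toFun := fun g => (hmem g).toLp
            map_add' := fun g g' => ?_
            map_smul' := fun c g => ?_ }, fun g => (hmem g).coeFn_toLp, fun g => ?_⟩
  · rw [← MemLp.toLp_add, MemLp.toLp_eq_toLp_iff]
    filter_upwards [hint g, hint g'] with x hx hx'
    rw [Pi.add_apply, ← integral_add hx hx']
    refine integral_congr_ae ?_
    filter_upwards [Lp.coeFn_add g g'] with ξ hξ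
    rw [hξ, Pi.add_apply, map_add]
  · rw [RingHom.id_apply, ← MemLp.toLp_const_smul, MemLp.toLp_eq_toLp_iff]
    refine .of_forall fun x => ?_
    rw [Pi.smul_apply, ← integral_smul]
    refine integral_congr_ae ?_
    filter_upwards [Lp.coeFn_smul c g] with ξ hξ
    rw [hξ, Pi.smul_apply, map_smul]
  · refine le_trans (le_of_eq ?_) (hbound g)
    rw [LinearMap.coe_mk, AddHom.coe_mk, Lp.enorm_def]
    exact eLpNorm_congr_ae (hmem g).coeFn_toLp

end HilbertSchmidt

/-! ### Semiclassical weights -/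

section Weight

variable {d N : ℕ}

/-- The semiclassical frequency `2^{-j} ξ` as a function of the ordinary frequency `ξ / 2π`. -/
noncomputable def freq (j : ℕ) (ξ : Sp d) : Sp d := (2 : ℝ) ^ (-(j : ℤ)) • ((2 * Real.pi) • ξ)

theorem continuous_freq (j : ℕ) : Continuous (freq j : Sp d → Sp d) := by
  unfold freq
  fun_prop

theorem hasTemperateGrowth_jap_freq (j : ℕ) (r : ℝ) :
    (fun ξ : Sp d => ((jap (freq j ξ) ^ r : ℝ) : ℂ)).HasTemperateGrowth := by
  have h := (Function.hasTemperateGrowth_one_add_norm_sq_rpow (Sp d) (r / 2)).comp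
    ((((2 : ℝ) ^ (-(j : ℤ))) • ((2 * Real.pi) • ContinuousLinearMap.id ℝ (Sp d))
      : Sp d →L[ℝ] Sp d).hasTemperateGrowth)
  have h2 := Complex.ofRealCLM.hasTemperateGrowth.comp h
  refine Eq.subst (motive := Function.HasTemperateGrowth) ?_ h2
  funext ξ
  rw [jap_rpow]
  rfl

theorem integrable_jap_freq_mul_schwartz (j : ℕ) (r : ℝ) (f : 𝓢(Sp d, Val N)) :
    Integrable fun ξ => jap (freq j ξ) ^ r * ‖f ξ‖ := by
  have h := (SchwartzMap.smulLeftCLM (Val N)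
    (fun ξ : Sp d => ((jap (freq j ξ) ^ r : ℝ) : ℂ)) f).integrable (μ := volume)
  refine h.norm.congr (.of_forall fun ξ => ?_)
  simp only
  rw [SchwartzMap.smulLeftCLM_apply_apply (hasTemperateGrowth_jap_freq j r), norm_smul,
    Complex.norm_real, Real.norm_of_nonneg (Real.rpow_nonneg (jap_pos _).le _)]

/-- Integrals over semiclassical frequencies: the change of variables costs the factor
`2^{jd}`. -/
theorem lintegral_jap_freq {s : ℝ} (hs : (d : ℝ) / 2 < s) (j : ℕ) :
    ∫⁻ ξ : Sp d, ENNReal.ofReal (jap (freq j ξ) ^ (-s)) ^ 2 =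
      ENNReal.ofReal ((2 : ℝ) ^ ((j : ℝ) * d) * ∫ ξ : Sp d, jap (freq 0 ξ) ^ (-(2 * s))) := by
  have hsq : ∀ (i : ℕ) (ξ : Sp d), ENNReal.ofReal (jap (freq i ξ) ^ (-s)) ^ 2 =
      ENNReal.ofReal (jap (freq i ξ) ^ (-(2 * s))) := by
    intro i ξ
    rw [← ENNReal.ofReal_pow (Real.rpow_nonneg (jap_pos _).le _), ← Real.rpow_natCast,
      ← Real.rpow_mul (jap_pos _).le]
    congr 2
    push_cast
    ring
  have hint0 : Integrable fun ξ : Sp d => jap ξ ^ (-(2 * s)) := by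
    have h := integrable_rpow_neg_one_add_norm_sq (E := Sp d) (μ := volume) (r := 2 * s)
      (by rw [finrank_euclideanSpace_fin]; linarith)
    refine h.congr (.of_forall fun ξ => ?_)
    simp only [jap_rpow]
  have hint : ∀ i : ℕ, Integrable fun ξ : Sp d => jap (freq i ξ) ^ (-(2 * s)) := by
    intro i
    have := (integrable_comp_smul_iff volume (fun ξ : Sp d => jap ξ ^ (-(2 * s)))
      (by positivity : (2 : ℝ) ^ (-(i : ℤ)) * (2 * Real.pi) ≠ 0)).2 hint0
    simpa only [freq, smul_smul] using this
  have h := integral_comp_zpow_smul (fun ξ : Sp d => jap (freq 0 ξ) ^ (-(2 * s))) (-(j : ℤ))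
  have e2 : ((2 : ℝ) ^ (-(j : ℤ))) ^ (-(d : ℤ)) = (2 : ℝ) ^ ((j : ℝ) * d) := by
    rw [← zpow_mul, ← Real.rpow_intCast]; congr 1; push_cast; ring
  have e3 : ∀ ξ : Sp d, freq 0 ((2 : ℝ) ^ (-(j : ℤ)) • ξ) = freq j ξ := by
    intro ξ
    simp only [freq, smul_smul]
    congr 1
    simp
    ring
  simp only [e2, e3, smul_eq_mul] at h
  rw [← h, ofReal_integral_eq_lintegral_ofReal (hint j)
    (.of_forall fun ξ => Real.rpow_nonneg (jap_pos _).le _)]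
  exact lintegral_congr fun ξ => hsq j ξ

end Weight

/-! ### The remainder as a Hilbert-Schmidt operator -/

section Remainder

variable {d N : ℕ}

theorem pdoJ_eq_fourierInv (j : ℕ) (a : Sp d → Sp d → Mat N) (v : Sp d → Val N) (x : Sp d) :
    pdoJ j a v x = 𝓕⁻ (fun ξ => a x (freq j ξ) (𝓕 v ξ)) x := by
  simp only [pdoJ, invHat_eq_fourierInv, hat_two_pi_smul]
  rfl

theorem integrable_apply_fourier (j : ℕ) {p : Sp d → Mat N} (hp : StronglyMeasurable p)
    {A m : ℝ} (hA : ∀ ξ, ‖p ξ‖ ≤ A * jap ξ ^ m) (v : 𝓢(Sp d, Val N)) :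
    Integrable fun ξ => p (freq j ξ) (𝓕 (v : Sp d → Val N) ξ) := by
  rw [← SchwartzMap.fourier_coe]
  refine ((integrable_jap_freq_mul_schwartz j m (𝓕 v)).const_mul A).mono' ?_
    (.of_forall fun ξ => ?_)
  · exact (isBoundedBilinearMap_apply.continuous.comp_stronglyMeasurable
      ((hp.comp_measurable (continuous_freq j).measurable).prodMk
        (𝓕 v : 𝓢(Sp d, Val N)).continuous.stronglyMeasurable)).aestronglyMeasurable
  · refine ((p (freq j ξ)).le_opNorm _).trans ?_
    rw [← mul_assoc]
    gcongr
    exact hA _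

theorem stronglyMeasurable_highSymbol_comp {κ : Sp d → ℂ} (hκ : Continuous κ) {χ₀ : ℝ → ℝ}
    (hχ : IsLPCutoff χ₀) (N₀ j : ℕ) {a : Sp d → Sp d → Mat N}
    (ha : Continuous (Function.uncurry a)) {X : Type*} [MeasurableSpace X] {f g : X → Sp d}
    (hf : Measurable f) (hg : Measurable g) :
    StronglyMeasurable fun p : X => highSymbol κ χ₀ N₀ j a (f p) (g p) := by
  have := (stronglyMeasurable_highSymbol hκ hχ N₀ j ha).comp_measurable (hf.prodMk hg)
  exact this

/-- The remainder of the para-differential approximation is the semiclassical pseudo-differential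
operator whose symbol is the high frequency part of `a`. -/
theorem diffJ_eq_integral {φ₀ : Sp d → ℝ} {φ : 𝓢(Sp d, ℂ)}
    (hφ : ∀ ξ, φ ξ = φ₀ ((2 * Real.pi) • ξ)) {χ₀ : ℝ → ℝ} (hχ : IsLPCutoff χ₀) (N₀ j : ℕ)
    {a : Sp d → Sp d → Mat N} (ha : Continuous (Function.uncurry a)) {A m : ℝ}
    (hA : ∀ x ξ, ‖a x ξ‖ ≤ A * jap ξ ^ m) (v : 𝓢(Sp d, Val N)) (x : Sp d) :
    diffJ φ₀ χ₀ N₀ j a v x = ∫ ξ, Complex.exp (↑(2 * Real.pi * ⟪ξ, x⟫) * Complex.I) •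
      highSymbol (𝓕⁻ φ : 𝓢(Sp d, ℂ)) χ₀ N₀ j a x (freq j ξ) (𝓕 (v : Sp d → Val N) ξ) := by
  have hax : ∀ ξ, Continuous fun x => a x ξ := fun ξ =>
    ha.comp (f := fun x : Sp d => (x, ξ)) (by fun_prop)
  have haξ : Continuous (a x) := ha.comp (f := fun ξ : Sp d => (x, ξ)) (by fun_prop)
  have hsub : ∀ ξ, paraSymbol φ₀ χ₀ N₀ (dil j a) ((2 : ℝ) ^ (j : ℤ) • x) ξ =
      a x ξ - highSymbol (𝓕⁻ φ : 𝓢(Sp d, ℂ)) χ₀ N₀ j a x ξ := fun ξ =>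
    paraSymbol_dil_eq_sub hφ hχ (hax ξ) (fun x => hA x ξ) j x
  generalize (𝓕⁻ φ : 𝓢(Sp d, ℂ)) = ψ at hsub ⊢
  have hhi : StronglyMeasurable fun ξ => highSymbol ψ χ₀ N₀ j a x ξ :=
    stronglyMeasurable_highSymbol_comp ψ.continuous hχ N₀ j ha measurable_const measurable_id
  have hi1 := integrable_apply_fourier j haξ.stronglyMeasurable (hA x) v
  have hi2 := integrable_apply_fourier j hhi (A := 2 * ((1 + ∫ z, ‖ψ z‖) * A)) (m := m)
    (fun ξ => (norm_highSymbol_le ψ.integrable hχ N₀ j (fun x => hA x ξ) x).trans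
      (le_of_eq (by ring))) v
  rw [diffJ, opJ, op, dilUInv_pdo_dilU, pdoJ_eq_fourierInv, pdoJ_eq_fourierInv]
  simp only [hsub, sub_apply]
  rw [fourierInv_sub_apply hi1 hi2, sub_sub_cancel, Real.fourierInv_eq']

/-- The remainder, composed with the inverse of the weight `⟨2^{-j} ξ⟩^r` in Fourier variables, is
a Hilbert-Schmidt operator. -/
theorem exists_operator_of_highPart_le {φ₀ : Sp d → ℝ} {φ : 𝓢(Sp d, ℂ)}
    (hφ : ∀ ξ, φ ξ = φ₀ ((2 * Real.pi) • ξ)) {χ₀ : ℝ → ℝ} (hχ : IsLPCutoff χ₀) (N₀ j : ℕ)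
    {a : Sp d → Sp d → Mat N} (ha : Continuous (Function.uncurry a)) {A m r s c : ℝ}
    (hA : ∀ x ξ, ‖a x ξ‖ ≤ A * jap ξ ^ m) (hmr : m ≤ r) (hs : (d : ℝ) / 2 < s) (hc : 0 ≤ c)
    {W : ℝ≥0∞} (hW : W ≠ ⊤)
    (h : ∀ (Q : ℤ) (ξ : Sp d), eLpNorm (highPart (𝓕⁻ φ : 𝓢(Sp d, ℂ)) ((2 : ℝ) ^ (-Q))
      fun x => a x ξ) 2 volume ≤ ENNReal.ofReal (c * jap ξ ^ m * ((2 : ℝ) ^ (-Q)) ^ s) * W) :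
    ∃ T : Lp (Val N) 2 (volume : Measure (Sp d)) →ₗ[ℂ] Lp (Val N) 2 (volume : Measure (Sp d)),
      (∀ (v : 𝓢(Sp d, Val N)) (g : Lp (Val N) 2 (volume : Measure (Sp d))),
        (g =ᵐ[volume] fun ξ => ((jap (freq j ξ) ^ r : ℝ) : ℂ) • 𝓕 (v : Sp d → Val N) ξ) →
        T g =ᵐ[volume] diffJ φ₀ χ₀ N₀ j a v) ∧
      ∀ g, ‖T g‖ₑ ≤ ENNReal.ofReal ((2 : ℝ) ^ (-((j : ℝ) * (s - d / 2))) *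
        (2 * c * ((2 : ℝ) ^ N₀) ^ s * √(∫ ξ : Sp d, jap (freq 0 ξ) ^ (-(2 * s))))) * W * ‖g‖ₑ := by
  have hd := fun v x => diffJ_eq_integral hφ hχ N₀ j ha hA v x
  generalize (𝓕⁻ φ : 𝓢(Sp d, ℂ)) = ψ at hd h
  set J : ℝ := ∫ ξ : Sp d, jap (freq 0 ξ) ^ (-(2 * s)) with hJ
  have hJ0 : 0 ≤ J := integral_nonneg fun ξ => Real.rpow_nonneg (jap_pos _).le _
  have hs0 : 0 ≤ s := le_trans (by positivity) hs.le
  set e : Sp d → Sp d → ℂ := fun x ξ => Complex.exp (↑(2 * Real.pi * ⟪ξ, x⟫) * Complex.I) with he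
  have hen : ∀ x ξ, ‖e x ξ‖ = 1 := fun x ξ => Complex.norm_exp_ofReal_mul_I _
  set κ : Sp d → Sp d → Mat N := fun x ξ =>
    (e x ξ * ((jap (freq j ξ) ^ (-r) : ℝ) : ℂ)) • highSymbol ψ χ₀ N₀ j a x (freq j ξ) with hκ
  have hκm : StronglyMeasurable (Function.uncurry κ) := by
    have h1 : Continuous fun p : Sp d × Sp d =>
        e p.1 p.2 * ((jap (freq j p.2) ^ (-r) : ℝ) : ℂ) := by
      refine Continuous.mul (by fun_prop) (Complex.continuous_ofReal.comp ?_)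
      exact (continuous_jap.comp ((continuous_freq j).comp continuous_snd)).rpow_const
        fun p => Or.inl (jap_pos _).ne'
    exact h1.stronglyMeasurable.smul
      (stronglyMeasurable_highSymbol_comp ψ.continuous hχ N₀ j ha measurable_fst
        ((continuous_freq j).measurable.comp measurable_snd))
  -- the decay of the kernel in `ξ`, in `L²` norm with respect to `x`
  set D : ℝ := 2 * c * ((2 : ℝ) ^ N₀) ^ s * (2 : ℝ) ^ (-(j : ℝ) * s) with hD
  have hD0 : 0 ≤ D := by positivity
  have hκξ : ∀ ξ, eLpNorm (fun x => κ x ξ) 2 volume ≤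
      ENNReal.ofReal D * W * ENNReal.ofReal (jap (freq j ξ) ^ (-s)) := by
    intro ξ
    have hj := jap_pos (freq j ξ)
    have h1 := eLpNorm_highSymbol_le (a := a) (ξ := freq j ξ) (c := c * jap (freq j ξ) ^ m)
      ψ.integrable hχ N₀ j
      (ha.comp (f := fun x : Sp d => (x, freq j ξ)) (by fun_prop)) (fun x => hA x (freq j ξ)) hs0
      (by positivity) (fun Q => h Q (freq j ξ))
    have h2 : eLpNorm (fun x => κ x ξ) 2 volume ≤ ENNReal.ofReal (jap (freq j ξ) ^ (-r)) *
        eLpNorm (fun x => highSymbol ψ χ₀ N₀ j a x (freq j ξ)) 2 volume := by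
      refine eLpNorm_le_mul_eLpNorm_of_ae_le_mul (.of_forall fun x => ?_) _
      rw [hκ, norm_smul, norm_mul, hen, one_mul, Complex.norm_real,
        Real.norm_of_nonneg (Real.rpow_nonneg hj.le _)]
    refine (h2.trans (mul_le_mul_right h1 _)).trans ?_
    rw [← mul_assoc, ← ENNReal.ofReal_mul (by positivity), mul_right_comm (ENNReal.ofReal D),
      ← ENNReal.ofReal_mul hD0]
    refine mul_le_mul' (ENNReal.ofReal_le_ofReal ?_) le_rfl
    have h3 : jap (freq j ξ) ^ (-r) * jap (freq j ξ) ^ m ≤ 1 := by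
      rw [← Real.rpow_add hj]
      exact Real.rpow_le_one_of_one_le_of_nonpos (one_le_jap _) (by linarith)
    calc _ = (jap (freq j ξ) ^ (-r) * jap (freq j ξ) ^ m) * (D * jap (freq j ξ) ^ (-s)) := by
          rw [hD]; ring
      _ ≤ _ := mul_le_of_le_one_left (by positivity) h3
  have hH : ∫⁻ ξ, ∫⁻ x, ‖κ x ξ‖ₑ ^ 2 ≤ (ENNReal.ofReal ((2 : ℝ) ^ (-((j : ℝ) * (s - d / 2))) *
        (2 * c * ((2 : ℝ) ^ N₀) ^ s * √J)) * W) ^ 2 := by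
    calc ∫⁻ ξ, ∫⁻ x, ‖κ x ξ‖ₑ ^ 2
        ≤ ∫⁻ ξ : Sp d, (ENNReal.ofReal D * W) ^ 2 *
            ENNReal.ofReal (jap (freq j ξ) ^ (-s)) ^ 2 := by
          refine lintegral_mono fun ξ => ?_
          rw [← eLpNorm_two_sq, ← mul_pow]
          gcongr
          exact hκξ ξ
      _ = (ENNReal.ofReal D * W) ^ 2 * ENNReal.ofReal ((2 : ℝ) ^ ((j : ℝ) * d) * J) := by
          rw [lintegral_const_mul' _ _ (by finiteness), lintegral_jap_freq hs]
      _ = _ := by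
          rw [mul_pow, mul_pow _ W, mul_right_comm, ← ENNReal.ofReal_pow hD0,
            ← ENNReal.ofReal_mul (by positivity), ← ENNReal.ofReal_pow (by positivity)]
          congr 2
          have h5 : ((2 : ℝ) ^ (-(j : ℝ) * s)) ^ 2 * (2 : ℝ) ^ ((j : ℝ) * d) =
              ((2 : ℝ) ^ (-((j : ℝ) * (s - d / 2)))) ^ 2 := by
            rw [← Real.rpow_natCast, ← Real.rpow_natCast, ← Real.rpow_mul zero_le_two,
              ← Real.rpow_mul zero_le_two, ← Real.rpow_add two_pos]
            congr 1
            push_cast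
            ring
          rw [mul_pow ((2 : ℝ) ^ (-((j : ℝ) * (s - d / 2)))), ← h5, hD, mul_pow _ √J,
            Real.sq_sqrt hJ0]
          ring
  obtain ⟨T, hT, hTb⟩ := exists_hilbertSchmidt hκm (by finiteness) hH
  refine ⟨T, fun v g hg => (hT g).trans (.of_forall fun x => ?_), hTb⟩
  simp only
  rw [hd]
  refine integral_congr_ae ?_
  filter_upwards [hg] with ξ hξ
  have hj := jap_pos (freq j ξ)
  rw [hξ, hκ, smul_apply, map_smul, smul_smul, mul_assoc, ← Complex.ofReal_mul,
    ← Real.rpow_add hj, neg_add_cancel, Real.rpow_zero, Complex.ofReal_one, mul_one]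

end Remainder

/-! ### Weighted Fourier transforms on Sobolev spaces -/

section WeightedFourier

variable {d N : ℕ}

theorem toTemperedDistribution_injective {f g : Lp (Val N) 2 (volume : Measure (Sp d))}
    (h : (f : 𝓢'(Sp d, Val N)) = g) : f = g := by
  have hk := Lp.ker_toTemperedDistributionCLM_eq_bot (E := Sp d) (F := Val N) (μ := volume) (p := 2)
  exact LinearMap.ker_eq_bot.1 hk h

theorem smulLeftCLM_coe_schwartz {g : Sp d → ℂ} (hg : g.HasTemperateGrowth)
    (f : 𝓢(Sp d, Val N)) : smulLeftCLM (Val N) g (f : 𝓢'(Sp d, Val N)) =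
      (SchwartzMap.smulLeftCLM (Val N) g f : 𝓢(Sp d, Val N)) := by
  ext1 u
  rw [smulLeftCLM_apply_apply, SchwartzMap.coe_apply, SchwartzMap.coe_apply]
  refine integral_congr_ae (.of_forall fun ξ => ?_)
  simp only [SchwartzMap.smulLeftCLM_apply_apply hg, smul_smul, smul_eq_mul, mul_comm]

theorem rpow_le_add_rpow {α β t : ℝ} (hα : 0 < α) (h1 : α ≤ t) (h2 : t ≤ β) (r : ℝ) :
    t ^ r ≤ α ^ r + β ^ r := by
  have ht : 0 < t := hα.trans_le h1
  rcases le_total 0 r with hr | hr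
  · have := Real.rpow_le_rpow ht.le h2 hr
    have := Real.rpow_nonneg hα.le r
    linarith
  · have := Real.rpow_le_rpow_of_nonpos hα h1 hr
    have := Real.rpow_nonneg (ht.le.trans h2) r
    linarith

/-- Semiclassical and ordinary weights are comparable, with constants that depend on `j`. -/
theorem exists_jap_freq_rpow_mul_le (j : ℕ) (r : ℝ) :
    ∃ C : ℝ, ∀ ξ : Sp d, jap (freq j ξ) ^ r * (1 + ‖ξ‖ ^ 2) ^ (-r / 2) ≤ C := by
  set c : ℝ := (2 : ℝ) ^ (-(j : ℤ)) * (2 * Real.pi) with hc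
  have hc0 : 0 < c := by positivity
  refine ⟨(min 1 (c ^ 2)) ^ (r / 2) + (max 1 (c ^ 2)) ^ (r / 2), fun ξ => ?_⟩
  have hn : ‖freq j ξ‖ ^ 2 = c ^ 2 * ‖ξ‖ ^ 2 := by
    rw [freq, smul_smul, norm_smul, Real.norm_of_nonneg hc0.le, mul_pow]
  have hp : 0 < 1 + ‖ξ‖ ^ 2 := by positivity
  have hsq := sq_nonneg ‖ξ‖
  rw [jap_rpow, hn, neg_div, Real.rpow_neg hp.le, ← div_eq_mul_inv,
    ← Real.div_rpow (by positivity) hp.le]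
  refine rpow_le_add_rpow (lt_min one_pos (by positivity)) ?_ ?_ _
  · rw [le_div_iff₀ hp, mul_add, mul_one]
    exact add_le_add (min_le_left _ _) (mul_le_mul_of_nonneg_right (min_le_right _ _) hsq)
  · rw [div_le_iff₀ hp, mul_add, mul_one]
    exact add_le_add (le_max_left _ _) (mul_le_mul_of_nonneg_right (le_max_right _ _) hsq)

/-- The infimum that defines `‖v‖_{j,r}` is over a nonempty set when `v ∈ H^r`. -/
theorem exists_smulLeftCLM_fourier_eq (j : ℕ) {r : ℝ} {f : 𝓢'(Sp d, Val N)}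
    (hf : MemSobolev r 2 f) : ∃ g : Lp (Val N) 2 (volume : Measure (Sp d)),
      smulLeftCLM (Val N) (fun ξ : Sp d => ((jap (freq j ξ) ^ r : ℝ) : ℂ)) (𝓕 f) =
        (g : 𝓢'(Sp d, Val N)) := by
  obtain ⟨f', hf'⟩ := memSobolev_iff_exists_smulLeftCLM_fourier.1 hf
  obtain ⟨C, hC⟩ := exists_jap_freq_rpow_mul_le (d := d) j r
  set w : Sp d → ℂ := fun ξ => ((jap (freq j ξ) ^ r : ℝ) : ℂ) with hw
  have hwt : w.HasTemperateGrowth := hasTemperateGrowth_jap_freq j r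
  have ht1 : (fun ξ : Sp d => (((1 + ‖ξ‖ ^ 2) ^ (r / 2) : ℝ) : ℂ)).HasTemperateGrowth := by
    fun_prop
  have ht2 : (fun ξ : Sp d => (((1 + ‖ξ‖ ^ 2) ^ (-r / 2) : ℝ) : ℂ)).HasTemperateGrowth := by
    fun_prop
  -- the quotient of the two weights is bounded, hence acts on `L²`
  set q : Sp d → ℂ := w * fun ξ : Sp d => (((1 + ‖ξ‖ ^ 2) ^ (-r / 2) : ℝ) : ℂ) with hq
  have hqt : q.HasTemperateGrowth := hwt.mul ht2
  have hqm : MemLp q ⊤ (volume : Measure (Sp d)) := by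
    refine memLp_top_of_bound hqt.1.continuous.aestronglyMeasurable C (.of_forall fun ξ => ?_)
    have h1 : 0 ≤ jap (freq j ξ) ^ r := Real.rpow_nonneg (jap_pos _).le _
    rw [hq, Pi.mul_apply, hw, norm_mul, Complex.norm_real, Complex.norm_real,
      Real.norm_of_nonneg h1, Real.norm_of_nonneg (by positivity)]
    exact hC ξ
  refine ⟨hqm.toLp q • f', ?_⟩
  rw [Lp.toTemperedDistribution_smul_eq hqt hqm, ← hf', smulLeftCLM_smulLeftCLM_apply ht1 hqt]
  congr 2
  funext ξ
  have hp : 0 < 1 + ‖ξ‖ ^ 2 := by positivity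
  rw [Pi.mul_apply, hq, Pi.mul_apply, mul_left_comm, ← Complex.ofReal_mul, ← Real.rpow_add hp,
    show r / 2 + -r / 2 = 0 by ring, Real.rpow_zero, Complex.ofReal_one, mul_one]

/-- The infimum that defines `‖v‖_{j,r}` is over at most one function. -/
theorem wNorm_eq {j : ℕ} {r : ℝ} {f : 𝓢'(Sp d, Val N)}
    {g : Lp (Val N) 2 (volume : Measure (Sp d))}
    (hg : smulLeftCLM (Val N) (fun ξ : Sp d => ((jap (freq j ξ) ^ r : ℝ) : ℂ)) (𝓕 f) =
      (g : 𝓢'(Sp d, Val N))) : wNorm j r f = ‖g‖ₑ := by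
  refine le_antisymm (iInf₂_le g hg) (le_iInf₂ fun g' hg' => ?_)
  rw [toTemperedDistribution_injective (hg.symm.trans hg')]

/-- The map `v ↦ ⟨2^{-j} ξ⟩^r v̂` from `H^r` to `L²`; it computes the norm `‖·‖_{j,r}`. -/
theorem exists_weightedFourier (j : ℕ) (r : ℝ) :
    ∃ G : HSpace d N r →ₗ[ℂ] Lp (Val N) 2 (volume : Measure (Sp d)),
      (∀ v : HSpace d N r, ‖G v‖ₑ = wNorm j r (v : 𝓢'(Sp d, Val N))) ∧
      ∀ v : 𝓢(Sp d, Val N), G (schwartzToH r v) =ᵐ[volume] fun ξ =>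
        ((jap (freq j ξ) ^ r : ℝ) : ℂ) • 𝓕 (v : Sp d → Val N) ξ := by
  choose G hG using fun v : HSpace d N r => exists_smulLeftCLM_fourier_eq j v.2
  have hinj : ∀ (v : HSpace d N r) (g : Lp (Val N) 2 (volume : Measure (Sp d))),
      smulLeftCLM (Val N) (fun ξ : Sp d => ((jap (freq j ξ) ^ r : ℝ) : ℂ))
        (𝓕 (v : 𝓢'(Sp d, Val N))) = (g : 𝓢'(Sp d, Val N)) → G v = g := fun v g hg =>
    toTemperedDistribution_injective ((hG v).symm.trans hg)
  refine ⟨{ toFun := G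
            map_add' := fun v v' => hinj _ _ ?_
            map_smul' := fun c v => hinj _ _ ?_ }, fun v => (wNorm_eq (hG v)).symm, fun v => ?_⟩
  · have : 𝓕 ((v + v' : HSpace d N r) : 𝓢'(Sp d, Val N)) =
        𝓕 (v : 𝓢'(Sp d, Val N)) + 𝓕 (v' : 𝓢'(Sp d, Val N)) := FourierTransform.fourier_add _ _
    rw [this, map_add, hG v, hG v']
    exact (map_add (Lp.toTemperedDistributionCLM (Val N) volume 2) _ _).symm
  · have : 𝓕 ((c • v : HSpace d N r) : 𝓢'(Sp d, Val N)) = c • 𝓕 (v : 𝓢'(Sp d, Val N)) :=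
      FourierTransform.fourier_smul _ _
    rw [this, map_smul, hG v]
    exact (map_smul (Lp.toTemperedDistributionCLM (Val N) volume 2) _ _).symm
  · have ht := hasTemperateGrowth_jap_freq (d := d) j r
    have h := hinj (schwartzToH r v) ((SchwartzMap.smulLeftCLM (Val N)
      (fun ξ : Sp d => ((jap (freq j ξ) ^ r : ℝ) : ℂ)) (𝓕 v)).toLp 2) (by
        rw [Lp.toTemperedDistribution_toLp_eq, ← smulLeftCLM_coe_schwartz ht,
          ← fourier_toTemperedDistributionCLM_eq]
        rfl)
    have h2 := SchwartzMap.coeFn_toLp (SchwartzMap.smulLeftCLM (Val N)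
      (fun ξ : Sp d => ((jap (freq j ξ) ^ r : ℝ) : ℂ)) (𝓕 v)) 2 (volume : Measure (Sp d))
    rw [LinearMap.coe_mk, AddHom.coe_mk, h]
    filter_upwards [h2] with ξ hξ
    rw [hξ, SchwartzMap.smulLeftCLM_apply_apply ht, SchwartzMap.fourier_coe]

end WeightedFourier

/-! ### Sobolev functions above the embedding threshold -/

section SobolevFunctions

variable {d n N : ℕ}

theorem memLp_jap_freq_rpow_neg {s : ℝ} (hs : (d : ℝ) / 2 < s) :
    MemLp (fun ξ : Sp d => ((jap (freq 0 ξ) ^ (-s) : ℝ) : ℂ)) 2 volume := by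
  refine ⟨(hasTemperateGrowth_jap_freq 0 (-s)).1.continuous.aestronglyMeasurable, ?_⟩
  refine (or_iff_left two_ne_zero).1 (ENNReal.pow_lt_top_iff (n := 2).1 ?_)
  rw [eLpNorm_two_sq]
  have h := lintegral_jap_freq hs 0
  refine lt_of_eq_of_lt ?_ (h.trans_lt ENNReal.ofReal_lt_top)
  refine lintegral_congr fun ξ => ?_
  rw [← ofReal_norm, Complex.norm_real, Real.norm_of_nonneg (Real.rpow_nonneg (jap_pos _).le _)]

theorem norm_le_jap_freq_zero (ξ : Sp d) : ‖ξ‖ ≤ jap (freq 0 ξ) := by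
  have hpi : 1 ≤ 2 * Real.pi := by linarith [Real.pi_gt_three]
  refine Real.le_sqrt_of_sq_le ?_
  rw [freq, norm_smul, norm_smul, Real.norm_of_nonneg (zero_le_one.trans hpi)]
  simp only [Nat.cast_zero, neg_zero, zpow_zero, norm_one, one_mul]
  have : ‖ξ‖ ≤ 2 * Real.pi * ‖ξ‖ := le_mul_of_one_le_left (norm_nonneg _) hpi
  nlinarith [norm_nonneg ξ]

/-- For `s > d/2`, a function in `H^s` is the inverse Fourier transform of an integrable
function. -/
theorem exists_fourierInv_ae_eq_of_memHs {s : ℝ} (hs : (d : ℝ) / 2 < s) {u : Sp d → Sp n}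
    (hu : MemHs s u) : ∃ g : Sp d → Val n, Integrable g ∧ MemLp g 2 volume ∧
      𝓕⁻ g =ᵐ[volume] complexify u ∧ eLpNorm g 2 volume ≤ hsNorm s u ∧
      eLpNorm (fun ξ => ‖ξ‖ ^ s • g ξ) 2 volume ≤ hsNorm s u ∧ hsNorm s u ≠ ⊤ := by
  obtain ⟨h, hsob⟩ := hu
  have hs0 : 0 ≤ s := le_trans (by positivity) hs.le
  obtain ⟨g₀, hg₀⟩ := exists_smulLeftCLM_fourier_eq 0 hsob
  have hnorm : hsNorm s u = ‖g₀‖ₑ := by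
    rw [hsNorm, iInf_pos h]
    exact wNorm_eq hg₀
  set f : Lp (Val n) 2 (volume : Measure (Sp d)) := h.toLp (complexify u) with hf
  set q : Sp d → ℂ := fun ξ => ((jap (freq 0 ξ) ^ (-s) : ℝ) : ℂ) with hq
  have hqt : q.HasTemperateGrowth := hasTemperateGrowth_jap_freq 0 (-s)
  have hqn : ∀ ξ, ‖q ξ‖ = jap (freq 0 ξ) ^ (-s) := fun ξ => by
    rw [hq, Complex.norm_real, Real.norm_of_nonneg (Real.rpow_nonneg (jap_pos _).le _)]
  have hq1 : ∀ ξ, ‖q ξ‖ ≤ 1 := fun ξ => by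
    rw [hqn]
    exact Real.rpow_le_one_of_one_le_of_nonpos (one_le_jap _) (by linarith)
  have hqm : MemLp q ⊤ (volume : Measure (Sp d)) :=
    memLp_top_of_bound hqt.1.continuous.aestronglyMeasurable 1 (.of_forall hq1)
  -- division by the weight recovers the Fourier transform
  have hdiv : 𝓕 f = (hqm.toLp q • g₀ : Lp (Val n) 2 (volume : Measure (Sp d))) := by
    refine toTemperedDistribution_injective ?_
    rw [Lp.toTemperedDistribution_smul_eq hqt hqm, ← hg₀, smulLeftCLM_smulLeftCLM_apply
      (hasTemperateGrowth_jap_freq 0 s) hqt, ← Lp.fourier_toTemperedDistribution_eq]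
    have : ((fun ξ : Sp d => ((jap (freq 0 ξ) ^ s : ℝ) : ℂ)) * q) = fun _ => 1 := by
      funext ξ
      rw [Pi.mul_apply, hq, ← Complex.ofReal_mul, ← Real.rpow_add (jap_pos _), add_neg_cancel,
        Real.rpow_zero, Complex.ofReal_one]
    rw [this, smulLeftCLM_const, one_smul]
  have hae : (𝓕 f : Lp (Val n) 2 (volume : Measure (Sp d))) =ᵐ[volume] fun ξ => q ξ • g₀ ξ := by
    rw [hdiv]
    filter_upwards [Lp.coeFn_lpSMul (r := 2) (hqm.toLp q) g₀, hqm.coeFn_toLp] with ξ h1 h2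
    rw [h1, Pi.smul_apply', h2]
  have hgL2 : MemLp (𝓕 f : Lp (Val n) 2 (volume : Measure (Sp d))) 2 volume := Lp.memLp _
  have hgL1 : Integrable (𝓕 f : Lp (Val n) 2 (volume : Measure (Sp d))) := by
    refine Integrable.congr ?_ hae.symm
    rw [← memLp_one_iff_integrable]
    exact (Lp.memLp g₀).smul (memLp_jap_freq_rpow_neg hs)
  have hinv : 𝓕⁻ ((𝓕 f : Lp (Val n) 2 (volume : Measure (Sp d))) : Sp d → Val n) =ᵐ[volume]
      complexify u := by
    have h1 := fourierInv_toLp_ae_eq hgL1 hgL2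
    rw [Lp.toLp_coeFn, FourierPair.fourierInv_fourier_eq] at h1
    exact h1.symm.trans h.coeFn_toLp
  refine ⟨_, hgL1, hgL2, hinv, ?_, ?_, hnorm ▸ enorm_ne_top⟩
  · rw [hnorm, Lp.enorm_def]
    refine eLpNorm_mono_ae (hae.mono fun ξ hξ => ?_)
    rw [hξ, norm_smul]
    exact mul_le_of_le_one_left (norm_nonneg _) (hq1 ξ)
  · rw [hnorm, Lp.enorm_def]
    refine eLpNorm_mono_ae (hae.mono fun ξ hξ => ?_)
    rw [hξ, norm_smul, norm_smul, ← mul_assoc, hqn, Real.norm_of_nonneg (by positivity)]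
    refine mul_le_of_le_one_left (norm_nonneg _) ?_
    calc ‖ξ‖ ^ s * jap (freq 0 ξ) ^ (-s) ≤ jap (freq 0 ξ) ^ s * jap (freq 0 ξ) ^ (-s) := by
          gcongr
          · exact Real.rpow_nonneg (jap_pos _).le _
          · exact norm_le_jap_freq_zero ξ
      _ = 1 := by rw [← Real.rpow_add (jap_pos _), add_neg_cancel, Real.rpow_zero]

/-- The real part of a vector of `ℂ^n`. -/
noncomputable def rePart (n : ℕ) : Val n →L[ℝ] Sp n :=
  LinearMap.mkContinuous
    { toFun := fun z => WithLp.toLp 2 fun i => (z i).re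
      map_add' := fun z w => by ext i; simp
      map_smul' := fun c z => by ext i; simp } 1 fun z => by
    rw [one_mul, EuclideanSpace.norm_eq, EuclideanSpace.norm_eq]
    refine Real.sqrt_le_sqrt (Finset.sum_le_sum fun i _ => ?_)
    gcongr
    exact Complex.abs_re_le_norm (z i)

theorem norm_rePart_le : ‖rePart n‖ ≤ 1 := LinearMap.mkContinuous_norm_le _ zero_le_one _

theorem rePart_complexify (u : Sp d → Sp n) (x : Sp d) : rePart n (complexify u x) = u x := by
  ext i
  change ((u x i : ℝ) : ℂ).re = u x i
  exact Complex.ofReal_re _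

theorem norm_complexify (u : Sp d → Sp n) (x : Sp d) : ‖complexify u x‖ = ‖u x‖ := by
  rw [EuclideanSpace.norm_eq, EuclideanSpace.norm_eq]
  congr 1
  refine Finset.sum_congr rfl fun i _ => ?_
  rw [complexify, Complex.norm_real]

/-- A continuous function is everywhere bounded by the essential supremum of a function equal to it
almost everywhere. -/
theorem norm_le_eLpNorm_top_of_ae_eq {U : Sp d → Val n} (hU : Continuous U) {B : ℝ}
    (hB : ∀ x, ‖U x‖ ≤ B) {u : Sp d → Sp n} (hUu : U =ᵐ[volume] complexify u) (x : Sp d) :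
    ‖U x‖ ≤ (eLpNorm u ⊤ volume).toReal := by
  have e : eLpNorm u ⊤ volume = eLpNorm U ⊤ volume := by
    refine eLpNorm_congr_norm_ae (hUu.mono fun x hx => ?_)
    rw [hx, norm_complexify]
  have hfin : eLpNorm U ⊤ volume ≠ ⊤ :=
    (memLp_top_of_bound hU.aestronglyMeasurable B (.of_forall hB)).2.ne
  have hae : ∀ᵐ x, ‖U x‖ ≤ (eLpNorm U ⊤ volume).toReal := by
    have := ae_le_eLpNormEssSup (f := U) (μ := (volume : Measure (Sp d)))
    filter_upwards [this] with x hx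
    rw [← eLpNorm_exponent_top] at hx
    rw [← toReal_enorm]
    exact ENNReal.toReal_mono hfin hx
  rw [e]
  have hcl : IsClosed {x | ‖U x‖ ≤ (eLpNorm U ⊤ volume).toReal} :=
    isClosed_le hU.norm continuous_const
  have hd : Dense {x | ‖U x‖ ≤ (eLpNorm U ⊤ volume).toReal} :=
    Measure.dense_of_ae hae
  exact hcl.closure_subset (hd x)

end SobolevFunctions

/-! ### Symbol estimates -/

section Symbols

variable {d n N : ℕ}

/-- Extending a function of `ℝ^n` to `ℂ^n` through the real part does not increase its
derivatives. -/
theorem norm_iteratedFDeriv_comp_rePart_le {X : Type*} [NormedAddCommGroup X] [NormedSpace ℝ X]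
    {f : Sp n → X} (hf : ContDiff ℝ ∞ f) (k : ℕ) (z : Val n) :
    ‖iteratedFDeriv ℝ k (fun z => f (rePart n z)) z‖ ≤ ‖iteratedFDeriv ℝ k f (rePart n z)‖ := by
  have h := (rePart n).iteratedFDeriv_comp_right hf z (i := k) (by exact_mod_cast le_top)
  have e : iteratedFDeriv ℝ k (fun z => f (rePart n z)) z =
    (iteratedFDeriv ℝ k f (rePart n z)).compContinuousLinearMap fun _ => rePart n := h
  rw [e]
  refine (ContinuousMultilinearMap.norm_compContinuousLinearMap_le _ _).trans ?_
  refine mul_le_of_le_one_right (norm_nonneg _) ?_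
  rw [Finset.prod_const]
  exact pow_le_one₀ (norm_nonneg _) norm_rePart_le

theorem IsSmoothSymbol.contDiff_left {m : ℝ} {σ : Sp n → Sp d → Mat N} (hσ : IsSmoothSymbol m σ)
    (ξ : Sp d) : ContDiff ℝ ∞ fun w => σ w ξ :=
  hσ.1.comp (contDiff_id.prodMk contDiff_const)

/-- The symbol estimates for derivatives in the first variable up to order `K`, with one monotone
constant. -/
theorem IsSmoothSymbol.exists_norm_iteratedFDeriv_le {m : ℝ} {σ : Sp n → Sp d → Mat N}
    (hσ : IsSmoothSymbol m σ) (K : ℕ) : ∃ C : ℝ → ℝ, Monotone C ∧ (∀ R, 0 ≤ C R) ∧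
      ∀ (R : ℝ) (k : ℕ), k ≤ K → ∀ (w : Sp n) (ξ : Sp d), ‖w‖ ≤ R →
        ‖iteratedFDeriv ℝ k (fun w => σ w ξ) w‖ ≤ C R * jap ξ ^ m := by
  choose c hcm hc using fun k => hσ.2 k 0
  refine ⟨fun R => ∑ k ∈ Finset.range (K + 1), max (c k R) 0, fun R R' h =>
    Finset.sum_le_sum fun k _ => max_le_max (hcm k h) le_rfl,
    fun R => Finset.sum_nonneg fun k _ => le_max_right _ _, fun R k hk w ξ hw => ?_⟩
  have hj := jap_pos ξ
  have h1 := hc k w ξ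
  have e : ‖iteratedFDeriv ℝ k (fun w' => iteratedFDeriv ℝ 0 (fun ξ' => σ w' ξ') ξ) w‖ =
      ‖iteratedFDeriv ℝ k (fun w => σ w ξ) w‖ := by
    have : (fun w' => iteratedFDeriv ℝ 0 (fun ξ' => σ w' ξ') ξ) =
        (continuousMultilinearCurryFin0 ℝ (Sp d) (Mat N)).symm ∘ fun w' => σ w' ξ := by
      funext w'
      rw [iteratedFDeriv_zero_eq_comp]
      rfl
    rw [this, LinearIsometryEquiv.norm_iteratedFDeriv_comp_left]
  rw [e, Nat.cast_zero, zero_sub, Real.rpow_neg hj.le, inv_mul_le_iff₀ (Real.rpow_pos_of_pos hj m),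
    mul_comm] at h1
  refine h1.trans ?_
  gcongr
  exact (hcm k hw).trans ((le_max_left _ _).trans
    (Finset.single_le_sum (f := fun k => max (c k R) 0) (fun k _ => le_max_right _ _)
      (Finset.mem_range.2 (by omega))))

end Symbols

/-! ### The estimate of the remainder -/

section Estimate

variable {d n N : ℕ}

/-- Only the almost everywhere class of the symbol matters: `paraSymbol` integrates it, and `pdoJ`
evaluates it at the point `x` alone. -/
theorem diffJ_congr_ae {φ₀ : Sp d → ℝ} {χ₀ : ℝ → ℝ} {N₀ j : ℕ} {a a' : Sp d → Sp d → Mat N}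
    (h : ∀ᵐ x, a x = a' x) (v : Sp d → Val N) :
    diffJ φ₀ χ₀ N₀ j a v =ᵐ[volume] diffJ φ₀ χ₀ N₀ j a' v := by
  have hp : paraSymbol φ₀ χ₀ N₀ (dil j a) = paraSymbol φ₀ χ₀ N₀ (dil j a') := by
    funext x ξ
    exact paraSymbol_congr_ae φ₀ χ₀ N₀ (ae_dil h) x ξ
  filter_upwards [h] with x hx
  rw [diffJ, diffJ, opJ, opJ, op, op, hp, pdoJ, pdoJ, hx]

/-- The estimate on `H^r` for every `r ≥ m`, always with the power `2^{-j(s - d/2)}`. -/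
theorem exists_extends_diffJ_le (m : ℝ) {s : ℝ} (hs : (d : ℝ) / 2 < s)
    {φ₀ : Sp d → ℝ} (hφ₀ : IsLPCutoff φ₀) {χ₀ : ℝ → ℝ} (hχ₀ : IsLPCutoff χ₀) (N₀ : ℕ)
    {σ : Sp n → Sp d → Mat N} (hσ : IsSmoothSymbol m σ) :
    ∃ C : ℝ≥0 → ℝ≥0, Monotone C ∧ ∀ u : Sp d → Sp n, MemHs s u → ∀ (j : ℕ) (r : ℝ), m ≤ r →
      ∃ T : HSpace d N r →ₗ[ℂ] Lp (Val N) 2 (volume : Measure (Sp d)),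
        Extends T (diffJ φ₀ χ₀ N₀ j (fun x ξ => σ (u x) ξ)) ∧
        ∀ v : HSpace d N r, ‖T v‖ₑ ≤ ENNReal.ofReal ((2 : ℝ) ^ (-((j : ℝ) * (s - d / 2)))) *
          C (eLpNorm u ⊤ volume).toNNReal * hsNorm s u * wNorm j r (v : 𝓢'(Sp d, Val N)) := by
  obtain ⟨φ, hφ, ε, hε, hφ1⟩ := exists_schwartz_eq_cutoff hφ₀
  have hs0 : 0 ≤ s := le_trans (by positivity) hs.le
  obtain ⟨C₁, K, R₀, hC₁, hR₀, hmoser⟩ := exists_eLpNorm_highPart_comp_le (Y := Val n) (Z := Mat N)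
    φ hε hφ1 hs0
  obtain ⟨A, hAmono, hA0, hA⟩ := hσ.exists_norm_iteratedFDeriv_le K
  set J : ℝ := √(∫ ξ : Sp d, jap (freq 0 ξ) ^ (-(2 * s))) with hJ
  set c : ℝ → ℝ := fun b => C₁ * A (R₀ * b) * (1 + b) ^ K with hc
  set C₂ : ℝ := 2 * ((2 : ℝ) ^ N₀) ^ s * J with hC₂
  have hC₂0 : 0 ≤ C₂ := by positivity
  have hc0 : ∀ b, 0 ≤ b → 0 ≤ c b := fun b hb =>
    mul_nonneg (mul_nonneg hC₁ (hA0 _)) (by positivity)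
  refine ⟨fun b => (C₂ * c b).toNNReal, fun b b' hbb => ?_, fun u hu j r hr => ?_⟩
  · have hbb' : (b : ℝ) ≤ b' := hbb
    have := hA0 (R₀ * b)
    have := hA0 (R₀ * b')
    have := b.2
    refine Real.toNNReal_le_toNNReal (mul_le_mul_of_nonneg_left ?_ hC₂0)
    simp only [hc]
    gcongr
    exact hAmono (by gcongr)
  obtain ⟨g, hg1, hg2, hgu, hW, hWs, hWtop⟩ := exists_fourierInv_ae_eq_of_memHs hs hu
  set W := hsNorm s u with hWdef
  set b : ℝ := (eLpNorm u ⊤ volume).toReal with hb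
  have hb0 : 0 ≤ b := ENNReal.toReal_nonneg
  -- the continuous representative of `u`
  set U : Sp d → Val n := 𝓕⁻ g with hU
  have hUc : Continuous U := continuous_fourierInv hg1
  have hUb : ∀ x, ‖U x‖ ≤ b := norm_le_eLpNorm_top_of_ae_eq hUc
    (B := ∫ ξ, ‖g ξ‖) (fun x => by
      rw [hU, Real.fourierInv_eq']
      refine norm_integral_le_of_norm_le hg1.norm (.of_forall fun ξ => ?_)
      rw [norm_smul, Complex.norm_exp_ofReal_mul_I, one_mul]) hgu
  set a : Sp d → Sp d → Mat N := fun x ξ => σ (rePart n (U x)) ξ with ha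
  have hac : Continuous (Function.uncurry a) := hσ.1.continuous.comp
    (f := fun p : Sp d × Sp d => (rePart n (U p.1), p.2)) (by fun_prop)
  have hau : ∀ᵐ x, (fun x ξ => σ (u x) ξ) x = a x := by
    filter_upwards [hgu] with x hx
    simp only [ha, hx, rePart_complexify]
  have hre : ∀ z : Val n, ‖rePart n z‖ ≤ ‖z‖ := fun z =>
    ((rePart n).le_opNorm z).trans (mul_le_of_le_one_left (norm_nonneg _) norm_rePart_le)
  have hbR : b ≤ R₀ * b := le_mul_of_one_le_left hb0 hR₀
  have hder : ∀ (ξ : Sp d) (k : ℕ), k ≤ K → ∀ z : Val n, ‖z‖ ≤ R₀ * b →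
      ‖iteratedFDeriv ℝ k (fun z => σ (rePart n z) ξ) z‖ ≤ A (R₀ * b) * jap ξ ^ m :=
    fun ξ k hk z hz => (norm_iteratedFDeriv_comp_rePart_le (hσ.contDiff_left ξ) k z).trans
      (hA _ k hk _ ξ ((hre z).trans hz))
  have habound : ∀ x ξ, ‖a x ξ‖ ≤ A (R₀ * b) * jap ξ ^ m := fun x ξ => by
    simpa using hder ξ 0 (Nat.zero_le _) (U x) ((hUb x).trans hbR)
  have hhigh : ∀ (Q : ℤ) (ξ : Sp d), eLpNorm (highPart (𝓕⁻ φ : 𝓢(Sp d, ℂ)) ((2 : ℝ) ^ (-Q))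
      fun x => a x ξ) 2 volume ≤
        ENNReal.ofReal (c b * jap ξ ^ m * ((2 : ℝ) ^ (-Q)) ^ s) * W := by
    intro Q ξ
    refine (hmoser (fun z => σ (rePart n z) ξ) (A (R₀ * b) * jap ξ ^ m) b g W Q
      ((hσ.contDiff_left ξ).comp (rePart n).contDiff)
      (mul_nonneg (hA0 _) (Real.rpow_nonneg (jap_pos ξ).le _)) hg1 hg2 hUb (hder ξ) hW hWs).trans
      (le_of_eq ?_)
    congr 2
    rw [hc]
    ring
  obtain ⟨T, hT, hTb⟩ := exists_operator_of_highPart_le hφ hχ₀ N₀ j hac habound hr hs (hc0 b hb0)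
    hWtop hhigh
  obtain ⟨G, hG, hGv⟩ := exists_weightedFourier (d := d) (N := N) j r
  refine ⟨T ∘ₗ G, fun v => ?_, fun v => ?_⟩
  · rw [LinearMap.comp_apply]
    exact (hT v _ (hGv v)).trans (diffJ_congr_ae hau v).symm
  · rw [LinearMap.comp_apply, ← hG]
    refine (hTb (G v)).trans (le_of_eq ?_)
    congr 2
    change _ = _ * ENNReal.ofReal (C₂ * c b)
    rw [ENNReal.ofReal_mul (by positivity)]
    congr 2
    rw [hC₂]
    ring

end Estimate

end ParaDiff

theorem mainTheorem3 {d n N : ℕ} (m s : ℝ) (hs : (d : ℝ) / 2 < s)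
    (φ₀ : ParaDiff.Sp d → ℝ) (hφ₀ : ParaDiff.IsLPCutoff φ₀)
    (χ₀ : ℝ → ℝ) (hχ₀ : ParaDiff.IsLPCutoff χ₀)
    (N₀ : ℕ) (hN₀ : 3 ≤ N₀)
    (σ : ParaDiff.Sp n → ParaDiff.Sp d → ParaDiff.Mat N)
    (hσ : ParaDiff.IsSmoothSymbol m σ) :
    ∃ C : ℝ≥0 → ℝ≥0, Monotone C ∧
      ∀ u : ParaDiff.Sp d → ParaDiff.Sp n, ParaDiff.MemHs s u → ∀ j : ℕ,
        (∃ T : ParaDiff.HSpace d N (m + d / 2) →ₗ[ℂ]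
            Lp (ParaDiff.Val N) 2 (volume : Measure (ParaDiff.Sp d)),
          ParaDiff.Extends T (ParaDiff.diffJ φ₀ χ₀ N₀ j (fun x ξ => σ (u x) ξ)) ∧
          ∀ v : ParaDiff.HSpace d N (m + d / 2),
            ‖T v‖ₑ ≤ ENNReal.ofReal ((2 : ℝ) ^ (-((j : ℝ) * (s - d / 2)))) *
              C (eLpNorm u ∞ volume).toNNReal * ParaDiff.hsNorm s u *
              ParaDiff.wNorm j (m + d / 2) (v : 𝓢'(ParaDiff.Sp d, ParaDiff.Val N))) ∧
        ((d : ℝ) < s →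
          ∃ T : ParaDiff.HSpace d N m →ₗ[ℂ]
            Lp (ParaDiff.Val N) 2 (volume : Measure (ParaDiff.Sp d)),
          ParaDiff.Extends T (ParaDiff.diffJ φ₀ χ₀ N₀ j (fun x ξ => σ (u x) ξ)) ∧
          ∀ v : ParaDiff.HSpace d N m,
            ‖T v‖ₑ ≤ ENNReal.ofReal ((2 : ℝ) ^ (-((j : ℝ) * (s - d)))) *
              C (eLpNorm u ∞ volume).toNNReal * ParaDiff.hsNorm s u *
              ParaDiff.wNorm j m (v : 𝓢'(ParaDiff.Sp d, ParaDiff.Val N))) := by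
  obtain ⟨C, hC, h⟩ := ParaDiff.exists_extends_diffJ_le m hs hφ₀ hχ₀ N₀ hσ
  refine ⟨C, hC, fun u hu j => ⟨h u hu j _ (le_add_of_nonneg_right (by positivity)), fun _ => ?_⟩⟩
  obtain ⟨T, hT, hTb⟩ := h u hu j m le_rfl
  refine ⟨T, hT, fun v => (hTb v).trans ?_⟩
  have hd : (0 : ℝ) ≤ d := Nat.cast_nonneg d
  have he : -((j : ℝ) * (s - d / 2)) ≤ -((j : ℝ) * (s - d)) :=
    neg_le_neg (mul_le_mul_of_nonneg_left (by linarith) (Nat.cast_nonneg j))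
  gcongr
  exact one_le_two
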